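/- Let $\Delta\ge 0$ be an integer and let $0<\beta<1$ and $\lambda>0$ be real numbers with $$\beta\ \ge\ 1-\frac{2}{2e^{-1/2}\Delta+3}.$$ For a finite hypergraph $G=(V,\mathcal E)$, $\mathcal E\subseteq 2^V$, the partition function of the anti-ferromagnetic Ising model with interaction parameter $\beta$ and external field $\lambda$ is $$Z(G)=\sum_{\sigma:V\to\{0,1\}}\ \prod_{e\in\mathcal E}w(e,\sigma)\prod_{v\in V}w(v,\sigma),$$ where $w(e,\sigma)=\beta$ if $\sigma$ is constant on $e$ and $w(e,\sigma)=1$ otherwise, and where $w(v,\sigma)=\lambda$ if $\sigma(v)=1$ and $w(v,\sigma)=1$ if $\sigma(v)=0$. Then there is an FPTAS for $Z$ on the class of finite hypergraphs of maximum degree at most $\Delta$ (every vertex lies in at most $\Delta$ hyperedges; hyperedges may have any size). That is, there are a deterministic algorithm and a polynomial $p$ (both may depend on the constants $\Delta,\beta,\lambda$) such that, for every hypergraph $G$ in the class, given by its number of vertices in unary and its incidence matrix, and every rational $\varepsilon>0$, given by its numerator and denominator in binary, the algorithm outputs within $p(N+\lceil 1/\varepsilon\rceil)$ steps, where $N$ is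 the size of the input, a rational number $\hat Z$ with $$(1-\varepsilon)\,Z(G)\le \hat Z\le (1+\varepsilon)\,Z(G).$$ Here time is the number of evaluation steps of a program in a first-order recursive language over binary trees, in which numbers are processed bit by bit, and the algorithm has access to the real constants $\beta$ and $\lambda$ through oracles that, asked for $k$ bits, return some dyadic approximation $m/2^k$ with error at most $2^{-k}$, at a cost of at least $k$ steps. -/

import Mathlib

/-! ### Two state spin systems on finite hypergraphs -/

namespace HypergraphSpin

open scoped Classical in
/-- The weight of a hyperedge `e` under a configuration `σ` of the vertices (`false` is the
state `0` and `true` is the state `1`): `b` if all vertices of `e` are in state `0`, `c` if all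
are in state `1`, and `1` otherwise. -/
noncomputable def edgeWeight {α : Type*} {G : Hypergraph α} (b c : ℝ) (e : Set α)
    (σ : G.vertexSet → Bool) : ℝ :=
  if ∀ v : G.vertexSet, (v : α) ∈ e → σ v = false then b
  else if ∀ v : G.vertexSet, (v : α) ∈ e → σ v = true then c
  else 1

/-- The weight of a vertex in the given state: `lam` in state `1`, and `1` in state `0`. -/
def vertexWeight (lam : ℝ) (s : Bool) : ℝ := if s = true then lam else 1

/-- The weight of a configuration of the two state spin system on the hypergraph `G` (which has
finitely many vertices) with edge labels `b`, `c` and external field `lam`. -/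
noncomputable def weight {α : Type*} (G : Hypergraph α) (b c : G.edgeSet → ℝ) (lam : ℝ)
    (σ : G.vertexSet → Bool) : ℝ :=
  (∏ᶠ e : G.edgeSet, edgeWeight (b e) (c e) (e : Set α) σ) *
    ∏ᶠ v : G.vertexSet, vertexWeight lam (σ v)

/-- The partition function of the two state spin system: the sum of the weights of all
configurations. -/
noncomputable def partitionFunction {α : Type*} (G : Hypergraph α) (b c : G.edgeSet → ℝ)
    (lam : ℝ) : ℝ :=
  ∑ᶠ σ : G.vertexSet → Bool, weight G b c lam σ

/-- The partition function of the Ising model with interaction parameter `β` and external field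
`lam`: both labels of every hyperedge are `β`. -/
noncomputable def isingPartitionFunction {α : Type*} (β lam : ℝ) (G : Hypergraph α) : ℝ :=
  partitionFunction G (fun _ => β) (fun _ => β) lam

/-- The maximum degree: the supremum over the vertices of the number of incident hyperedges. -/
noncomputable def maxDegree {α : Type*} (G : Hypergraph α) : ℕ∞ :=
  ⨆ v ∈ G.vertexSet, {e | e ∈ G.edgeSet ∧ v ∈ e}.encard

end HypergraphSpin

/-! ### A machine model with a step count

Programs are first-order recursive programs over binary trees (a LISP-like language without
equality tests, so that every evaluation step is a constant-time operation of a pointer machine).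
Time is the number of evaluation steps. Polynomial time in this model is polynomial time on Turing
machines: all numbers are processed bit by bit. Real parameters of a problem are available through
oracles that return dyadic approximations; asking for `k` bits costs at least `k` steps. -/

namespace TreeMachine

/-- The data: binary trees. -/
inductive Val : Type
  | nil : Val
  | cons : Val → Val → Val

namespace Val

/-- The number of nodes. -/
def size : Val → ℕ
  | nil => 1
  | cons a b => a.size + b.size + 1

/-- The length of a tree that is read as a list. -/
def length : Val → ℕ
  | nil => 0
  | cons _ b => b.length + 1

/-- Lists of trees as trees. -/
def ofList : List Val → Val
  | [] => nil
  | a :: l => cons a (ofList l)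

/-- Bits as trees. -/
def ofBool : Bool → Val
  | false => nil
  | true => cons nil nil

/-- A natural number in unary. -/
def ofUnary (n : ℕ) : Val := ofList (List.replicate n nil)

/-- A natural number in binary, the least significant bit first. -/
def ofNat (n : ℕ) : Val := ofList (n.bits.map ofBool)

/-- The natural number of which a tree is the list of binary digits, the least significant one
first; an entry `nil` of the list is the digit `0` and any other entry is the digit `1`. -/
def toNat : Val → ℕ
  | nil => 0
  | cons nil b => 2 * b.toNat
  | cons (cons _ _) b => 2 * b.toNat + 1

/-- The rational number `p / q` given by a pair of natural numbers in binary. -/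
def toRat : Val → ℚ
  | nil => 0
  | cons p q => (p.toNat : ℚ) / (q.toNat : ℚ)

end Val

/-- Terms. Variables are de Bruijn indices into the environment; `ι` indexes the oracles. -/
inductive Term (ι : Type) : Type
  /-- the value of a variable -/
  | var : ℕ → Term ι
  /-- the empty tree -/
  | nil : Term ι
  /-- a new node -/
  | cons : Term ι → Term ι → Term ι
  /-- case distinction; in the second branch the two subtrees are the variables `0` and `1` -/
  | case : Term ι → Term ι → Term ι → Term ι
  /-- local definition, of the variable `0` in the second term -/
  | bind : Term ι → Term ι → Term ι
  /-- call of a function of the program, with one argument -/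
  | call : ℕ → Term ι → Term ι
  /-- query of an oracle -/
  | query : ι → Term ι → Term ι

/-- A program is a list of function bodies. The argument of a function is the variable `0` of its
body. Functions may call themselves and each other. -/
abbrev Program (ι : Type) : Type := List (Term ι)

/-- `Eval P O env e v t`: in the environment `env` the term `e` evaluates (call by value) to the
tree `v` in exactly `t` steps, where `P` is the program and `O` are the oracles. An oracle is
queried with a natural number `k`, given as a list of length `k`; the answer is in binary. -/
inductive Eval {ι : Type} (P : Program ι) (O : ι → ℕ → ℕ) :
    List Val → Term ι → Val → ℕ → Prop
  | var {env : List Val} {i : ℕ} {v : Val} (h : env[i]? = some v) : Eval P O env (.var i) v 1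
  | nil {env : List Val} : Eval P O env .nil .nil 1
  | cons {env : List Val} {e₁ e₂ : Term ι} {v₁ v₂ : Val} {t₁ t₂ : ℕ}
      (h₁ : Eval P O env e₁ v₁ t₁) (h₂ : Eval P O env e₂ v₂ t₂) :
      Eval P O env (.cons e₁ e₂) (.cons v₁ v₂) (t₁ + t₂ + 1)
  | case_nil {env : List Val} {e e₁ e₂ : Term ι} {v : Val} {t t₁ : ℕ}
      (h : Eval P O env e .nil t) (h₁ : Eval P O env e₁ v t₁) :
      Eval P O env (.case e e₁ e₂) v (t + t₁ + 1)
  | case_cons {env : List Val} {e e₁ e₂ : Term ι} {a b v : Val} {t t₂ : ℕ}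
      (h : Eval P O env e (.cons a b) t) (h₂ : Eval P O (a :: b :: env) e₂ v t₂) :
      Eval P O env (.case e e₁ e₂) v (t + t₂ + 1)
  | bind {env : List Val} {e₁ e₂ : Term ι} {v₁ v₂ : Val} {t₁ t₂ : ℕ}
      (h₁ : Eval P O env e₁ v₁ t₁) (h₂ : Eval P O (v₁ :: env) e₂ v₂ t₂) :
      Eval P O env (.bind e₁ e₂) v₂ (t₁ + t₂ + 1)
  | call {env : List Val} {f : ℕ} {body e : Term ι} {v w : Val} {t₁ t₂ : ℕ}
      (hf : P[f]? = some body) (h₁ : Eval P O env e v t₁) (h₂ : Eval P O [v] body w t₂) :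
      Eval P O env (.call f e) w (t₁ + t₂ + 1)
  | query {env : List Val} {i : ι} {e : Term ι} {v : Val} {t : ℕ}
      (h : Eval P O env e v t) :
      Eval P O env (.query i e) (Val.ofNat (O i v.length)) (t + v.length + 1)

/-- The model is deterministic: the result and the number of steps are unique. -/
theorem Eval.unique {ι : Type} {P : Program ι} {O : ι → ℕ → ℕ} {env : List Val} {e : Term ι}
    {v w : Val} {s t : ℕ} (h : Eval P O env e v s) (h' : Eval P O env e w t) :
    v = w ∧ s = t := by
  induction h generalizing w t with
  | var h => cases h' with | var h' => simp_all
  | nil => cases h'; simp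
  | cons _ _ ih₁ ih₂ =>
    cases h' with
    | cons h₁ h₂ => have := ih₁ h₁; have := ih₂ h₂; simp_all
  | case_nil _ _ ih ih₁ =>
    cases h' with
    | case_nil h h₁ => have := ih h; have := ih₁ h₁; simp_all
    | case_cons h h₂ => have := ih h; simp_all
  | case_cons _ _ ih ih₂ =>
    cases h' with
    | case_nil h h₁ => have := ih h; simp_all
    | case_cons h h₂ =>
      obtain ⟨h3, rfl⟩ := ih h
      cases h3
      have := ih₂ h₂; simp_all
  | bind _ _ ih₁ ih₂ =>
    cases h' with
    | bind h₁ h₂ =>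
      obtain ⟨rfl, rfl⟩ := ih₁ h₁
      have := ih₂ h₂; simp_all
  | call hf _ _ ih₁ ih₂ =>
    cases h' with
    | call hf' h₁ h₂ =>
      obtain ⟨rfl, rfl⟩ := ih₁ h₁
      rw [hf] at hf'
      cases hf'
      have := ih₂ h₂; simp_all
  | query _ ih =>
    cases h' with
    | query h => obtain ⟨rfl, rfl⟩ := ih h; simp

/-- Started on the given input, the program (whose main function is its first one) halts with the
given output after exactly `t` steps. -/
def Runs {ι : Type} (P : Program ι) (O : ι → ℕ → ℕ) (input output : Val) (t : ℕ) : Prop :=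
  Eval P O [input] (.call 0 (.var 0)) output t

/-- The oracle `φ` presents the nonnegative real number `x`: for every `k` it yields a dyadic
approximation `φ k / 2 ^ k` of `x` with error at most `2 ^ (-k)`. -/
def Presents (φ : ℕ → ℕ) (x : ℝ) : Prop :=
  ∀ k : ℕ, |(φ k : ℝ) / 2 ^ k - x| ≤ 1 / 2 ^ k

end TreeMachine

/-! ### Approximation schemes for hypergraph problems -/

namespace HypergraphSpin

open TreeMachine

/-- The lists `vs` and `es` enumerate, without repetition, the vertices and the hyperedges of
`G`; so `G` is finite. -/
structure Enumerates {α : Type*} (G : Hypergraph α) (vs : List α) (es : List (Set α)) :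
    Prop where
  vs_nodup : vs.Nodup
  mem_vs : ∀ v, v ∈ vs ↔ v ∈ G.vertexSet
  es_nodup : es.Nodup
  mem_es : ∀ e, e ∈ es ↔ e ∈ G.edgeSet

open scoped Classical in
/-- The encoding of a hypergraph with enumerated vertices and hyperedges: the number of vertices in
unary, and the incidence matrix, one row for each hyperedge. -/
noncomputable def encodeHypergraph {α : Type*} (vs : List α) (es : List (Set α)) : Val :=
  .cons (.ofUnary vs.length)
    (.ofList (es.map fun e => .ofList (vs.map fun v => .ofBool (decide (v ∈ e)))))

/-- The input of an approximation scheme: a hypergraph and a positive rational accuracy parameter,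
whose numerator and denominator are in binary. -/
noncomputable def encodeInput {α : Type*} (vs : List α) (es : List (Set α)) (ε : ℚ) : Val :=
  .cons (encodeHypergraph vs es) (.cons (.ofNat ε.num.toNat) (.ofNat ε.den))

/-- The function `Z` of finite hypergraphs has a fully polynomial-time approximation scheme on the
class `C`. The problem has the fixed real parameters `x i`, to which the algorithm has access
through oracles. For every finite hypergraph in the class and every rational `ε > 0` the algorithm
halts, within time polynomial in the size of the input and `1 / ε`, with a rational number that
approximates `Z` within a factor `1 ± ε`. -/
def HasFPTAS {ι : Type} (x : ι → ℝ) (C : ∀ α : Type, Hypergraph α → Prop)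
    (Z : ∀ α : Type, Hypergraph α → ℝ) : Prop :=
  ∃ (P : Program ι) (p : Polynomial ℕ),
    ∀ O : ι → ℕ → ℕ, (∀ i, Presents (O i) (x i)) →
    ∀ (α : Type) (G : Hypergraph α), C α G →
    ∀ (vs : List α) (es : List (Set α)), Enumerates G vs es →
    ∀ ε : ℚ, 0 < ε →
      ∃ (output : Val) (t : ℕ),
        Runs P O (encodeInput vs es ε) output t ∧
        t ≤ p.eval ((encodeInput vs es ε).size + ⌈1 / ε⌉₊) ∧
        (1 - (ε : ℝ)) * Z α G ≤ (output.toRat : ℝ) ∧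
        (output.toRat : ℝ) ≤ (1 + (ε : ℝ)) * Z α G

/-- The real parameters of the Ising model. -/
inductive IsingParam : Type
  | interaction : IsingParam
  | field : IsingParam

/-- The values of the parameters of the Ising model. -/
def isingParams (β lam : ℝ) : IsingParam → ℝ
  | .interaction => β
  | .field => lam

end HypergraphSpin

namespace HypergraphSpin

open Real Finset

/-! ### The contraction of a hyperedge -/

/-! The all-zero configuration has weight `β ^ m`, where `m` is the number of hyperedges. So `Z` is
`β ^ m` divided by the probability that all vertices are `0`, and by the chain rule this probability
is a product of conditional marginals `1 / (1 + R)`. It remains to approximate the odds `R` of one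
vertex in an instance in which other vertices are pinned.

The odds satisfy an exact recursion (`ratio_eq`). If the state of `v` is switched from `0` to `1` in
one incident edge at a time, then `R` telescopes into `λ` times one factor per incident edge, namely
`(1 - (1-β) Pr[S all 1]) / (1 - (1-β) Pr[S all 0])`, where `S` is the rest of the edge and a missing
label drops its term. Both probabilities expand into odds of smaller instances.

The recursion contracts in log-odds. For one edge the sensitivity is at most `(1-β)/β` times a sum
of two terms `∏ g * ∑ (1 - g)`, where `g` runs over the conditional probabilities along a chain.
Each term is at most `g₀ * exp (-g₀)`. Both chains start at the same vertex of the same instance, so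
the two values `g₀` add up to `1`, and the sum is at most `exp (-1/2)` (`mul_exp_neg_add_le`,
`edge_contraction`). Over at most `Δ` edges this contracts if `Δ * (1-β)/β * exp (-1/2) < 1`, which
the hypothesis on `β` implies with room to spare.

Edges may be large, so depth is the wrong measure. Marginals are bounded away from `0` and `1`,
hence an edge with `k` further vertices contracts exponentially in `k`, and one `θ < 1` serves all
sizes with rate `θ ^ (k+1)` (`exists_decay_rate`). Charging `k+1` units of budget for such an edge
gives an error `O(θ ^ B)` (`approxRatio_error`), while the work remains `D ^ B` up to polynomial
factors with `D = 8 Δ + 2` (`ratioBound`). A logarithmic budget therefore suffices.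

The program computes this truncated recursion exactly on fractions; the numbers of digits grow like
`D ^ B` too, so no rounding is needed. The oracles are queried once with precision `B`, and
replacing `β` and `λ` by the answers changes `log Z` only slightly (`abs_log_total_sub_le`).
`isingProgram_runs` gives time and value, and `chain_error` combines the two errors. -/

/-- The function `s * exp (-s)` lies below its tangent at `1/2`, and the tangent values at `s` and
`1 - s` add up to `exp (-1/2)`. -/
theorem mul_exp_neg_add_le (s : ℝ) (h0 : 0 ≤ s) (h1 : s ≤ 1) :
    s * exp (-s) + (1 - s) * exp (-(1 - s)) ≤ exp (-1 / 2) := by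
  have key : ∀ s : ℝ, 0 ≤ s → s * exp (-s) ≤ exp (-1 / 2) * (1 / 4 + s / 2) := by
    intro s h0
    have h := add_one_le_exp (s - 1 / 2)
    have h2 : exp (-1 / 2) = exp (-s) * exp (s - 1 / 2) := by rw [← exp_add]; ring_nf
    rw [h2]
    have h3 : s ≤ exp (s - 1 / 2) * (1 / 4 + s / 2) := by
      nlinarith [sq_nonneg (1 - 2 * s)]
    nlinarith [exp_pos (-s)]
  have := key s h0
  have := key (1 - s) (by linarith)
  linarith

/-- With `T` the sum of `1 - g j` over `j ≥ 1`, the other factors contribute at most `exp (-T)`, and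
`u ≤ exp (u - 1)` at `u = T + 1 - g 0` cancels `T`. The bound keeps `g 0` because the two chains of
an edge are coupled through their first entries. -/
theorem prod_mul_sum_one_sub_le (g : ℕ → ℝ) (k : ℕ) (h0 : ∀ j, 0 ≤ g j) (h1 : ∀ j, g j ≤ 1) :
    (∏ j ∈ range (k + 1), g j) * ∑ j ∈ range (k + 1), (1 - g j) ≤ g 0 * exp (-g 0) := by
  have hprod : ∏ j ∈ range k, g (j + 1) ≤ exp (-∑ j ∈ range k, (1 - g (j + 1))) := by
    rw [← sum_neg_distrib, exp_sum]
    refine prod_le_prod (fun j _ => h0 _) (fun j _ => ?_)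
    have := add_one_le_exp (-(1 - g (j + 1)))
    linarith
  rw [prod_range_succ', sum_range_succ']
  set T := ∑ j ∈ range k, (1 - g (j + 1)) with hT
  have hT0 : 0 ≤ T := sum_nonneg fun j _ => by linarith [h1 (j + 1)]
  have hu : 0 ≤ T + (1 - g 0) := by linarith [h1 0]
  have h2 : (T + (1 - g 0)) ≤ exp (T + (1 - g 0) - 1) := by
    have := add_one_le_exp (T + (1 - g 0) - 1); linarith
  have h3 : exp (-T) * exp (T + (1 - g 0) - 1) = exp (-g 0) := by rw [← exp_add]; ring_nf
  calc (∏ j ∈ range k, g (j + 1)) * g 0 * (T + (1 - g 0))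
      ≤ exp (-T) * g 0 * exp (T + (1 - g 0) - 1) := by
        have := h0 0
        gcongr
    _ = g 0 * (exp (-T) * exp (T + (1 - g 0) - 1)) := by ring
    _ = _ := by rw [h3]

theorem prod_mul_sum_one_sub_le_pow (g : ℕ → ℝ) (k : ℕ) (M : ℝ) (h0 : ∀ j, 0 ≤ g j)
    (h1 : ∀ j < k, g j ≤ M) :
    (∏ j ∈ range k, g j) * ∑ j ∈ range k, (1 - g j) ≤ k * M ^ k := by
  have hp : ∏ j ∈ range k, g j ≤ M ^ k := by
    calc ∏ j ∈ range k, g j ≤ ∏ _j ∈ range k, M :=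
          prod_le_prod (fun j _ => h0 j) (fun j hj => h1 j (mem_range.1 hj))
      _ = M ^ k := by simp
  have hs : ∑ j ∈ range k, (1 - g j) ≤ k := by
    calc ∑ j ∈ range k, (1 - g j) ≤ ∑ _j ∈ range k, (1 : ℝ) :=
          sum_le_sum fun j _ => by linarith [h0 j]
      _ = k := by simp
  have hp0 : 0 ≤ ∏ j ∈ range k, g j := prod_nonneg fun j _ => h0 j
  calc _ ≤ (∏ j ∈ range k, g j) * k := by gcongr
    _ ≤ M ^ k * k := by gcongr
    _ = _ := by ring

/-- The bound for the contraction of an edge with `k` free vertices. -/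
noncomputable def edgeRate (M : ℝ) (k : ℕ) : ℝ := min (exp (-1 / 2)) (2 * (k * M ^ k))

theorem hasDerivAt_prod_sigmoid (p d : ℕ → ℝ) (k : ℕ) (t : ℝ) :
    HasDerivAt (fun t => ∏ j ∈ range k, sigmoid (p j + t * d j))
      ((∏ j ∈ range k, sigmoid (p j + t * d j)) *
        ∑ j ∈ range k, (1 - sigmoid (p j + t * d j)) * d j) t := by
  induction k with
  | zero => simpa using hasDerivAt_const t (1 : ℝ)
  | succ k ih =>
    simp only [prod_range_succ, sum_range_succ]
    have hl : HasDerivAt (fun t => p k + t * d k) (d k) t := by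
      simpa using ((hasDerivAt_id t).mul_const (d k)).const_add (p k)
    have h := ih.mul ((hasDerivAt_sigmoid (p k + t * d k)).comp t hl)
    exact h.congr_deriv (by simp only [Function.comp]; ring)

/-- The sequences `p` and `q` are the log-odds of state `1` along the all-one chain and of state `0`
along the all-zero chain. Along the segment from `p, q` to `p', q'` the derivative is bounded, using
that both denominators are at least `1 - a`. The constants `a₁` and `a₀` are `1 - β` or, for a label
that is off, `0`; with `a = 1 - β` the prefactor is `(1-β)/β`. -/
theorem edge_contraction (k : ℕ) (p q p' q' : ℕ → ℝ) (a a₁ a₀ δ M : ℝ)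
    (hpq : 0 < k → q 0 = -p 0) (hpq' : 0 < k → q' 0 = -p' 0)
    (hp : ∀ j < k, |p' j - p j| ≤ δ) (hq : ∀ j < k, |q' j - q j| ≤ δ)
    (hMp : ∀ j < k, sigmoid (p j) ≤ M) (hMp' : ∀ j < k, sigmoid (p' j) ≤ M)
    (hMq : ∀ j < k, sigmoid (q j) ≤ M) (hMq' : ∀ j < k, sigmoid (q' j) ≤ M)
    (ha : a < 1) (h1 : 0 ≤ a₁) (h1' : a₁ ≤ a) (h0 : 0 ≤ a₀) (h0' : a₀ ≤ a) (hδ : 0 ≤ δ) :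
    |(log (1 - a₁ * ∏ j ∈ range k, sigmoid (p' j)) - log (1 - a₀ * ∏ j ∈ range k, sigmoid (q' j)))
      - (log (1 - a₁ * ∏ j ∈ range k, sigmoid (p j)) -
        log (1 - a₀ * ∏ j ∈ range k, sigmoid (q j)))| ≤ a / (1 - a) * edgeRate M k * δ := by
  have ha0 : 0 ≤ a := h1.trans h1'
  set X : (ℕ → ℝ) → (ℕ → ℝ) → ℝ → ℝ := fun p p' t =>
    ∏ j ∈ range k, sigmoid (p j + t * (p' j - p j)) with hX
  set A : (ℕ → ℝ) → (ℕ → ℝ) → ℝ → ℝ := fun p p' t =>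
    ∑ j ∈ range k, (1 - sigmoid (p j + t * (p' j - p j))) * (p' j - p j) with hA
  set A' : (ℕ → ℝ) → (ℕ → ℝ) → ℝ → ℝ := fun p p' t =>
    ∑ j ∈ range k, (1 - sigmoid (p j + t * (p' j - p j))) with hA'
  have hX0 : ∀ p p' t, 0 ≤ X p p' t := fun p p' t => prod_nonneg fun j _ => sigmoid_nonneg _
  have hX1 : ∀ p p' t, X p p' t ≤ 1 := fun p p' t =>
    prod_le_one (fun j _ => sigmoid_nonneg _) (fun j _ => sigmoid_le_one _)
  have hden : ∀ b, 0 ≤ b → b ≤ a → ∀ p p' t, 1 - a ≤ 1 - b * X p p' t := by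
    intro b hb hb' p p' t
    have := mul_le_mul hb' (hX1 p p' t) (hX0 p p' t) ha0
    linarith
  have hder : ∀ b, 0 ≤ b → b ≤ a → ∀ p p' t,
      HasDerivAt (fun t => log (1 - b * X p p' t))
        (-(b * (X p p' t * A p p' t)) / (1 - b * X p p' t)) t := by
    intro b hb hb' p p' t
    have h := (((hasDerivAt_prod_sigmoid p (fun j => p' j - p j) k t).const_mul b).const_sub 1).log
      (by have := hden b hb hb' p p' t; simp only [hX] at this; linarith)
    convert h using 1
  have hAA : ∀ p p' : ℕ → ℝ, (∀ j < k, |p' j - p j| ≤ δ) → ∀ t, |A p p' t| ≤ A' p p' t * δ := by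
    intro p p' hp t
    simp only [hA, hA', sum_mul]
    refine (abs_sum_le_sum_abs _ _).trans (sum_le_sum fun j hj => ?_)
    rw [abs_mul, abs_of_nonneg (by linarith [sigmoid_le_one (p j + t * (p' j - p j))])]
    exact mul_le_mul_of_nonneg_left (hp j (mem_range.1 hj))
      (by linarith [sigmoid_le_one (p j + t * (p' j - p j))])
  have hterm : ∀ b, 0 ≤ b → b ≤ a → ∀ p p' : ℕ → ℝ, (∀ j < k, |p' j - p j| ≤ δ) → ∀ t,
      |-(b * (X p p' t * A p p' t)) / (1 - b * X p p' t)| ≤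
        a / (1 - a) * (X p p' t * A' p p' t) * δ := by
    intro b hb hb' p p' hp t
    have hd := hden b hb hb' p p' t
    have hA'0 : 0 ≤ A' p p' t := sum_nonneg fun j _ => by
      linarith [sigmoid_le_one (p j + t * (p' j - p j))]
    rw [abs_div, abs_neg, abs_mul, abs_mul, abs_of_nonneg hb, abs_of_nonneg (hX0 p p' t),
      abs_of_nonneg (by linarith : 0 ≤ 1 - b * X p p' t)]
    calc b * (X p p' t * |A p p' t|) / (1 - b * X p p' t)
        ≤ a * (X p p' t * (A' p p' t * δ)) / (1 - a) := by
          have := hAA p p' hp t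
          have := hX0 p p' t
          have : 0 < 1 - a := by linarith
          gcongr
      _ = _ := by ring
  have hsum : ∀ t ∈ Set.Ico (0 : ℝ) 1,
      X p p' t * A' p p' t + X q q' t * A' q q' t ≤ edgeRate M k := by
    intro t ht
    have hM : ∀ p p' : ℕ → ℝ, (∀ j < k, sigmoid (p j) ≤ M) → (∀ j < k, sigmoid (p' j) ≤ M) →
        ∀ j < k, sigmoid (p j + t * (p' j - p j)) ≤ M := by
      intro p p' h h' j hj
      rcases le_total (p j) (p' j) with hle | hle
      · exact (sigmoid_le (by nlinarith [ht.1, ht.2])).trans (h' j hj)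
      · exact (sigmoid_le (by nlinarith [ht.1, ht.2])).trans (h j hj)
    refine le_min ?_ ?_
    · rcases Nat.eq_zero_or_pos k with rfl | hk
      · simp [hA']; positivity
      · obtain ⟨k, rfl⟩ := Nat.exists_eq_succ_of_ne_zero hk.ne'
        have e1 := prod_mul_sum_one_sub_le (fun j => sigmoid (p j + t * (p' j - p j))) k
          (fun j => sigmoid_nonneg _) (fun j => sigmoid_le_one _)
        have e2 := prod_mul_sum_one_sub_le (fun j => sigmoid (q j + t * (q' j - q j))) k
          (fun j => sigmoid_nonneg _) (fun j => sigmoid_le_one _)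
        -- The shared first vertex: its two state probabilities sum to `1` at every point of the
        -- segment.
        have e3 : sigmoid (q 0 + t * (q' 0 - q 0)) = 1 - sigmoid (p 0 + t * (p' 0 - p 0)) := by
          rw [← sigmoid_neg, hpq hk, hpq' hk]; ring_nf
        simp only [e3] at e2
        have := mul_exp_neg_add_le _ (sigmoid_nonneg (p 0 + t * (p' 0 - p 0)))
          (sigmoid_le_one _)
        simp only [hX, hA', Nat.succ_eq_add_one]
        linarith
    · have e1 := prod_mul_sum_one_sub_le_pow (fun j => sigmoid (p j + t * (p' j - p j))) k M
          (fun j => sigmoid_nonneg _) (hM p p' hMp hMp')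
      have e2 := prod_mul_sum_one_sub_le_pow (fun j => sigmoid (q j + t * (q' j - q j))) k M
          (fun j => sigmoid_nonneg _) (hM q q' hMq hMq')
      simp only [hX, hA']
      linarith
  have key := norm_image_sub_le_of_norm_deriv_le_segment_01'
    (f := fun t => log (1 - a₁ * X p p' t) - log (1 - a₀ * X q q' t))
    (C := a / (1 - a) * edgeRate M k * δ)
    (fun t _ => ((hder a₁ h1 h1' p p' t).sub (hder a₀ h0 h0' q q' t)).hasDerivWithinAt) (by
      intro t ht
      rw [norm_eq_abs]
      refine (abs_sub _ _).trans ?_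
      have e1 := hterm a₁ h1 h1' p p' hp t
      have e2 := hterm a₀ h0 h0' q q' hq t
      have e3 := hsum t ht
      have : 0 ≤ a / (1 - a) := div_nonneg ha0 (by linarith)
      calc _ ≤ a / (1 - a) * (X p p' t * A' p p' t + X q q' t * A' q q' t) * δ := by linarith
        _ ≤ _ := by gcongr)
  rw [norm_eq_abs] at key
  simpa [hX] using key

/-- A rate of decay that dominates the contraction at edges of all sizes. -/
theorem exists_decay_rate (g M : ℝ) (hg : 0 ≤ g) (hM0 : 0 < M) (hM1 : M < 1)
    (h : g * exp (-1 / 2) < 1) :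
    ∃ θ : ℝ, 0 < θ ∧ θ < 1 ∧ ∀ k : ℕ, g * edgeRate M k ≤ θ ^ (k + 1) := by
  -- For large `k` the bound `k * M ^ k` is beaten by `M' ^ (k+1)` for any `M' > M`. Only `k ≤ K`
  -- remains, and there `θ` close to `1` makes `θ ^ (K+1)` at least `g * exp (-1/2)`.
  obtain ⟨M', hM', hM'1⟩ := exists_between hM1
  have hM'0 : 0 < M' := hM0.trans hM'
  have hlim : Filter.Tendsto (fun k : ℕ => g * 2 / M' * (k * (M / M') ^ k)) Filter.atTop
      (nhds (g * 2 / M' * 0)) :=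
    (tendsto_self_mul_const_pow_of_lt_one (by positivity) (by rwa [div_lt_one hM'0])).const_mul _
  rw [mul_zero] at hlim
  obtain ⟨K, hK⟩ := (hlim.eventually_le_const zero_lt_one).exists_forall_of_atTop
  have hlim2 : Filter.Tendsto (fun x : ℝ => x ^ (K + 1)) (nhdsWithin 1 (Set.Iio 1))
      (nhds ((1 : ℝ) ^ (K + 1))) :=
    (continuous_pow (K + 1)).continuousAt.tendsto.mono_left nhdsWithin_le_nhds
  rw [one_pow] at hlim2
  obtain ⟨θ, hθ1, hθM, hθ2⟩ := ((hlim2.eventually_const_le h).and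
    (Ioo_mem_nhdsLT hM'1)).exists
  have hθ0 : 0 < θ := hM'0.trans hθM
  refine ⟨θ, hθ0, hθ2, fun k => ?_⟩
  rcases le_total K k with hk | hk
  · have := hK k hk
    calc g * edgeRate M k ≤ g * (2 * (k * M ^ k)) := by
          gcongr
          exact min_le_right _ _
      _ = (g * 2 / M' * (k * (M / M') ^ k)) * M' ^ (k + 1) := by
          rw [div_pow]; field_simp; ring
      _ ≤ 1 * M' ^ (k + 1) := by gcongr
      _ ≤ θ ^ (k + 1) := by rw [one_mul]; gcongr
  · calc g * edgeRate M k ≤ g * exp (-1 / 2) := by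
          gcongr
          exact min_le_left _ _
      _ ≤ θ ^ (K + 1) := hθ1
      _ ≤ θ ^ (k + 1) := pow_le_pow_of_le_one hθ0.le hθ2.le (by omega)

end HypergraphSpin

namespace HypergraphSpin

open Finset

/-! ### Labelled edges and pinning -/

/-- A hyperedge with free vertices `support` in which the all-zero and the all-one penalties are
switched on or off. -/
structure LabelledEdge where
  zeroOn : Bool
  oneOn : Bool
  support : List ℕ

/-- The edge that is left when the vertex `v` is fixed in the state `s`. -/
def pinEdge (s : Bool) (v : ℕ) (e : LabelledEdge) : LabelledEdge :=
  if v ∈ e.support then ⟨e.zeroOn && !s, e.oneOn && s, e.support.filter (· ≠ v)⟩ else e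

/-- The list of edges that is left when the vertex `v` is fixed in the state `s`. -/
def pin (s : Bool) (v : ℕ) (I : List LabelledEdge) : List LabelledEdge := I.map (pinEdge s v)

theorem pin_cons (s : Bool) (v : ℕ) (e : LabelledEdge) (I : List LabelledEdge) :
    pin s v (e :: I) = pinEdge s v e :: pin s v I := rfl

theorem notMem_pinEdge (s : Bool) (v : ℕ) (e : LabelledEdge) : v ∉ (pinEdge s v e).support := by
  unfold pinEdge
  split_ifs with h <;> simp [h]

theorem mem_of_mem_pinEdge {s : Bool} {u v : ℕ} {e : LabelledEdge}
    (h : u ∈ (pinEdge s v e).support) : u ∈ e.support := by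
  unfold pinEdge at h
  split_ifs at h with h'
  · simp at h; exact h.1
  · exact h

theorem notMem_pin (s : Bool) (v : ℕ) (I : List LabelledEdge) :
    ∀ e ∈ pin s v I, v ∉ e.support := by
  intro e he
  obtain ⟨e', -, rfl⟩ := List.mem_map.1 he
  exact notMem_pinEdge s v e'

open Classical in
/-- The weight of the edge `e` in the configuration in which `A` is the set of ones. -/
noncomputable def labelWeight (β : ℝ) (A : Finset ℕ) (e : LabelledEdge) : ℝ :=
  if (e.zeroOn = true ∧ ∀ u ∈ e.support, u ∉ A) ∨ (e.oneOn = true ∧ ∀ u ∈ e.support, u ∈ A)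
  then β else 1

/-- The weight of the configuration in which `A` is the set of ones. -/
noncomputable def configWeight (β lam : ℝ) (I : List LabelledEdge) (A : Finset ℕ) : ℝ :=
  lam ^ A.card * (I.map (labelWeight β A)).prod

open Classical in
/-- The indicator of the configurations in which all vertices of `S` have the state `s`. -/
noncomputable def stateIndicator (s : Bool) (S : List ℕ) (A : Finset ℕ) : ℝ :=
  if ∀ u ∈ S, (u ∈ A ↔ s = true) then 1 else 0

/-- The weighted sum of `φ` over the configurations on the vertex set `U`. -/
noncomputable def total (β lam : ℝ) (U : Finset ℕ) (I : List LabelledEdge)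
    (φ : Finset ℕ → ℝ) : ℝ :=
  ∑ A ∈ U.powerset, configWeight β lam I A * φ A

theorem stateIndicator_nil (s : Bool) : stateIndicator s [] = 1 := by
  ext A; simp [stateIndicator]

theorem stateIndicator_cons (s : Bool) (u : ℕ) (S : List ℕ) :
    stateIndicator s (u :: S) = stateIndicator s [u] * stateIndicator s S := by
  ext A
  by_cases h : (u ∈ A ↔ s = true) <;> simp [stateIndicator, h]

theorem labelWeight_pinEdge (β : ℝ) (s : Bool) (v : ℕ) (e : LabelledEdge) (A : Finset ℕ)
    (h : v ∈ A ↔ s = true) : labelWeight β A (pinEdge s v e) = labelWeight β A e := by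
  unfold pinEdge
  split_ifs with hv
  · unfold labelWeight
    congr 1
    cases s
    · simp only [Bool.false_eq_true, iff_false] at h
      have h1 : ¬ ∀ u ∈ e.support, u ∈ A := fun h' => h (h' v hv)
      simp only [Bool.not_false, Bool.and_true, Bool.and_false, Bool.false_eq_true, false_and,
        or_false, h1, and_false, List.mem_filter, decide_eq_true_eq, and_imp]
      refine propext (and_congr_right fun _ => ⟨fun h' u hu => ?_, fun h' u hu _ => h' u hu⟩)
      by_cases huv : u = v
      · rwa [huv]
      · exact h' u hu huv
    · simp only [iff_true] at h
      have h1 : ¬ ∀ u ∈ e.support, u ∉ A := fun h' => h' v hv h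
      simp only [Bool.not_true, Bool.and_true, Bool.and_false, Bool.false_eq_true, false_and,
        false_or, h1, and_false, List.mem_filter, decide_eq_true_eq, and_imp]
      refine propext (and_congr_right fun _ => ⟨fun h' u hu => ?_, fun h' u hu _ => h' u hu⟩)
      by_cases huv : u = v
      · rwa [huv]
      · exact h' u hu huv
  · rfl

theorem configWeight_pin (β lam : ℝ) (s : Bool) (v : ℕ) (I : List LabelledEdge) (A : Finset ℕ)
    (h : v ∈ A ↔ s = true) : configWeight β lam (pin s v I) A = configWeight β lam I A := by
  unfold configWeight pin
  rw [List.map_map]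
  congr 2
  exact List.map_congr_left fun e _ => labelWeight_pinEdge β s v e A h

/-- Pinning alters the edges but leaves `v` in `U`. Weights change only where `v` has the other
state, and the indicator removes those configurations. -/
theorem total_pin (β lam : ℝ) (U : Finset ℕ) (s : Bool) (v : ℕ) (I : List LabelledEdge)
    (φ : Finset ℕ → ℝ) :
    total β lam U (pin s v I) (stateIndicator s [v] * φ) =
      total β lam U I (stateIndicator s [v] * φ) := by
  refine sum_congr rfl fun A _ => ?_
  by_cases h : (v ∈ A ↔ s = true)
  · rw [configWeight_pin _ _ _ _ _ _ h]
  · simp [stateIndicator, h]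

theorem labelWeight_insert (β : ℝ) (v : ℕ) (A : Finset ℕ) (e : LabelledEdge)
    (h : v ∉ e.support) : labelWeight β (insert v A) e = labelWeight β A e := by
  unfold labelWeight
  congr 1
  have h1 : ∀ u ∈ e.support, (u ∈ insert v A ↔ u ∈ A) := fun u hu => by
    simp [show u ≠ v from fun h' => h (h' ▸ hu)]
  refine propext (or_congr (and_congr_right fun _ => ?_) (and_congr_right fun _ => ?_))
  · exact forall₂_congr fun u hu => not_congr (h1 u hu)
  · exact forall₂_congr fun u hu => h1 u hu

theorem configWeight_insert (β lam : ℝ) (v : ℕ) (A : Finset ℕ) (I : List LabelledEdge)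
    (h : ∀ e ∈ I, v ∉ e.support) (hA : v ∉ A) :
    configWeight β lam I (insert v A) = lam * configWeight β lam I A := by
  unfold configWeight
  rw [card_insert_of_notMem hA, pow_succ',
    List.map_congr_left fun e he => labelWeight_insert β v A e (h e he)]
  ring

/-- The probability of the state `s` of an isolated vertex. -/
noncomputable def freeProb (lam : ℝ) (s : Bool) : ℝ := if s = true then lam / (1 + lam) else 1 / (1 + lam)

theorem freeProb_pos {lam : ℝ} (hl : 0 < lam) (s : Bool) : 0 < freeProb lam s := by
  unfold freeProb; split_ifs <;> positivity

/-- A vertex in no edge is independent of the rest. Together with `total_pin` this lets a pinned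
vertex survive as an isolated one, so `U` stays fixed throughout the recursion. -/
theorem total_free (β lam : ℝ) (hl : 0 < lam) (U : Finset ℕ) (s : Bool) (v : ℕ)
    (I : List LabelledEdge) (φ : Finset ℕ → ℝ) (hv : v ∈ U) (h : ∀ e ∈ I, v ∉ e.support)
    (hφ : ∀ A, v ∉ A → φ (insert v A) = φ A) :
    total β lam U I (stateIndicator s [v] * φ) = freeProb lam s * total β lam U I φ := by
  have key : ∀ ψ : Finset ℕ → ℝ, total β lam U I ψ =
      ∑ A ∈ (U.erase v).powerset, configWeight β lam I A * (ψ A + lam * ψ (insert v A)) := by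
    intro ψ
    unfold total
    conv_lhs => rw [← insert_erase hv]
    rw [sum_powerset_insert (notMem_erase v U), ← sum_add_distrib]
    refine sum_congr rfl fun A hA => ?_
    have hA' : v ∉ A := fun h' => notMem_erase v U (mem_powerset.1 hA h')
    rw [configWeight_insert _ _ _ _ _ h hA']
    ring
  rw [key, key, mul_sum]
  refine sum_congr rfl fun A hA => ?_
  have hA' : v ∉ A := fun h' => notMem_erase v U (mem_powerset.1 hA h')
  have : (1 + lam) ≠ 0 := by positivity
  cases s <;> simp [stateIndicator, freeProb, hA', hφ A hA'] <;> field_simp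

theorem labelWeight_pos {β : ℝ} (hβ : 0 < β) (A : Finset ℕ) (e : LabelledEdge) :
    0 < labelWeight β A e := by
  unfold labelWeight; split_ifs <;> linarith

theorem configWeight_pos {β lam : ℝ} (hβ : 0 < β) (hl : 0 < lam) (I : List LabelledEdge)
    (A : Finset ℕ) : 0 < configWeight β lam I A := by
  refine mul_pos (pow_pos hl _) (List.prod_pos ?_)
  intro x hx
  obtain ⟨e, -, rfl⟩ := List.mem_map.1 hx
  exact labelWeight_pos hβ A e

theorem total_one_pos {β lam : ℝ} (hβ : 0 < β) (hl : 0 < lam) (U : Finset ℕ)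
    (I : List LabelledEdge) : 0 < total β lam U I 1 :=
  sum_pos (fun A _ => mul_pos (configWeight_pos hβ hl I A) one_pos) (powerset_nonempty U)

theorem total_state {β lam : ℝ} (hl : 0 < lam) (U : Finset ℕ) (s : Bool) (v : ℕ)
    (I : List LabelledEdge) (hv : v ∈ U) :
    total β lam U I (stateIndicator s [v]) = freeProb lam s * total β lam U (pin s v I) 1 := by
  have h1 := total_pin β lam U s v I 1
  rw [mul_one] at h1
  have h2 := total_free β lam hl U s v (pin s v I) 1 hv (notMem_pin s v I) (fun _ _ => rfl)
  rw [mul_one] at h2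
  rw [← h1, h2]

/-- The ratio of the probabilities of the states `1` and `0` of a vertex. -/
noncomputable def ratio (β lam : ℝ) (U : Finset ℕ) (I : List LabelledEdge) (v : ℕ) : ℝ :=
  total β lam U I (stateIndicator true [v]) / total β lam U I (stateIndicator false [v])

theorem ratio_eq_pin {β lam : ℝ} (hβ : 0 < β) (hl : 0 < lam) (U : Finset ℕ)
    (I : List LabelledEdge) (v : ℕ) (hv : v ∈ U) :
    ratio β lam U I v =
      lam * (total β lam U (pin true v I) 1 / total β lam U (pin false v I) 1) := by
  unfold ratio
  rw [total_state hl U true v I hv, total_state hl U false v I hv]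
  have := total_one_pos hβ hl U (pin false v I)
  simp only [freeProb]
  simp
  field_simp

theorem ratio_pos {β lam : ℝ} (hβ : 0 < β) (hl : 0 < lam) (U : Finset ℕ)
    (I : List LabelledEdge) (v : ℕ) (hv : v ∈ U) : 0 < ratio β lam U I v := by
  rw [ratio_eq_pin hβ hl U I v hv]
  have := total_one_pos hβ hl U (pin true v I)
  have := total_one_pos hβ hl U (pin false v I)
  positivity

/-- The probability of the state `s` of a vertex for which the ratio of the probabilities of `1`
and `0` is `R`. -/
noncomputable def stateProb (s : Bool) (R : ℝ) : ℝ := if s = true then R / (1 + R) else 1 / (1 + R)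

/-- The product of the conditional probabilities of the state `s` of the vertices of a list, each
one conditioned on the state `s` of the vertices before it, where `f` yields the ratios. -/
noncomputable def chainProb (f : ℕ → List LabelledEdge → ℝ) (s : Bool) :
    List ℕ → List LabelledEdge → ℝ
  | [], _ => 1
  | u :: S, I => stateProb s (f u I) * chainProb f s S (pin s u I)

theorem stateProb_ratio {β lam : ℝ} (hβ : 0 < β) (hl : 0 < lam) (U : Finset ℕ) (s : Bool)
    (I : List LabelledEdge) (v : ℕ) (hv : v ∈ U) :
    stateProb s (ratio β lam U I v) =
      total β lam U I (stateIndicator s [v]) / total β lam U I 1 := by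
  have h0 : total β lam U I 1 = total β lam U I (stateIndicator true [v]) +
      total β lam U I (stateIndicator false [v]) := by
    unfold total
    rw [← sum_add_distrib]
    refine sum_congr rfl fun A _ => ?_
    by_cases h : v ∈ A <;> simp [stateIndicator, h]
  have h1 : 0 < total β lam U I (stateIndicator true [v]) := by
    rw [total_state hl U true v I hv]
    exact mul_pos (freeProb_pos hl _) (total_one_pos hβ hl _ _)
  have h2 : 0 < total β lam U I (stateIndicator false [v]) := by
    rw [total_state hl U false v I hv]
    exact mul_pos (freeProb_pos hl _) (total_one_pos hβ hl _ _)
  rw [h0]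
  unfold ratio stateProb
  cases s <;> simp <;> field_simp <;> ring

/-- The chain rule for conditional probabilities. Distinctness of the vertices matters: a pinned
vertex is isolated rather than frozen, so a repetition would contribute a spurious factor. -/
theorem chainProb_ratio {β lam : ℝ} (hβ : 0 < β) (hl : 0 < lam) (U : Finset ℕ) (s : Bool)
    (S : List ℕ) (hS : S.Nodup) (hU : ∀ u ∈ S, u ∈ U) (I : List LabelledEdge) :
    chainProb (fun u J => ratio β lam U J u) s S I =
      total β lam U I (stateIndicator s S) / total β lam U I 1 := by
  induction S generalizing I with
  | nil =>
    simp only [chainProb, stateIndicator_nil]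
    rw [div_self (total_one_pos hβ hl U I).ne']
  | cons u S ih =>
    have hu : u ∈ U := hU u (by simp)
    rw [List.nodup_cons] at hS
    have h1 := total_pin β lam U s u I (stateIndicator s S)
    have h2 := total_free β lam hl U s u (pin s u I) (stateIndicator s S) hu (notMem_pin s u I) (by
      intro A _
      have : ∀ w ∈ S, (w ∈ insert u A ↔ w ∈ A) := fun w hw => by
        simp [show w ≠ u from fun h => hS.1 (h ▸ hw)]
      unfold stateIndicator
      congr 1
      exact propext (forall₂_congr fun w hw => by rw [this w hw]))
    simp only [chainProb]
    rw [ih hS.2 (fun w hw => hU w (by simp [hw])), stateProb_ratio hβ hl U s I u hu,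
      stateIndicator_cons s u S, ← h1, h2, total_state hl U s u I hu]
    have := total_one_pos hβ hl U (pin s u I)
    field_simp

/-! ### The recursion for the ratios -/

/-- The factor of an edge with switches `b`, `c` and remaining free vertices `S` in the recursion
for the ratio of a vertex. -/
noncomputable def edgeFactor (β : ℝ) (f : ℕ → List LabelledEdge → ℝ) (b c : Bool) (S : List ℕ)
    (J : List LabelledEdge) : ℝ :=
  (1 - (if c = true then 1 - β else 0) * chainProb f true S J) /
    (1 - (if b = true then 1 - β else 0) * chainProb f false S J)

/-- The product of the edge factors at the vertex `v`. In the edges before the current one, which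
are listed in `pre`, the vertex is in state `1`, and in the later ones it is in state `0`. -/
noncomputable def edgeProduct (β : ℝ) (f : ℕ → ℕ → List LabelledEdge → ℝ) (v : ℕ) :
    List LabelledEdge → List LabelledEdge → ℝ
  | _, [] => 1
  | pre, e :: I =>
    if v ∈ e.support then
      -- The first argument of `f` is the number of remaining vertices, from which `approxRatio`
      -- determines the reduced budget. The factor is evaluated in the instance without the current
      -- edge.
      edgeFactor β (f (e.support.filter (· ≠ v)).length) e.zeroOn e.oneOn
        (e.support.filter (· ≠ v)) (pre.reverseAux (pin false v I)) *
      edgeProduct β f v (pinEdge true v e :: pre) I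
    else edgeProduct β f v (e :: pre) I

theorem total_perm (β lam : ℝ) (U : Finset ℕ) {I J : List LabelledEdge} (h : I.Perm J)
    (φ : Finset ℕ → ℝ) : total β lam U I φ = total β lam U J φ := by
  refine sum_congr rfl fun A _ => ?_
  unfold configWeight
  rw [(h.map _).prod_eq]

/-- An edge with a single label has weight `1 - (1-β) * indicator`, so adding it subtracts a
multiple of one restricted sum. -/
theorem total_cons_zero (β lam : ℝ) (U : Finset ℕ) (J : List LabelledEdge) (b : Bool)
    (S : List ℕ) :
    total β lam U (⟨b, false, S⟩ :: J) 1 = total β lam U J 1 -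
      (if b = true then 1 - β else 0) * total β lam U J (stateIndicator false S) := by
  unfold total
  rw [mul_sum, ← sum_sub_distrib]
  refine sum_congr rfl fun A _ => ?_
  have hw : labelWeight β A ⟨b, false, S⟩ =
      1 - (if b = true then 1 - β else 0) * stateIndicator false S A := by
    unfold labelWeight stateIndicator
    split_ifs <;> simp_all
  simp only [configWeight, List.map_cons, List.prod_cons, hw, Pi.one_apply]
  ring

theorem total_cons_one (β lam : ℝ) (U : Finset ℕ) (J : List LabelledEdge) (c : Bool)
    (S : List ℕ) :
    total β lam U (⟨false, c, S⟩ :: J) 1 = total β lam U J 1 -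
      (if c = true then 1 - β else 0) * total β lam U J (stateIndicator true S) := by
  unfold total
  rw [mul_sum, ← sum_sub_distrib]
  refine sum_congr rfl fun A _ => ?_
  have hw : labelWeight β A ⟨false, c, S⟩ =
      1 - (if c = true then 1 - β else 0) * stateIndicator true S A := by
    unfold labelWeight stateIndicator
    split_ifs <;> simp_all
  simp only [configWeight, List.map_cons, List.prod_cons, hw, Pi.one_apply]
  ring

theorem edgeFactor_ratio {β lam : ℝ} (hβ : 0 < β) (hl : 0 < lam) (U : Finset ℕ) (b c : Bool)
    (S : List ℕ) (hS : S.Nodup) (hU : ∀ u ∈ S, u ∈ U) (J : List LabelledEdge) :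
    edgeFactor β (fun u J => ratio β lam U J u) b c S J =
      total β lam U (⟨false, c, S⟩ :: J) 1 / total β lam U (⟨b, false, S⟩ :: J) 1 := by
  unfold edgeFactor
  rw [chainProb_ratio hβ hl U _ S hS hU, chainProb_ratio hβ hl U _ S hS hU, total_cons_zero,
    total_cons_one]
  have := total_one_pos hβ hl U J
  rw [← mul_div_mul_right _ _ this.ne']
  congr 1 <;> field_simp

/-- Telescoping: each factor compares two instances that differ only in whether the current edge
sees `v` as `1` or as `0`. Such a pinned edge has at most one label left, which is the case treated
by `total_cons_zero` and `total_cons_one`. -/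
theorem edgeProduct_ratio {β lam : ℝ} (hβ : 0 < β) (hl : 0 < lam) (U : Finset ℕ) (v : ℕ)
    (I : List LabelledEdge) (hI : ∀ e ∈ I, e.support.Nodup ∧ ∀ u ∈ e.support, u ∈ U)
    (pre : List LabelledEdge) :
    edgeProduct β (fun _ u J => ratio β lam U J u) v pre I =
      total β lam U (pre ++ pin true v I) 1 / total β lam U (pre ++ pin false v I) 1 := by
  induction I generalizing pre with
  | nil => simp [edgeProduct, pin, (total_one_pos hβ hl U pre).ne']
  | cons e I ih =>
    have hI' := fun e he => hI e (List.mem_cons_of_mem _ he)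
    have perm1 : ∀ (e : LabelledEdge) (J : List LabelledEdge), (e :: pre ++ J).Perm (pre ++ e :: J) :=
      fun e J => List.perm_middle.symm
    simp only [edgeProduct, pin_cons]
    split_ifs with hv
    · obtain ⟨h1, h2⟩ := hI e (by simp)
      rw [edgeFactor_ratio hβ hl U _ _ _ (h1.filter _)
        (fun u hu => h2 u (List.mem_of_mem_filter hu)), ih hI']
      have e1 : (⟨false, e.oneOn, e.support.filter (· ≠ v)⟩ : LabelledEdge) = pinEdge true v e := by
        simp [pinEdge, hv]
      have e2 : (⟨e.zeroOn, false, e.support.filter (· ≠ v)⟩ : LabelledEdge) =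
          pinEdge false v e := by
        simp [pinEdge, hv]
      have perm2 : ∀ e : LabelledEdge, (e :: pre.reverseAux (pin false v I)).Perm
          (pre ++ e :: pin false v I) := by
        intro e
        rw [List.reverseAux_eq]
        refine List.Perm.trans ?_ (perm1 e _)
        exact (List.Perm.append_right _ (List.reverse_perm pre)).cons e
      rw [e1, e2, total_perm β lam U (perm2 _), total_perm β lam U (perm2 _),
        total_perm β lam U (perm1 _ (pin true v I)), total_perm β lam U (perm1 _ (pin false v I))]
      have := total_one_pos hβ hl U (pre ++ pinEdge true v e :: pin false v I)
      field_simp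
    · have e1 : ∀ s, pinEdge s v e = e := fun s => by simp [pinEdge, hv]
      rw [ih hI', e1, e1, total_perm β lam U (perm1 _ (pin true v I)),
        total_perm β lam U (perm1 _ (pin false v I))]

theorem ratio_eq {β lam : ℝ} (hβ : 0 < β) (hl : 0 < lam) (U : Finset ℕ) (v : ℕ) (hv : v ∈ U)
    (I : List LabelledEdge) (hI : ∀ e ∈ I, e.support.Nodup ∧ ∀ u ∈ e.support, u ∈ U) :
    ratio β lam U I v = lam * edgeProduct β (fun _ u J => ratio β lam U J u) v [] I := by
  rw [edgeProduct_ratio hβ hl U v I hI, ratio_eq_pin hβ hl U I v hv]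
  rfl

/-- The recursion for the ratios, truncated. An edge with `k` further free vertices reduces the
budget by `k + 1`. -/
noncomputable def approxRatio (β lam : ℝ) : ℕ → ℕ → List LabelledEdge → ℝ
  | 0, _, _ => lam
  -- The subtraction is truncated, so an edge with `k ≥ B` leads straight to the base case.
  | B + 1, v, I => lam * edgeProduct β (fun k u J => approxRatio β lam (B - k) u J) v [] I
termination_by B => B

end HypergraphSpin

namespace HypergraphSpin

open Finset

/-! ### Instances of bounded degree -/

/-- The number of edges of the list in which the vertex is free. -/
def degree (v : ℕ) (I : List LabelledEdge) : ℕ := I.countP (fun e => decide (v ∈ e.support))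

theorem degree_cons (v : ℕ) (e : LabelledEdge) (I : List LabelledEdge) :
    degree v (e :: I) = degree v I + if v ∈ e.support then 1 else 0 := by
  simp [degree, List.countP_cons]

theorem degree_reverseAux (v : ℕ) (I J : List LabelledEdge) :
    degree v (I.reverseAux J) = degree v I + degree v J := by
  simp [degree, List.reverseAux_eq]

theorem degree_pin_le (s : Bool) (u v : ℕ) (I : List LabelledEdge) :
    degree v (pin s u I) ≤ degree v I := by
  induction I with
  | nil => simp [pin]
  | cons e I ih =>
    rw [pin_cons, degree_cons, degree_cons]
    have : (if v ∈ (pinEdge s u e).support then 1 else 0) ≤ if v ∈ e.support then 1 else 0 := by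
      split_ifs with h1 h2
      · rfl
      · exact absurd (mem_of_mem_pinEdge h1) h2
      · omega
      · rfl
    omega

/-- The free vertices of the edges are in `U`, and no vertex is in more than `Δ` edges. -/
structure Admissible (U : Finset ℕ) (Δ : ℕ) (I : List LabelledEdge) : Prop where
  edges : ∀ e ∈ I, e.support.Nodup ∧ ∀ u ∈ e.support, u ∈ U
  degree_le : ∀ v, degree v I ≤ Δ

theorem pinEdge_nodup_subset {U : Finset ℕ} (s : Bool) (v : ℕ) {e : LabelledEdge}
    (h : e.support.Nodup ∧ ∀ u ∈ e.support, u ∈ U) :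
    (pinEdge s v e).support.Nodup ∧ ∀ u ∈ (pinEdge s v e).support, u ∈ U := by
  refine ⟨?_, fun u hu => h.2 u (mem_of_mem_pinEdge hu)⟩
  unfold pinEdge
  split_ifs
  · exact h.1.filter _
  · exact h.1

theorem Admissible.pin {U : Finset ℕ} {Δ : ℕ} {I : List LabelledEdge} (h : Admissible U Δ I)
    (s : Bool) (v : ℕ) : Admissible U Δ (pin s v I) := by
  refine ⟨fun e he => ?_, fun u => (degree_pin_le s v u I).trans (h.degree_le u)⟩
  obtain ⟨e', he', rfl⟩ := List.mem_map.1 he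
  exact pinEdge_nodup_subset s v (h.edges e' he')

/-- Here `pre.reverseAux (e :: I)` describes a stage of the scan in `edgeProduct`: edges already
passed, the current one, and those to come. Its admissibility is the loop invariant;
`Admissible.without` yields the instance for the recursive calls and `Admissible.next` the following
stage. -/
theorem Admissible.current {U : Finset ℕ} {Δ : ℕ} {pre I : List LabelledEdge} {e : LabelledEdge}
    (h : Admissible U Δ (pre.reverseAux (e :: I))) :
    e.support.Nodup ∧ ∀ u ∈ e.support, u ∈ U := by
  apply h.edges
  simp [List.reverseAux_eq]

theorem Admissible.filter_nodup {U : Finset ℕ} {Δ : ℕ} {pre I : List LabelledEdge}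
    {e : LabelledEdge} (h : Admissible U Δ (pre.reverseAux (e :: I))) (v : ℕ) :
    (e.support.filter (· ≠ v)).Nodup ∧ ∀ u ∈ e.support.filter (· ≠ v), u ∈ U :=
  ⟨h.current.1.filter _, fun u hu => h.current.2 u (List.mem_of_mem_filter hu)⟩

theorem Admissible.without {U : Finset ℕ} {Δ : ℕ} {pre I : List LabelledEdge} {e : LabelledEdge}
    (h : Admissible U Δ (pre.reverseAux (e :: I))) (s : Bool) (v : ℕ) :
    Admissible U Δ (pre.reverseAux (HypergraphSpin.pin s v I)) := by
  refine ⟨fun e' he' => ?_, fun u => ?_⟩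
  · simp only [List.reverseAux_eq, List.mem_append, List.mem_reverse] at he'
    rcases he' with he' | he'
    · exact h.edges e' (by simp [List.reverseAux_eq, he'])
    · obtain ⟨e'', he'', rfl⟩ := List.mem_map.1 he'
      exact pinEdge_nodup_subset s v (h.edges e'' (by simp [List.reverseAux_eq, he'']))
  · have := h.degree_le u
    have := degree_pin_le s v u I
    rw [degree_reverseAux] at *
    rw [degree_cons] at *
    omega

theorem Admissible.next {U : Finset ℕ} {Δ : ℕ} {pre I : List LabelledEdge} {e : LabelledEdge}
    (h : Admissible U Δ (pre.reverseAux (e :: I))) (s : Bool) (v : ℕ) :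
    Admissible U Δ ((pinEdge s v e :: pre).reverseAux I) := by
  refine ⟨fun e' he' => ?_, fun u => ?_⟩
  · simp only [List.reverseAux_eq, List.mem_append, List.mem_reverse, List.mem_cons] at he'
    rcases he' with (rfl | he') | he'
    · exact pinEdge_nodup_subset s v h.current
    · exact h.edges e' (by simp [List.reverseAux_eq, he'])
    · exact h.edges e' (by simp [List.reverseAux_eq, he'])
  · have := h.degree_le u
    have : (if u ∈ (pinEdge s v e).support then 1 else 0) ≤ if u ∈ e.support then 1 else 0 := by
      split_ifs with h1 h2
      · rfl
      · exact absurd (mem_of_mem_pinEdge h1) h2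
      · omega
      · rfl
    rw [degree_reverseAux] at *
    rw [degree_cons] at *
    omega

/-! ### Correlation decay -/

/-- The ratio that `f` yields for the vertex number `j` in `chainProb f s S I`. -/
noncomputable def chainValue (f : ℕ → List LabelledEdge → ℝ) (s : Bool) :
    List ℕ → List LabelledEdge → ℕ → ℝ
  | [], _, _ => 1
  | u :: _, I, 0 => f u I
  | u :: S, I, j + 1 => chainValue f s S (pin s u I) j

theorem chainProb_eq_prod (f : ℕ → List LabelledEdge → ℝ) (s : Bool) (S : List ℕ)
    (I : List LabelledEdge) :
    chainProb f s S I = ∏ j ∈ range S.length, stateProb s (chainValue f s S I j) := by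
  induction S generalizing I with
  | nil => simp [chainProb]
  | cons u S ih => rw [chainProb, ih, List.length_cons, prod_range_succ', mul_comm]; rfl

/-- Every instance met along a chain is a pinning of an admissible one. Keeping `P` general covers
positivity, bounds on log-odds and the distance of two families at once. -/
theorem chainValue_rel {U : Finset ℕ} {Δ : ℕ} (f g : ℕ → List LabelledEdge → ℝ)
    (P : ℝ → ℝ → Prop) (h : ∀ u ∈ U, ∀ J, Admissible U Δ J → P (f u J) (g u J)) (s : Bool)
    (S : List ℕ) (hS : ∀ u ∈ S, u ∈ U) (I : List LabelledEdge) (hI : Admissible U Δ I)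
    (j : ℕ) (hj : j < S.length) : P (chainValue f s S I j) (chainValue g s S I j) := by
  induction S generalizing I j with
  | nil => simp at hj
  | cons u S ih =>
    cases j with
    | zero => exact h u (hS u (by simp)) I hI
    | succ j =>
      exact ih (fun w hw => hS w (by simp [hw])) _ (hI.pin s u) j (by simpa using hj)

theorem stateProb_true {R : ℝ} (hR : 0 < R) : stateProb true R = Real.sigmoid (Real.log R) := by
  rw [Real.sigmoid_def, Real.exp_neg, Real.exp_log hR]
  simp only [stateProb, if_true]
  field_simp
  ring

theorem stateProb_false {R : ℝ} (hR : 0 < R) :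
    stateProb false R = Real.sigmoid (-Real.log R) := by
  rw [Real.sigmoid_def, neg_neg, Real.exp_log hR]
  simp [stateProb]

theorem stateProb_mem {R : ℝ} (hR : 0 < R) (s : Bool) :
    0 < stateProb s R ∧ stateProb s R ≤ 1 := by
  cases s
  · rw [stateProb_false hR]; exact ⟨Real.sigmoid_pos _, Real.sigmoid_le_one _⟩
  · rw [stateProb_true hR]; exact ⟨Real.sigmoid_pos _, Real.sigmoid_le_one _⟩

theorem chainProb_mem {U : Finset ℕ} {Δ : ℕ} {f : ℕ → List LabelledEdge → ℝ}
    (h : ∀ u ∈ U, ∀ J, Admissible U Δ J → 0 < f u J) (s : Bool)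
    (S : List ℕ) (hS : ∀ u ∈ S, u ∈ U) (I : List LabelledEdge) (hI : Admissible U Δ I) :
    0 < chainProb f s S I ∧ chainProb f s S I ≤ 1 := by
  rw [chainProb_eq_prod]
  have h1 : ∀ j ∈ range S.length, 0 < chainValue f s S I j := fun j hj =>
    chainValue_rel f f (fun x _ => 0 < x) h s S hS I hI j (mem_range.1 hj)
  exact ⟨prod_pos fun j hj => (stateProb_mem (h1 j hj) s).1,
    prod_le_one (fun j hj => (stateProb_mem (h1 j hj) s).1.le)
      (fun j hj => (stateProb_mem (h1 j hj) s).2)⟩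

/-- Numerator and denominator both lie in `[β, 1]`. This a priori bound keeps all log-odds in a
fixed interval and starts the induction on the budget. -/
theorem edgeFactor_mem {U : Finset ℕ} {Δ : ℕ} {f : ℕ → List LabelledEdge → ℝ} {β : ℝ}
    (hβ : 0 < β) (hβ1 : β ≤ 1) (h : ∀ u ∈ U, ∀ J, Admissible U Δ J → 0 < f u J) (b c : Bool)
    (S : List ℕ) (hS : ∀ u ∈ S, u ∈ U) (I : List LabelledEdge) (hI : Admissible U Δ I) :
    0 < edgeFactor β f b c S I ∧ |Real.log (edgeFactor β f b c S I)| ≤ -Real.log β := by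
  have key : ∀ s b : Bool,
      β ≤ 1 - (if b = true then 1 - β else 0) * chainProb f s S I ∧
      1 - (if b = true then 1 - β else 0) * chainProb f s S I ≤ 1 := by
    intro s b
    obtain ⟨h1, h2⟩ := chainProb_mem h s S hS I hI
    cases b
    · simpa using hβ1
    · simp only [if_true]; constructor <;> nlinarith
  obtain ⟨h1, h2⟩ := key true c
  obtain ⟨h3, h4⟩ := key false b
  unfold edgeFactor
  have p1 := hβ.trans_le h1
  have p2 := hβ.trans_le h3
  refine ⟨div_pos p1 p2, ?_⟩
  rw [Real.log_div p1.ne' p2.ne', abs_le]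
  have := Real.log_le_log hβ h1
  have := Real.log_le_log hβ h3
  have := Real.log_nonpos p1.le h2
  have := Real.log_nonpos p2.le h4
  constructor <;> linarith

theorem edgeFactor_contraction {U : Finset ℕ} {Δ : ℕ} {f g : ℕ → List LabelledEdge → ℝ}
    {β Λ δ : ℝ} (hβ : 0 < β) (hβ1 : β ≤ 1) (hδ : 0 ≤ δ)
    (hf : ∀ u ∈ U, ∀ J, Admissible U Δ J → 0 < f u J ∧ |Real.log (f u J)| ≤ Λ)
    (hg : ∀ u ∈ U, ∀ J, Admissible U Δ J → 0 < g u J ∧ |Real.log (g u J)| ≤ Λ)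
    (hfg : ∀ u ∈ U, ∀ J, Admissible U Δ J → |Real.log (f u J) - Real.log (g u J)| ≤ δ)
    (b c : Bool) (S : List ℕ) (hS : ∀ u ∈ S, u ∈ U) (I : List LabelledEdge)
    (hI : Admissible U Δ I) :
    |Real.log (edgeFactor β f b c S I) - Real.log (edgeFactor β g b c S I)| ≤
      (1 - β) / β * edgeRate (Real.sigmoid Λ) S.length * δ := by
  set p : (ℕ → List LabelledEdge → ℝ) → ℕ → ℝ := fun f j => Real.log (chainValue f true S I j)
    with hp
  set q : (ℕ → List LabelledEdge → ℝ) → ℕ → ℝ := fun f j => -Real.log (chainValue f false S I j)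
    with hq
  have hval : ∀ f : ℕ → List LabelledEdge → ℝ,
      (∀ u ∈ U, ∀ J, Admissible U Δ J → 0 < f u J ∧ |Real.log (f u J)| ≤ Λ) →
      ∀ s, ∀ j < S.length, 0 < chainValue f s S I j ∧ |Real.log (chainValue f s S I j)| ≤ Λ :=
    fun f hf s j hj => chainValue_rel f f (fun x _ => 0 < x ∧ |Real.log x| ≤ Λ) hf s S hS I hI j hj
  have hval2 : ∀ s, ∀ j < S.length,
      |Real.log (chainValue f s S I j) - Real.log (chainValue g s S I j)| ≤ δ :=
    fun s j hj => chainValue_rel f g (fun x y => |Real.log x - Real.log y| ≤ δ) hfg s S hS I hI j hj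
  have htrue : ∀ f : ℕ → List LabelledEdge → ℝ,
      (∀ u ∈ U, ∀ J, Admissible U Δ J → 0 < f u J ∧ |Real.log (f u J)| ≤ Λ) →
      chainProb f true S I = ∏ j ∈ range S.length, Real.sigmoid (p f j) := by
    intro f hf
    rw [chainProb_eq_prod]
    exact prod_congr rfl fun j hj => stateProb_true (hval f hf true j (mem_range.1 hj)).1
  have hfalse : ∀ f : ℕ → List LabelledEdge → ℝ,
      (∀ u ∈ U, ∀ J, Admissible U Δ J → 0 < f u J ∧ |Real.log (f u J)| ≤ Λ) →
      chainProb f false S I = ∏ j ∈ range S.length, Real.sigmoid (q f j) := by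
    intro f hf
    rw [chainProb_eq_prod]
    exact prod_congr rfl fun j hj => stateProb_false (hval f hf false j (mem_range.1 hj)).1
  -- Nothing has been pinned yet at the head of `S`, so the two chains use the same ratio there,
  -- with opposite signs of the logarithm.
  have hhead : ∀ f : ℕ → List LabelledEdge → ℝ, 0 < S.length → q f 0 = -p f 0 := by
    intro f hS
    cases S with
    | nil => simp at hS
    | cons u S => rfl
  have hMp : ∀ f : ℕ → List LabelledEdge → ℝ,
      (∀ u ∈ U, ∀ J, Admissible U Δ J → 0 < f u J ∧ |Real.log (f u J)| ≤ Λ) →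
      ∀ j < S.length, Real.sigmoid (p f j) ≤ Real.sigmoid Λ := fun f hf j hj =>
    Real.sigmoid_le ((le_abs_self _).trans (hval f hf true j hj).2)
  have hMq : ∀ f : ℕ → List LabelledEdge → ℝ,
      (∀ u ∈ U, ∀ J, Admissible U Δ J → 0 < f u J ∧ |Real.log (f u J)| ≤ Λ) →
      ∀ j < S.length, Real.sigmoid (q f j) ≤ Real.sigmoid Λ := fun f hf j hj =>
    Real.sigmoid_le ((neg_le_abs _).trans (hval f hf false j hj).2)
  have hlog : ∀ f : ℕ → List LabelledEdge → ℝ,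
      (∀ u ∈ U, ∀ J, Admissible U Δ J → 0 < f u J ∧ |Real.log (f u J)| ≤ Λ) →
      Real.log (edgeFactor β f b c S I) =
        Real.log (1 - (if c = true then 1 - β else 0) * chainProb f true S I) -
        Real.log (1 - (if b = true then 1 - β else 0) * chainProb f false S I) := by
    intro f hf
    have key : ∀ s b : Bool, (1 - (if b = true then 1 - β else 0) * chainProb f s S I) ≠ 0 := by
      intro s b
      obtain ⟨h1, h2⟩ := chainProb_mem (fun u hu J hJ => (hf u hu J hJ).1) s S hS I hI
      cases b
      · simp
      · simp only [if_true]; nlinarith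
    exact Real.log_div (key _ _) (key _ _)
  have hb : ∀ b : Bool, 0 ≤ (if b = true then 1 - β else 0) ∧
      (if b = true then 1 - β else 0) ≤ 1 - β := by
    intro b; cases b <;> simp <;> linarith
  rw [hlog f hf, hlog g hg, htrue f hf, htrue g hg, hfalse f hf, hfalse g hg]
  have := edge_contraction S.length (p g) (q g) (p f) (q f) (1 - β)
    (if c = true then 1 - β else 0) (if b = true then 1 - β else 0) δ (Real.sigmoid Λ)
    (hhead g) (hhead f) (fun j hj => hval2 true j hj)
    (fun j hj => by
      simp only [hq]
      rw [neg_sub_neg, abs_sub_comm]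
      exact hval2 false j hj)
    (hMp g hg) (hMp f hf) (hMq g hg) (hMq f hf) (by linarith) (hb c).1 (hb c).2 (hb b).1 (hb b).2 hδ
  simpa using this

theorem edgeProduct_mem {U : Finset ℕ} {Δ : ℕ} {f : ℕ → ℕ → List LabelledEdge → ℝ} {β : ℝ}
    (hβ : 0 < β) (hβ1 : β ≤ 1) (h : ∀ k, ∀ u ∈ U, ∀ J, Admissible U Δ J → 0 < f k u J) (v : ℕ)
    (I pre : List LabelledEdge) (hI : Admissible U Δ (pre.reverseAux I)) :
    0 < edgeProduct β f v pre I ∧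
      |Real.log (edgeProduct β f v pre I)| ≤ degree v I * -Real.log β := by
  induction I generalizing pre with
  | nil => simp [edgeProduct, degree]
  | cons e I ih =>
    rw [degree_cons]
    simp only [edgeProduct]
    split_ifs with hv
    · obtain ⟨h1, h2⟩ := edgeFactor_mem hβ hβ1 (h (e.support.filter (· ≠ v)).length) e.zeroOn e.oneOn
        (e.support.filter (· ≠ v)) (hI.filter_nodup v).2 _ (hI.without false v)
      obtain ⟨h3, h4⟩ := ih _ (hI.next true v)
      refine ⟨mul_pos h1 h3, ?_⟩
      rw [Real.log_mul h1.ne' h3.ne']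
      refine (abs_add_le _ _).trans ?_
      push_cast
      linarith
    · have := hI.next true v
      rw [show pinEdge true v e = e by simp [pinEdge, hv]] at this
      simpa using ih _ this

/-- The error `δ k` of the recursive values may grow with the edge size `k`, as larger edges leave
less budget. What matters is that rate times error has the bound `E` uniformly in `k`. -/
theorem edgeProduct_contraction {U : Finset ℕ} {Δ : ℕ} {f g : ℕ → ℕ → List LabelledEdge → ℝ}
    {β Λ E : ℝ} {δ : ℕ → ℝ} (hβ : 0 < β) (hβ1 : β ≤ 1) (hδ : ∀ k, 0 ≤ δ k)
    (hf : ∀ k, ∀ u ∈ U, ∀ J, Admissible U Δ J → 0 < f k u J ∧ |Real.log (f k u J)| ≤ Λ)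
    (hg : ∀ k, ∀ u ∈ U, ∀ J, Admissible U Δ J → 0 < g k u J ∧ |Real.log (g k u J)| ≤ Λ)
    (hfg : ∀ k, ∀ u ∈ U, ∀ J, Admissible U Δ J →
      |Real.log (f k u J) - Real.log (g k u J)| ≤ δ k)
    (hE : ∀ k, (1 - β) / β * edgeRate (Real.sigmoid Λ) k * δ k ≤ E) (v : ℕ)
    (I pre : List LabelledEdge) (hI : Admissible U Δ (pre.reverseAux I)) :
    |Real.log (edgeProduct β f v pre I) - Real.log (edgeProduct β g v pre I)| ≤
      degree v I * E := by
  induction I generalizing pre with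
  | nil => simp [edgeProduct, degree]
  | cons e I ih =>
    rw [degree_cons]
    simp only [edgeProduct]
    split_ifs with hv
    · set k := (e.support.filter (· ≠ v)).length
      have hf' := fun k u hu J hJ => (hf k u hu J hJ).1
      have hg' := fun k u hu J hJ => (hg k u hu J hJ).1
      have hJ := hI.without false v
      have hS := (hI.filter_nodup v).2
      have h1 := (edgeFactor_mem hβ hβ1 (hf' k) e.zeroOn e.oneOn _ hS _ hJ).1
      have h2 := (edgeFactor_mem hβ hβ1 (hg' k) e.zeroOn e.oneOn _ hS _ hJ).1
      have h3 := (edgeProduct_mem hβ hβ1 hf' v I _ (hI.next true v)).1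
      have h4 := (edgeProduct_mem hβ hβ1 hg' v I _ (hI.next true v)).1
      have h5 := edgeFactor_contraction hβ hβ1 (hδ k) (hf k) (hg k) (hfg k) e.zeroOn e.oneOn _ hS _ hJ
      have h6 := ih _ (hI.next true v)
      rw [Real.log_mul h1.ne' h3.ne', Real.log_mul h2.ne' h4.ne', add_sub_add_comm]
      refine (abs_add_le _ _).trans ?_
      have := hE k
      push_cast
      linarith
    · have := hI.next true v
      rw [show pinEdge true v e = e by simp [pinEdge, hv]] at this
      simpa using ih _ this

/-- The parameters for which the recursion contracts, with constants that are uniform in the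
interaction and the field. -/
structure DecayParams (Δ : ℕ) (β₀ Λ₀ θ : ℝ) : Prop where
  beta_pos : 0 < β₀
  beta_le : β₀ ≤ 1
  theta_pos : 0 < θ
  theta_lt : θ < 1
  rate : ∀ k : ℕ, (Δ * ((1 - β₀) / β₀)) *
    edgeRate (Real.sigmoid (Λ₀ + Δ * -Real.log β₀)) k ≤ θ ^ (k + 1)

theorem edgeRate_nonneg {M : ℝ} (hM : 0 ≤ M) (k : ℕ) : 0 ≤ edgeRate M k := by
  unfold edgeRate; positivity

section Decay

variable {Δ : ℕ} {β₀ Λ₀ θ β lam : ℝ} (hD : DecayParams Δ β₀ Λ₀ θ) (hβ : β₀ ≤ β) (hβ1 : β ≤ 1)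
  (hl : 0 < lam) (hΛ : |Real.log lam| ≤ Λ₀) {U : Finset ℕ}

include hD hβ hβ1 hl hΛ

/-- As `f` is an arbitrary positive family, this applies to the exact ratios and to the truncated
ones alike. -/
theorem log_mul_edgeProduct_le {f : ℕ → ℕ → List LabelledEdge → ℝ}
    (h : ∀ k, ∀ u ∈ U, ∀ J, Admissible U Δ J → 0 < f k u J) (v : ℕ)
    (I : List LabelledEdge) (hI : Admissible U Δ I) :
    0 < lam * edgeProduct β f v [] I ∧
      |Real.log (lam * edgeProduct β f v [] I)| ≤ Λ₀ + Δ * -Real.log β₀ ∧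
      |Real.log (lam * edgeProduct β f v [] I) - Real.log lam| ≤ Δ * -Real.log β₀ := by
  obtain ⟨h1, h2⟩ := edgeProduct_mem (hD.beta_pos.trans_le hβ) hβ1 h v I [] hI
  have h3 : |Real.log (edgeProduct β f v [] I)| ≤ Δ * -Real.log β₀ := by
    refine h2.trans ?_
    have e1 : (degree v I : ℝ) ≤ Δ := by exact_mod_cast hI.degree_le v
    have e2 := Real.log_le_log hD.beta_pos hβ
    have e3 := Real.log_nonpos (hD.beta_pos.trans_le hβ).le hβ1
    gcongr
    linarith
  refine ⟨mul_pos hl h1, ?_, ?_⟩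
  · rw [Real.log_mul hl.ne' h1.ne']
    exact (abs_add_le _ _).trans (add_le_add hΛ h3)
  · rw [Real.log_mul hl.ne' h1.ne', add_sub_cancel_left]
    exact h3

theorem ratio_mem (v : ℕ) (hv : v ∈ U) (I : List LabelledEdge) (hI : Admissible U Δ I) :
    0 < ratio β lam U I v ∧ |Real.log (ratio β lam U I v)| ≤ Λ₀ + Δ * -Real.log β₀ ∧
      |Real.log (ratio β lam U I v) - Real.log lam| ≤ Δ * -Real.log β₀ := by
  have hβ0 := hD.beta_pos.trans_le hβ
  rw [ratio_eq hβ0 hl U v hv I hI.edges]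
  exact log_mul_edgeProduct_le hD hβ hβ1 hl hΛ (fun _ u hu J _ => ratio_pos hβ0 hl U J u hu) v I hI

/-- Correlation decay: the truncated recursion approximates the ratios with an error that is
exponentially small in the budget. -/
theorem approxRatio_error (B v : ℕ) (hv : v ∈ U) (I : List LabelledEdge)
    (hI : Admissible U Δ I) :
    0 < approxRatio β lam B v I ∧
      |Real.log (approxRatio β lam B v I)| ≤ Λ₀ + Δ * -Real.log β₀ ∧
      |Real.log (approxRatio β lam B v I) - Real.log (ratio β lam U I v)| ≤
        Δ * -Real.log β₀ * θ ^ B := by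
  have hβ0 := hD.beta_pos.trans_le hβ
  have hL : 0 ≤ -Real.log β₀ := by
    have := Real.log_nonpos hD.beta_pos.le hD.beta_le
    linarith
  induction B using Nat.strong_induction_on generalizing v I with
  | _ B ih =>
    cases B with
    | zero =>
      rw [approxRatio]
      refine ⟨hl, hΛ.trans (by have : 0 ≤ (Δ : ℝ) * -Real.log β₀ := by positivity
                               linarith), ?_⟩
      rw [pow_zero, mul_one, abs_sub_comm]
      exact (ratio_mem hD hβ hβ1 hl hΛ v hv I hI).2.2
    | succ B =>
      rw [approxRatio]
      have ih' := fun k u hu J hJ => ih (B - k) (by omega) u hu J hJ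
      obtain ⟨h1, h2, -⟩ := log_mul_edgeProduct_le hD hβ hβ1 hl hΛ
        (fun k u hu J hJ => (ih' k u hu J hJ).1) v I hI
      refine ⟨h1, h2, ?_⟩
      rw [ratio_eq hβ0 hl U v hv I hI.edges]
      have hr := fun (_ : ℕ) u (hu : u ∈ U) J (hJ : Admissible U Δ J) =>
        ratio_mem hD hβ hβ1 hl hΛ u hu J hJ
      have p1 := (edgeProduct_mem hβ0 hβ1 (fun k u hu J hJ => (ih' k u hu J hJ).1) v I [] hI).1
      have p2 := (edgeProduct_mem hβ0 hβ1 (fun k u hu J hJ => (hr k u hu J hJ).1) v I [] hI).1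
      rw [Real.log_mul hl.ne' p1.ne', Real.log_mul hl.ne' p2.ne', add_sub_add_left_eq_sub]
      have hE := edgeProduct_contraction (E := -Real.log β₀ * θ ^ (B + 1))
        (δ := fun k => Δ * -Real.log β₀ * θ ^ (B - k)) hβ0 hβ1
        (fun k => by have := hD.theta_pos; positivity)
        (fun k u hu J hJ => ⟨(ih' k u hu J hJ).1, (ih' k u hu J hJ).2.1⟩)
        (fun k u hu J hJ => ⟨(hr k u hu J hJ).1, (hr k u hu J hJ).2.1⟩)
        (fun k u hu J hJ => (ih' k u hu J hJ).2.2) (by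
          intro k
          have hθ := hD.theta_pos
          have e1 := hD.rate k
          have e2 : (1 - β) / β ≤ (1 - β₀) / β₀ := by
            rw [div_le_div_iff₀ hβ0 hD.beta_pos]; linarith
          have e3 : 0 ≤ edgeRate (Real.sigmoid (Λ₀ + Δ * -Real.log β₀)) k :=
            edgeRate_nonneg (Real.sigmoid_nonneg _) k
          -- The rate `θ ^ (k+1)` pays for exactly the budget that the edge consumed; truncation of
          -- `B - k` only enlarges the exponent.
          have e4 : θ ^ (k + 1) * θ ^ (B - k) ≤ θ ^ (B + 1) := by
            rw [← pow_add]
            exact pow_le_pow_of_le_one hθ.le hD.theta_lt.le (by omega)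
          calc (1 - β) / β * edgeRate (Real.sigmoid (Λ₀ + Δ * -Real.log β₀)) k *
                (Δ * -Real.log β₀ * θ ^ (B - k))
              ≤ (1 - β₀) / β₀ * edgeRate (Real.sigmoid (Λ₀ + Δ * -Real.log β₀)) k *
                (Δ * -Real.log β₀ * θ ^ (B - k)) := by gcongr
            _ = ((Δ * ((1 - β₀) / β₀)) * edgeRate (Real.sigmoid (Λ₀ + Δ * -Real.log β₀)) k) *
                (-Real.log β₀ * θ ^ (B - k)) := by ring
            _ ≤ θ ^ (k + 1) * (-Real.log β₀ * θ ^ (B - k)) := by gcongr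
            _ = -Real.log β₀ * (θ ^ (k + 1) * θ ^ (B - k)) := by ring
            _ ≤ _ := by gcongr)
        v I [] hI
      refine hE.trans ?_
      have e1 : (degree v I : ℝ) ≤ Δ := by exact_mod_cast hI.degree_le v
      have hθ := hD.theta_pos
      calc (degree v I : ℝ) * (-Real.log β₀ * θ ^ (B + 1))
          ≤ Δ * (-Real.log β₀ * θ ^ (B + 1)) := by gcongr
        _ = _ := by ring

omit hD hβ hβ1 hl hΛ in
-- If `x ≤ exp d * y` with `d ≥ 0`, then also `1 + x ≤ exp d * (1 + y)`. Thus an error in log-odds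
-- bounds the error in the logarithm of `1 / (1 + R)`.
theorem abs_log_one_add_sub_le {x y : ℝ} (hx : 0 < x) (hy : 0 < y) :
    |Real.log (1 + x) - Real.log (1 + y)| ≤ |Real.log x - Real.log y| := by
  have key : ∀ x y : ℝ, 0 < x → 0 < y →
      Real.log (1 + x) - Real.log (1 + y) ≤ |Real.log x - Real.log y| := by
    intro x y hx hy
    have h1 : x ≤ Real.exp |Real.log x - Real.log y| * y := by
      calc x = Real.exp (Real.log x - Real.log y) * y := by
            rw [Real.exp_sub, Real.exp_log hx, Real.exp_log hy]; field_simp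
        _ ≤ _ := by gcongr; exact le_abs_self _
    have h2 : 1 ≤ Real.exp |Real.log x - Real.log y| := Real.one_le_exp (abs_nonneg _)
    have h3 : Real.log (1 + x) ≤ Real.log (Real.exp |Real.log x - Real.log y| * (1 + y)) :=
      Real.log_le_log (by linarith) (by linarith)
    rw [Real.log_mul (Real.exp_pos _).ne' (by linarith), Real.log_exp] at h3
    linarith
  rw [abs_le]
  have h1 := key x y hx hy
  have h2 := key y x hy hx
  rw [abs_sub_comm] at h2
  constructor <;> linarith

theorem chainProb_error (B : ℕ) (S : List ℕ) (hS : ∀ u ∈ S, u ∈ U) (I : List LabelledEdge)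
    (hI : Admissible U Δ I) :
    |Real.log (chainProb (approxRatio β lam B) false S I) -
      Real.log (chainProb (fun u J => ratio β lam U J u) false S I)| ≤
      S.length * (Δ * -Real.log β₀ * θ ^ B) := by
  induction S generalizing I with
  | nil => simp [chainProb]
  | cons u S ih =>
    have hS' : ∀ w ∈ S, w ∈ U := fun w hw => hS w (by simp [hw])
    have ha := approxRatio_error hD hβ hβ1 hl hΛ B u (hS u (by simp)) I hI
    have hr := ratio_mem hD hβ hβ1 hl hΛ u (hS u (by simp)) I hI
    have c1 := (chainProb_mem (fun u hu J hJ => (approxRatio_error hD hβ hβ1 hl hΛ B u hu J hJ).1)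
      false S hS' _ (hI.pin false u)).1
    have c2 := (chainProb_mem (fun u hu J hJ => (ratio_mem hD hβ hβ1 hl hΛ u hu J hJ).1)
      false S hS' _ (hI.pin false u)).1
    have h1 := ih hS' _ (hI.pin false u)
    have h2 := abs_log_one_add_sub_le ha.1 hr.1
    simp only [chainProb]
    rw [Real.log_mul (stateProb_mem ha.1 false).1.ne' c1.ne',
      Real.log_mul (stateProb_mem hr.1 false).1.ne' c2.ne', add_sub_add_comm]
    refine (abs_add_le _ _).trans ?_
    have e : ∀ R : ℝ, Real.log (stateProb false R) = -Real.log (1 + R) := by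
      intro R; simp [stateProb]
    rw [e, e, neg_sub_neg, abs_sub_comm]
    rw [List.length_cons]
    push_cast
    linarith [ha.2.2]

/-- The partition function is approximated by the chain of the approximate ratios. -/
theorem total_error (B : ℕ) (S : List ℕ) (hSn : S.Nodup) (hS : ∀ u, u ∈ S ↔ u ∈ U)
    (I : List LabelledEdge) (hI : Admissible U Δ I) (hon : ∀ e ∈ I, e.zeroOn = true) :
    |Real.log (β ^ I.length / chainProb (approxRatio β lam B) false S I) -
      Real.log (total β lam U I 1)| ≤ S.length * (Δ * -Real.log β₀ * θ ^ B) := by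
  have hβ0 := hD.beta_pos.trans_le hβ
  have h1 := chainProb_error hD hβ hβ1 hl hΛ B S (fun u hu => (hS u).1 hu) I hI
  -- Only the empty set of ones survives the indicator, and there every edge has its zero label
  -- active.
  have h2 : total β lam U I (stateIndicator false S) = β ^ I.length := by
    unfold total
    rw [sum_eq_single ∅]
    · have hw : ∀ e ∈ I, labelWeight β ∅ e = β := fun e he => by simp [labelWeight, hon e he]
      rw [configWeight, List.map_congr_left hw]
      simp [stateIndicator]
    · intro A hA hne
      obtain ⟨u, hu⟩ := nonempty_iff_ne_empty.2 hne
      have hu' := (hS u).2 (mem_powerset.1 hA hu)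
      have : ¬ ∀ u ∈ S, (u ∈ A ↔ false = true) := fun h => by simpa using (h u hu').1 hu
      simp only [stateIndicator, if_neg this, mul_zero]
    · intro h; simp at h
  rw [chainProb_ratio hβ0 hl U false S hSn (fun u hu => (hS u).1 hu), h2] at h1
  have hT := total_one_pos hβ0 hl U I
  have hC := (chainProb_mem (fun u hu J hJ => (approxRatio_error hD hβ hβ1 hl hΛ B u hu J hJ).1)
      false S (fun u hu => (hS u).1 hu) I hI).1
  have hB : 0 < β ^ I.length := pow_pos hβ0 _
  rw [Real.log_div hB.ne' hT.ne'] at h1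
  rw [Real.log_div hB.ne' hC.ne', abs_sub_comm]
  convert h1 using 2
  ring

end Decay

end HypergraphSpin

namespace TreeMachine

open Term HypergraphSpin

/-! ### The program -/

/-- Terms with oracles for the parameters of the Ising model. -/
abbrev IsingTerm : Type := Term IsingParam

/-- The digit one. -/
def oneTerm : IsingTerm := .cons .nil .nil

/-- The numbers in `call` are positions in `isingProgram`. The nonempty branch of a `case` shifts
the older variables by two and a `bind` by one. The outer `case`s of most bodies only unpack the
argument tuple. -/
def incBody : IsingTerm :=
  .case (.var 0) (.cons oneTerm .nil)
    (.case (.var 0) (.cons oneTerm (.var 1)) (.cons .nil (.call 1 (.var 3))))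

/-- Output digit `s`, next carry `c`; `k` counts the variables bound by the preceding tests of
digits and carry. -/
def adcOut (s c : IsingTerm) (k : ℕ) : IsingTerm :=
  .cons s (.call 2 (.cons c (.cons (.var (3 + k)) (.var (1 + k)))))

def adcBody : IsingTerm :=
  .case (.var 0) .nil <| .case (.var 1) .nil <|
  .case (.var 0) (.case (.var 2) (.var 1) (.call 1 (.var 3))) <|
  .case (.var 3) (.case (.var 4) (.var 2) (.call 1 (.var 4))) <|
  .case (.var 6)
    (.case (.var 2)
      (.case (.var 0) (adcOut .nil .nil 0) (adcOut oneTerm .nil 2))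
      (.case (.var 2) (adcOut oneTerm .nil 2) (adcOut .nil oneTerm 4)))
    (.case (.var 4)
      (.case (.var 2) (adcOut oneTerm .nil 2) (adcOut .nil oneTerm 4))
      (.case (.var 4) (adcOut .nil oneTerm 4) (adcOut oneTerm oneTerm 6)))

def mulBody : IsingTerm :=
  .case (.var 0) .nil <| .case (.var 0) .nil <|
  .bind (.call 3 (.cons (.var 1) (.var 3))) <|
  .case (.var 1) (.cons .nil (.var 0))
    (.call 2 (.cons .nil (.cons (.cons .nil (.var 2)) (.var 6))))

/-- A vertex is a list identified by its length, so equality of vertices is tested by shortening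
both lists in parallel. -/
def eqBody : IsingTerm :=
  .case (.var 0) .nil <|
  .case (.var 0) (.case (.var 1) oneTerm .nil) <|
  .case (.var 3) .nil (.call 4 (.cons (.var 3) (.var 1)))

def memBody : IsingTerm :=
  .case (.var 0) .nil <| .case (.var 1) .nil <|
  .case (.call 4 (.cons (.var 2) (.var 0))) (.call 5 (.cons (.var 2) (.var 1))) oneTerm

def remBody : IsingTerm :=
  .case (.var 0) .nil <| .case (.var 1) .nil <|
  .case (.call 4 (.cons (.var 2) (.var 0)))
    (.cons (.var 0) (.call 6 (.cons (.var 2) (.var 1))))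
    (.call 6 (.cons (.var 4) (.var 3)))

def pinEdgeBody : IsingTerm :=
  .case (.var 0) .nil <| .case (.var 1) .nil <| .case (.var 1) .nil <|
  .case (.var 0) (.var 3) <|
  .case (.call 5 (.cons (.var 4) (.var 3))) (.var 5) <|
  .case (.var 8) (.cons (.cons (.var 2) .nil) (.call 6 (.cons (.var 6) (.var 5))))
    (.cons (.cons .nil (.var 5)) (.call 6 (.cons (.var 8) (.var 7))))

def pinBody : IsingTerm :=
  .case (.var 0) .nil <| .case (.var 1) .nil <| .case (.var 1) .nil <|
  .cons (.call 7 (.cons (.var 4) (.cons (.var 2) (.var 0))))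
    (.call 8 (.cons (.var 4) (.cons (.var 2) (.var 1))))

def revAppBody : IsingTerm :=
  .case (.var 0) .nil <| .case (.var 0) (.var 1) <|
  .call 9 (.cons (.var 1) (.cons (.var 0) (.var 3)))

def dropBody : IsingTerm :=
  .case (.var 0) .nil <| .case (.var 0) (.var 1) <| .case (.var 3) .nil <|
  .call 10 (.cons (.var 3) (.var 1))

def baseBody : IsingTerm :=
  .case (.var 0) .nil <| .case (.var 1) .nil <| .cons (.var 2) (.var 1)

/-- The argument is `(g, (B, (v, I)))`: the parameters, the budget, a vertex and a list of edges. -/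
def ratioBody : IsingTerm :=
  .case (.var 0) .nil <| .case (.var 1) .nil <| .case (.var 1) .nil <|
  .case (.var 2) (.call 12 (.var 4)) <|
  .call 13 (.cons (.var 6) (.cons (.var 1) (.cons (.var 2) (.cons .nil (.var 3)))))

/-- The argument is `(g, (B, (v, (pre, rest))))`. -/
def edgesBody : IsingTerm :=
  .case (.var 0) .nil <| .case (.var 1) .nil <| .case (.var 1) .nil <| .case (.var 1) .nil <|
  .case (.var 1) (.call 12 (.var 6)) <|
  .case (.call 5 (.cons (.var 4) (.call 14 (.var 0))))
    (.call 13 (.cons (.var 8) (.cons (.var 6) (.cons (.var 4) (.cons (.cons (.var 0) (.var 2))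
      (.var 1)))))) <|
  .bind (.call 6 (.cons (.var 6) (.call 14 (.var 2)))) <|
  .bind (.call 9 (.cons (.var 5) (.call 8 (.cons .nil (.cons (.var 7) (.var 4)))))) <|
  .bind (.call 10 (.cons (.var 1) (.var 10))) <|
  .bind (.call 17 (.cons (.call 16 (.var 5)) (.cons oneTerm (.cons (.var 13) (.cons (.var 0)
    (.cons (.var 2) (.var 1))))))) <|
  .bind (.call 17 (.cons (.call 15 (.var 6)) (.cons .nil (.cons (.var 14) (.cons (.var 1)
    (.cons (.var 3) (.var 2))))))) <|
  .bind (.call 13 (.cons (.var 15) (.cons (.var 13) (.cons (.var 11)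
    (.cons (.cons (.call 7 (.cons oneTerm (.cons (.var 11) (.var 7)))) (.var 9)) (.var 8)))))) <|
  .call 22 (.cons (.var 16) (.cons (.var 2) (.cons (.var 1) (.var 0))))

def supportBody : IsingTerm := .case (.var 0) .nil (.case (.var 0) .nil (.var 3))

def zeroOnBody : IsingTerm := .case (.var 0) .nil (.case (.var 0) .nil (.var 0))

def oneOnBody : IsingTerm := .case (.var 0) .nil (.case (.var 0) .nil (.var 1))

/-- A label that is off yields the pair `(0, 1)`, that is, probability `0`, without entering the
chain. -/
def chainIfBody : IsingTerm :=
  .case (.var 0) .nil <| .case (.var 0) (.cons .nil (.cons oneTerm .nil)) (.call 18 (.var 3))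

/-- The argument is `(s, (g, (B, (S, I))))`. -/
def chainBody : IsingTerm :=
  .case (.var 0) .nil <| .case (.var 1) .nil <| .case (.var 1) .nil <| .case (.var 1) .nil <|
  .case (.var 0) (.cons (.cons oneTerm .nil) .nil) <|
  .bind (.call 11 (.cons (.var 6) (.cons (.var 4) (.cons (.var 0) (.var 3))))) <|
  .bind (.call 18 (.cons (.var 9) (.cons (.var 7) (.cons (.var 5) (.cons (.var 2)
    (.call 8 (.cons (.var 9) (.cons (.var 1) (.var 4))))))))) <|
  .call 19 (.cons (.var 10) (.cons (.var 1) (.var 0)))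

def addTerm (x y : IsingTerm) : IsingTerm := .call 2 (.cons .nil (.cons x y))

def mulTerm (x y : IsingTerm) : IsingTerm := .call 3 (.cons x y)

/-- The argument is `(s, ((p, q), (P, C)))`. -/
def stepBody : IsingTerm :=
  .case (.var 0) .nil <| .case (.var 1) .nil <| .case (.var 0) .nil <| .case (.var 3) .nil <|
  .case (.var 6)
    (.cons (mulTerm (.var 3) (.var 0)) (addTerm (mulTerm (.var 2) (.var 0))
      (mulTerm (addTerm (.var 2) (.var 3)) (.var 1))))
    (.cons (mulTerm (.var 4) (.var 2)) (addTerm (mulTerm (.var 5) (.var 2))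
      (mulTerm (addTerm (.var 4) (.var 5)) (.var 3))))

/-- The argument is `(g, (P, C))`. -/
def mixBody : IsingTerm :=
  .case (.var 0) .nil <| .case (.var 0) .nil <| .case (.var 1) .nil <| .case (.var 5) .nil <|
  addTerm (mulTerm (.var 3) (.var 1)) (mulTerm (.var 2) (.var 0))

def sumBody : IsingTerm := .case (.var 0) .nil <| addTerm (.var 0) (.var 1)

/-- The argument is `(g, (X, (Y, (p, q))))`. -/
def combineBody : IsingTerm :=
  .case (.var 0) .nil <| .case (.var 1) .nil <| .case (.var 1) .nil <| .case (.var 1) .nil <|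
  .cons (mulTerm (.call 21 (.var 2)) (mulTerm (.call 20 (.cons (.var 6) (.var 4))) (.var 0)))
    (mulTerm (.call 21 (.var 4)) (mulTerm (.call 20 (.cons (.var 6) (.var 2))) (.var 1)))

/-- A vertex is stored as the tail of the row behind its entry. `verticesBody` does the same with
the unary list, so equal positions give equal lengths. -/
def rowBody : IsingTerm :=
  .case (.var 0) .nil <| .case (.var 0) (.call 23 (.var 1)) <|
  .cons (.var 3) (.call 23 (.var 3))

def rowsBody : IsingTerm :=
  .case (.var 0) .nil <|
  .cons (.cons (.cons oneTerm oneTerm) (.call 23 (.var 0))) (.call 24 (.var 1))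

def verticesBody : IsingTerm := .case (.var 0) .nil <| .cons (.var 1) (.call 25 (.var 1))

def countBody : IsingTerm := .case (.var 0) .nil <| .call 1 (.call 26 (.var 1))

def powBody : IsingTerm :=
  .case (.var 0) .nil <| .case (.var 1) (.cons oneTerm .nil) <|
  mulTerm (.var 2) (.call 27 (.cons (.var 2) (.var 1)))

def powTwoBody : IsingTerm :=
  .case (.var 0) (.cons oneTerm .nil) <| .cons .nil (.call 28 (.var 1))

/-- A list with `k` further entries. -/
def padTerm (e : IsingTerm) : ℕ → IsingTerm
  | 0 => e
  | k + 1 => .cons .nil (padTerm e k)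

def scaleBody (a : ℕ) : IsingTerm :=
  .case (.var 0) .nil <| .case (.var 0) (.var 1) <|
  padTerm (.call 29 (.cons (.var 1) (.var 3))) a

/-- The budget: a list of length `a * (|n| + |m| + (|den| - |num|)) + b`. -/
def budgetTerm (b : ℕ) (n rows num den : IsingTerm) : IsingTerm :=
  .call 29 (.cons (.call 26 n) (.call 29 (.cons (.call 26 rows)
    (.call 29 (.cons (.call 10 (.cons num den)) (padTerm .nil b))))))

/-- The argument is `((n, rows), (num, den))`. -/
def mainBody (b : ℕ) : IsingTerm :=
  .case (.var 0) .nil <| .case (.var 0) .nil <| .case (.var 3) .nil <|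
  .bind (budgetTerm b (.var 2) (.var 3) (.var 0) (.var 1)) <|
  -- The budget itself serves as the precision of the oracle queries.
  .bind (.query .field (.var 0)) <|
  .bind (.query .interaction (.var 1)) <|
  .bind (.call 28 (.var 2)) <|
  .bind (.call 18 (.cons .nil (.cons (.cons (.var 2) (.cons (.var 1) (.var 0))) (.cons (.var 3)
    (.cons (.call 25 (.var 6)) (.call 24 (.var 7))))))) <|
  .case (.var 0) .nil <|
  -- With `P / (P + C)` the approximate probability of all zeros and `mb / K` the approximation of
  -- `β`, the output is `(P + C) * mb ^ m / (P * K ^ m)`.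
  .cons (mulTerm (addTerm (.var 0) (.var 1)) (.call 27 (.cons (.var 4) (.var 10))))
    (mulTerm (.var 0) (.call 27 (.cons (.var 3) (.var 10))))

/-- The program; the budget is `a` times the number of digits of the input parameters plus `b`. -/
def isingProgram (a b : ℕ) : Program IsingParam :=
  [mainBody b, incBody, adcBody, mulBody, eqBody, memBody, remBody, pinEdgeBody, pinBody,
    revAppBody, dropBody, ratioBody, baseBody, edgesBody, supportBody, zeroOnBody, oneOnBody,
    chainIfBody, chainBody, stepBody, mixBody, sumBody, combineBody, rowBody, rowsBody,
    verticesBody, countBody, powBody, powTwoBody, scaleBody a]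

/-! ### Bounded evaluation -/

section EvalLE

variable {ι : Type} {P : Program ι} {O : ι → ℕ → ℕ} {env : List Val}

/-- Evaluation in at most `T` steps. -/
def EvalLE (P : Program ι) (O : ι → ℕ → ℕ) (env : List Val) (e : Term ι) (v : Val) (T : ℕ) :
    Prop := ∃ t ≤ T, Eval P O env e v t

/-- The function `f` of the program maps `a` to `v` in at most `T` steps. -/
def Computes (P : Program ι) (O : ι → ℕ → ℕ) (f : ℕ) (a v : Val) (T : ℕ) : Prop :=
  ∃ body, P[f]? = some body ∧ EvalLE P O [a] body v T

theorem EvalLE.var {i : ℕ} {v : Val} (h : env[i]? = some v) : EvalLE P O env (.var i) v 1 :=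
  ⟨1, le_rfl, .var h⟩

theorem EvalLE.nil : EvalLE P O env .nil .nil 1 := ⟨1, le_rfl, .nil⟩

theorem EvalLE.cons {e₁ e₂ : Term ι} {v₁ v₂ : Val} {T₁ T₂ : ℕ} (h₁ : EvalLE P O env e₁ v₁ T₁)
    (h₂ : EvalLE P O env e₂ v₂ T₂) :
    EvalLE P O env (.cons e₁ e₂) (.cons v₁ v₂) (T₁ + T₂ + 1) := by
  obtain ⟨t₁, l₁, h₁⟩ := h₁
  obtain ⟨t₂, l₂, h₂⟩ := h₂
  exact ⟨_, by omega, .cons h₁ h₂⟩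

theorem EvalLE.case_nil {e e₁ e₂ : Term ι} {v : Val} {T T₁ : ℕ} (h : EvalLE P O env e .nil T)
    (h₁ : EvalLE P O env e₁ v T₁) : EvalLE P O env (.case e e₁ e₂) v (T + T₁ + 1) := by
  obtain ⟨t, l, h⟩ := h
  obtain ⟨t₁, l₁, h₁⟩ := h₁
  exact ⟨_, by omega, .case_nil h h₁⟩

theorem EvalLE.case_cons {e e₁ e₂ : Term ι} {a b v : Val} {T T₂ : ℕ}
    (h : EvalLE P O env e (.cons a b) T) (h₂ : EvalLE P O (a :: b :: env) e₂ v T₂) :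
    EvalLE P O env (.case e e₁ e₂) v (T + T₂ + 1) := by
  obtain ⟨t, l, h⟩ := h
  obtain ⟨t₁, l₁, h₁⟩ := h₂
  exact ⟨_, by omega, .case_cons h h₁⟩

theorem EvalLE.bind {e₁ e₂ : Term ι} {v₁ v₂ : Val} {T₁ T₂ : ℕ} (h₁ : EvalLE P O env e₁ v₁ T₁)
    (h₂ : EvalLE P O (v₁ :: env) e₂ v₂ T₂) :
    EvalLE P O env (.bind e₁ e₂) v₂ (T₁ + T₂ + 1) := by
  obtain ⟨t₁, l₁, h₁⟩ := h₁
  obtain ⟨t₂, l₂, h₂⟩ := h₂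
  exact ⟨_, by omega, .bind h₁ h₂⟩

theorem EvalLE.call {f : ℕ} {e : Term ι} {v w : Val} {T₁ T₂ : ℕ} (h₁ : EvalLE P O env e v T₁)
    (h₂ : Computes P O f v w T₂) : EvalLE P O env (.call f e) w (T₁ + T₂ + 1) := by
  obtain ⟨t₁, l₁, h₁⟩ := h₁
  obtain ⟨body, hf, t₂, l₂, h₂⟩ := h₂
  exact ⟨_, by omega, .call hf h₁ h₂⟩

theorem EvalLE.query {i : ι} {e : Term ι} {v : Val} {T : ℕ} (h : EvalLE P O env e v T) :
    EvalLE P O env (.query i e) (Val.ofNat (O i v.length)) (T + v.length + 1) := by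
  obtain ⟨t, l, h⟩ := h
  exact ⟨_, by omega, .query h⟩

theorem EvalLE.one {P : Program IsingParam} {O : IsingParam → ℕ → ℕ} :
    EvalLE P O env oneTerm (.cons .nil .nil) 3 := EvalLE.cons .nil .nil

theorem Computes.of {f : ℕ} {a v : Val} {body : Term ι} {T T' : ℕ} (hf : P[f]? = some body)
    (h : EvalLE P O [a] body v T) (hT : T ≤ T') : Computes P O f a v T' := by
  obtain ⟨t, l, h⟩ := h
  exact ⟨body, hf, t, l.trans hT, h⟩

theorem Computes.mono {f : ℕ} {a v : Val} {T T' : ℕ} (h : Computes P O f a v T) (hT : T ≤ T') :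
    Computes P O f a v T' := by
  obtain ⟨b, hf, t, l, h⟩ := h
  exact ⟨b, hf, t, l.trans hT, h⟩

end EvalLE

end TreeMachine

namespace TreeMachine

open Term HypergraphSpin

/-! ### Binary arithmetic -/

namespace Val

/-- The digit one, or true. -/
abbrev tt : Val := cons nil nil

/-- The successor of a binary number. -/
def inc : Val → Val
  | nil => cons tt nil
  | cons nil x => cons tt x
  | cons (cons _ _) x => cons nil (inc x)

/-- The sum of two binary numbers and a carry. -/
def adc : Val → Val → Val → Val
  | nil, nil, y => y
  | cons _ _, nil, y => inc y
  | nil, cons b x, nil => cons b x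
  | cons _ _, cons b x, nil => inc (cons b x)
  | nil, cons nil x, cons nil y => cons nil (adc nil x y)
  | nil, cons nil x, cons (cons _ _) y => cons tt (adc nil x y)
  | nil, cons (cons _ _) x, cons nil y => cons tt (adc nil x y)
  | nil, cons (cons _ _) x, cons (cons _ _) y => cons nil (adc tt x y)
  | cons _ _, cons nil x, cons nil y => cons tt (adc nil x y)
  | cons _ _, cons nil x, cons (cons _ _) y => cons nil (adc tt x y)
  | cons _ _, cons (cons _ _) x, cons nil y => cons nil (adc tt x y)
  | cons _ _, cons (cons _ _) x, cons (cons _ _) y => cons tt (adc tt x y)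

/-- The product of two binary numbers. -/
def mul : Val → Val → Val
  | nil, _ => nil
  | cons nil x, y => cons nil (mul x y)
  | cons (cons _ _) x, y => adc nil (cons nil (mul x y)) y

theorem length_cons (a b : Val) : (cons a b).length = b.length + 1 := rfl

theorem length_nil : nil.length = 0 := rfl

theorem toNat_inc (x : Val) : (inc x).toNat = x.toNat + 1 := by
  fun_induction inc x <;> simp_all [toNat]
  omega

theorem length_inc (x : Val) : (inc x).length ≤ x.length + 1 := by
  fun_induction inc x <;> simp_all [length]

theorem toNat_adc (c x y : Val) :
    (adc c x y).toNat = x.toNat + y.toNat + (cons c nil).toNat := by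
  fun_induction adc c x y <;> simp_all [toNat, tt, toNat_inc] <;> omega

theorem length_adc (c x y : Val) : (adc c x y).length ≤ max x.length y.length + 1 := by
  fun_induction adc c x y <;> simp_all [length] <;>
    first
    | omega
    | exact length_inc _

theorem toNat_mul (x y : Val) : (mul x y).toNat = x.toNat * y.toNat := by
  fun_induction mul x y <;> simp_all [toNat, toNat_adc] <;> ring

/-- Each digit of `x` costs a place for the shift and one for a carry. Numbers may have leading
zeros, so lengths are tracked separately from values. -/
theorem length_mul (x y : Val) : (mul x y).length ≤ 2 * x.length + y.length := by
  fun_induction mul x y with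
  | case1 => simp [length]
  | case2 => simp_all [length]; omega
  | case3 _ _ x y ih =>
    have := length_adc nil (cons nil (mul x y)) y
    simp only [length] at *
    omega

end Val

open Val

variable {a b : ℕ} {O : IsingParam → ℕ → ℕ}

/-- The functions in `Val` mirror the program bodies branch by branch, so each `computes_` lemma for
them is a symbolic run along the functional induction or case split, in which `rfl` resolves
variable lookups. Their meaning is handled apart, through `toNat`, `length` and `toEdges`. -/
theorem computes_inc (x : Val) : Computes (isingProgram a b) O 1 x (inc x) (20 * (x.length + 1)) := by
  fun_induction inc x with
  | case1 =>
    apply Computes.of rfl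
    · apply EvalLE.case_nil (EvalLE.var rfl)
      exact EvalLE.cons EvalLE.one EvalLE.nil
    · simp [length]
  | case2 x =>
    apply Computes.of rfl
    · apply EvalLE.case_cons (EvalLE.var rfl)
      apply EvalLE.case_nil (EvalLE.var rfl)
      exact EvalLE.cons EvalLE.one (EvalLE.var rfl)
    · simp only [length]; omega
  | case3 c d x ih =>
    apply Computes.of rfl
    · apply EvalLE.case_cons (EvalLE.var rfl)
      apply EvalLE.case_cons (EvalLE.var rfl)
      exact EvalLE.cons EvalLE.nil (EvalLE.call (EvalLE.var rfl) ih)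
    · simp only [length]; omega

theorem computes_adc (c x y : Val) : Computes (isingProgram a b) O 2 (cons c (cons x y)) (adc c x y)
    (40 * (x.length + y.length + 1)) := by
  fun_induction adc c x y <;>
  · apply Computes.of rfl
    · apply EvalLE.case_cons (EvalLE.var rfl)
      apply EvalLE.case_cons (EvalLE.var rfl)
      repeat first
        | exact EvalLE.var rfl
        | exact EvalLE.call (EvalLE.var rfl) (computes_inc _)
        | exact EvalLE.cons .nil (EvalLE.call
            (EvalLE.cons .nil (EvalLE.cons (EvalLE.var rfl) (EvalLE.var rfl))) (by assumption))
        | exact EvalLE.cons .nil (EvalLE.call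
            (EvalLE.cons .one (EvalLE.cons (EvalLE.var rfl) (EvalLE.var rfl))) (by assumption))
        | exact EvalLE.cons .one (EvalLE.call
            (EvalLE.cons .nil (EvalLE.cons (EvalLE.var rfl) (EvalLE.var rfl))) (by assumption))
        | exact EvalLE.cons .one (EvalLE.call
            (EvalLE.cons .one (EvalLE.cons (EvalLE.var rfl) (EvalLE.var rfl))) (by assumption))
        | apply EvalLE.case_nil (EvalLE.var rfl)
        | apply EvalLE.case_cons (EvalLE.var rfl)
    · simp only [length]; omega

theorem computes_mul (x y : Val) : Computes (isingProgram a b) O 3 (cons x y) (mul x y)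
    (200 * (x.length + 1) * (x.length + y.length + 1)) := by
  fun_induction mul x y with
  | case1 =>
    apply Computes.of rfl
    · apply EvalLE.case_cons (EvalLE.var rfl)
      apply EvalLE.case_nil (EvalLE.var rfl)
      exact EvalLE.nil
    · simp only [length]; omega
  | case2 x y ih =>
    apply Computes.of rfl
    · apply EvalLE.case_cons (EvalLE.var rfl)
      apply EvalLE.case_cons (EvalLE.var rfl)
      apply EvalLE.bind (EvalLE.call (EvalLE.cons (EvalLE.var rfl) (EvalLE.var rfl)) ih)
      apply EvalLE.case_nil (EvalLE.var rfl)
      exact EvalLE.cons .nil (EvalLE.var rfl)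
    · simp only [length]; nlinarith
  | case3 c d x y ih =>
    apply Computes.of rfl
    · apply EvalLE.case_cons (EvalLE.var rfl)
      apply EvalLE.case_cons (EvalLE.var rfl)
      apply EvalLE.bind (EvalLE.call (EvalLE.cons (EvalLE.var rfl) (EvalLE.var rfl)) ih)
      apply EvalLE.case_cons (EvalLE.var rfl)
      exact EvalLE.call (EvalLE.cons .nil (EvalLE.cons (EvalLE.cons .nil (EvalLE.var rfl))
        (EvalLE.var rfl))) (computes_adc _ _ _)
    · have := length_mul x y
      simp only [length]; nlinarith

end TreeMachine

namespace TreeMachine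

open Term HypergraphSpin

/-! ### Lists of vertices and edges -/

namespace Val

def isTrue : Val → Bool
  | nil => false
  | cons _ _ => true

/-- The list of vertices of a tree. A vertex is a list, of which only the length matters. -/
def toVertices : Val → List ℕ
  | nil => []
  | cons a b => a.length :: b.toVertices

def toEdge : Val → LabelledEdge
  | cons (cons b c) S => ⟨b.isTrue, c.isTrue, S.toVertices⟩
  | _ => ⟨false, false, []⟩

def toEdges : Val → List LabelledEdge
  | nil => []
  | cons e I => e.toEdge :: I.toEdges

def eqLength : Val → Val → Val
  | nil, nil => tt
  | nil, cons _ _ => nil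
  | cons _ _, nil => nil
  | cons _ a, cons _ b => eqLength a b

def contains (v : Val) : Val → Val
  | nil => nil
  | cons u S => match eqLength v u with
    | nil => contains v S
    | cons _ _ => tt

def remove (v : Val) : Val → Val
  | nil => nil
  | cons u S => match eqLength v u with
    | nil => cons u (remove v S)
    | cons _ _ => remove v S

def support : Val → Val
  | cons (cons _ _) S => S
  | _ => nil

def zeroOn : Val → Val
  | cons (cons b _) _ => b
  | _ => nil

def oneOn : Val → Val
  | cons (cons _ c) _ => c
  | _ => nil

def pinEdge (s v : Val) : Val → Val
  | nil => nil
  | cons nil S => cons nil S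
  | cons (cons b c) S => match contains v S with
    | nil => cons (cons b c) S
    | cons _ _ => match s with
      | nil => cons (cons b nil) (remove v S)
      | cons _ _ => cons (cons nil c) (remove v S)

def pin (s v : Val) : Val → Val
  | nil => nil
  | cons e I => cons (pinEdge s v e) (pin s v I)

def revApp : Val → Val → Val
  | nil, y => y
  | cons a x, y => revApp x (cons a y)

/-- Truncated subtraction of lengths, needed for the reduced budget `B - k` and for the excess of
the digits of the denominator over those of the numerator. -/
def drop : Val → Val → Val
  | nil, y => y
  | cons _ _, nil => nil
  | cons _ x, cons _ y => drop x y

theorem length_toVertices (S : Val) : S.toVertices.length = S.length := by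
  induction S <;> simp_all [toVertices, length]

theorem isTrue_eqLength (a b : Val) : (eqLength a b).isTrue = decide (a.length = b.length) := by
  fun_induction eqLength a b <;> simp_all [isTrue, length]

theorem isTrue_contains (v S : Val) :
    (contains v S).isTrue = decide (v.length ∈ S.toVertices) := by
  fun_induction contains v S with
  | case1 => simp [isTrue, toVertices]
  | case2 u S h ih =>
    have := isTrue_eqLength v u
    rw [h] at this
    simp_all [isTrue, toVertices]
  | case3 u S _ _ h =>
    have := isTrue_eqLength v u
    rw [h] at this
    simp_all [isTrue, toVertices]

theorem toVertices_remove (v S : Val) :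
    (remove v S).toVertices = S.toVertices.filter (· ≠ v.length) := by
  fun_induction remove v S with
  | case1 => simp [toVertices]
  | case2 u S h ih =>
    have := isTrue_eqLength v u
    rw [h] at this
    simp only [isTrue, Bool.false_eq, decide_eq_false_iff_not] at this
    rw [toVertices, ih, toVertices, List.filter_cons_of_pos (by simp; omega)]
  | case3 u S _ _ h ih =>
    have := isTrue_eqLength v u
    rw [h] at this
    simp only [isTrue, Bool.true_eq, decide_eq_true_eq] at this
    rw [ih, toVertices, List.filter_cons_of_neg (by simp; omega)]

theorem toVertices_support (e : Val) : e.support.toVertices = e.toEdge.support := by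
  unfold support toEdge
  split <;> simp_all [toVertices]

theorem isTrue_zeroOn (e : Val) : e.zeroOn.isTrue = e.toEdge.zeroOn := by
  unfold zeroOn toEdge
  split <;> simp_all [isTrue]

theorem isTrue_oneOn (e : Val) : e.oneOn.isTrue = e.toEdge.oneOn := by
  unfold oneOn toEdge
  split <;> simp_all [isTrue]

theorem toEdge_pinEdge (s v e : Val) :
    (pinEdge s v e).toEdge = HypergraphSpin.pinEdge s.isTrue v.length e.toEdge := by
  fun_cases pinEdge s v e with
  | case1 => simp [toEdge, HypergraphSpin.pinEdge]
  | case2 => simp [toEdge, HypergraphSpin.pinEdge]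
  | case3 x b c S h =>
    have := isTrue_contains v S
    rw [h] at this
    simp_all [toEdge, HypergraphSpin.pinEdge, isTrue]
  | case4 b c S _ _ h =>
    have := isTrue_contains v S
    rw [h] at this
    simp_all [toEdge, HypergraphSpin.pinEdge, isTrue, toVertices_remove]
  | case5 b c S _ _ h =>
    have := isTrue_contains v S
    rw [h] at this
    simp_all [toEdge, HypergraphSpin.pinEdge, isTrue, toVertices_remove]

theorem toEdges_pin (s v I : Val) :
    (pin s v I).toEdges = HypergraphSpin.pin s.isTrue v.length I.toEdges := by
  fun_induction pin s v I with
  | case1 => rfl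
  | case2 e I ih => rw [toEdges, ih, toEdge_pinEdge]; rfl

theorem length_pin (s v I : Val) : (pin s v I).length = I.length := by
  fun_induction pin s v I <;> simp_all [length]

theorem toEdges_revApp (x y : Val) : (revApp x y).toEdges = x.toEdges.reverseAux y.toEdges := by
  fun_induction revApp x y <;> simp_all [toEdges]

theorem length_revApp (x y : Val) : (revApp x y).length = x.length + y.length := by
  fun_induction revApp x y <;> simp_all [length]
  omega

theorem length_drop (x y : Val) : (drop x y).length = y.length - x.length := by
  fun_induction drop x y <;> simp_all [length]

end Val

open Val

variable {a b : ℕ} {O : IsingParam → ℕ → ℕ}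

theorem computes_eqLength (x y : Val) :
    Computes (isingProgram a b) O 4 (cons x y) (eqLength x y) (20 * (x.length + 1)) := by
  fun_induction eqLength x y <;>
  · apply Computes.of rfl
    · repeat first
        | exact EvalLE.var rfl
        | exact EvalLE.one
        | exact EvalLE.nil
        | exact EvalLE.call (EvalLE.cons (EvalLE.var rfl) (EvalLE.var rfl)) (by assumption)
        | apply EvalLE.case_nil (EvalLE.var rfl)
        | apply EvalLE.case_cons (EvalLE.var rfl)
    · simp only [length]; omega

theorem computes_contains (v S : Val) :
    Computes (isingProgram a b) O 5 (cons v S) (contains v S)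
      (40 * (S.length + 1) * (v.length + 1)) := by
  fun_induction contains v S with
  | case1 =>
    apply Computes.of rfl
    · apply EvalLE.case_cons (EvalLE.var rfl)
      exact EvalLE.case_nil (EvalLE.var rfl) EvalLE.nil
    · simp only [length]; omega
  | case2 u S h ih =>
    have he := computes_eqLength (a := a) (b := b) (O := O) v u
    rw [h] at he
    apply Computes.of rfl
    · apply EvalLE.case_cons (EvalLE.var rfl)
      apply EvalLE.case_cons (EvalLE.var rfl)
      apply EvalLE.case_nil (EvalLE.call (EvalLE.cons (EvalLE.var rfl) (EvalLE.var rfl)) he)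
      exact EvalLE.call (EvalLE.cons (EvalLE.var rfl) (EvalLE.var rfl)) ih
    · simp only [length]; nlinarith
  | case3 u S _ _ h =>
    have he := computes_eqLength (a := a) (b := b) (O := O) v u
    rw [h] at he
    apply Computes.of rfl
    · apply EvalLE.case_cons (EvalLE.var rfl)
      apply EvalLE.case_cons (EvalLE.var rfl)
      apply EvalLE.case_cons (EvalLE.call (EvalLE.cons (EvalLE.var rfl) (EvalLE.var rfl)) he)
      exact EvalLE.one
    · simp only [length]; nlinarith

theorem computes_remove (v S : Val) :
    Computes (isingProgram a b) O 6 (cons v S) (remove v S)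
      (50 * (S.length + 1) * (v.length + 1)) := by
  fun_induction remove v S with
  | case1 =>
    apply Computes.of rfl
    · apply EvalLE.case_cons (EvalLE.var rfl)
      exact EvalLE.case_nil (EvalLE.var rfl) EvalLE.nil
    · simp only [length]; omega
  | case2 u S h ih =>
    have he := computes_eqLength (a := a) (b := b) (O := O) v u
    rw [h] at he
    apply Computes.of rfl
    · apply EvalLE.case_cons (EvalLE.var rfl)
      apply EvalLE.case_cons (EvalLE.var rfl)
      apply EvalLE.case_nil (EvalLE.call (EvalLE.cons (EvalLE.var rfl) (EvalLE.var rfl)) he)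
      apply EvalLE.cons (EvalLE.var rfl)
      exact EvalLE.call (EvalLE.cons (EvalLE.var rfl) (EvalLE.var rfl)) ih
    · simp only [length]; nlinarith
  | case3 u S _ _ h ih =>
    have he := computes_eqLength (a := a) (b := b) (O := O) v u
    rw [h] at he
    apply Computes.of rfl
    · apply EvalLE.case_cons (EvalLE.var rfl)
      apply EvalLE.case_cons (EvalLE.var rfl)
      apply EvalLE.case_cons (EvalLE.call (EvalLE.cons (EvalLE.var rfl) (EvalLE.var rfl)) he)
      exact EvalLE.call (EvalLE.cons (EvalLE.var rfl) (EvalLE.var rfl)) ih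
    · simp only [length]; nlinarith

theorem computes_pinEdge (s v e : Val) :
    Computes (isingProgram a b) O 7 (cons s (cons v e)) (pinEdge s v e)
      (150 * (e.support.length + 1) * (v.length + 1)) := by
  fun_cases pinEdge s v e with
  | case1 =>
    apply Computes.of rfl
    · apply EvalLE.case_cons (EvalLE.var rfl)
      apply EvalLE.case_cons (EvalLE.var rfl)
      exact EvalLE.case_nil (EvalLE.var rfl) EvalLE.nil
    · simp only [support, length]; omega
  | case2 =>
    apply Computes.of rfl
    · apply EvalLE.case_cons (EvalLE.var rfl)
      apply EvalLE.case_cons (EvalLE.var rfl)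
      apply EvalLE.case_cons (EvalLE.var rfl)
      exact EvalLE.case_nil (EvalLE.var rfl) (EvalLE.var rfl)
    · simp only [support, length]; omega
  | case3 x c d S h =>
    have he := computes_contains (a := a) (b := b) (O := O) v S
    rw [h] at he
    apply Computes.of rfl
    · apply EvalLE.case_cons (EvalLE.var rfl)
      apply EvalLE.case_cons (EvalLE.var rfl)
      apply EvalLE.case_cons (EvalLE.var rfl)
      apply EvalLE.case_cons (EvalLE.var rfl)
      exact EvalLE.case_nil (EvalLE.call (EvalLE.cons (EvalLE.var rfl) (EvalLE.var rfl)) he)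
        (EvalLE.var rfl)
    · simp only [support]; nlinarith
  | case4 c d S _ _ h =>
    have he := computes_contains (a := a) (b := b) (O := O) v S
    rw [h] at he
    apply Computes.of rfl
    · apply EvalLE.case_cons (EvalLE.var rfl)
      apply EvalLE.case_cons (EvalLE.var rfl)
      apply EvalLE.case_cons (EvalLE.var rfl)
      apply EvalLE.case_cons (EvalLE.var rfl)
      apply EvalLE.case_cons (EvalLE.call (EvalLE.cons (EvalLE.var rfl) (EvalLE.var rfl)) he)
      apply EvalLE.case_nil (EvalLE.var rfl)
      apply EvalLE.cons (EvalLE.cons (EvalLE.var rfl) EvalLE.nil)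
      exact EvalLE.call (EvalLE.cons (EvalLE.var rfl) (EvalLE.var rfl)) (computes_remove v S)
    · simp only [support]; nlinarith
  | case5 c d S _ _ h =>
    have he := computes_contains (a := a) (b := b) (O := O) v S
    rw [h] at he
    apply Computes.of rfl
    · apply EvalLE.case_cons (EvalLE.var rfl)
      apply EvalLE.case_cons (EvalLE.var rfl)
      apply EvalLE.case_cons (EvalLE.var rfl)
      apply EvalLE.case_cons (EvalLE.var rfl)
      apply EvalLE.case_cons (EvalLE.call (EvalLE.cons (EvalLE.var rfl) (EvalLE.var rfl)) he)
      apply EvalLE.case_cons (EvalLE.var rfl)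
      apply EvalLE.cons (EvalLE.cons EvalLE.nil (EvalLE.var rfl))
      exact EvalLE.call (EvalLE.cons (EvalLE.var rfl) (EvalLE.var rfl)) (computes_remove v S)
    · simp only [support]; nlinarith

theorem computes_pin (n : ℕ) (s v I : Val) (h : ∀ e ∈ I.toEdges, e.support.length ≤ n) :
    Computes (isingProgram a b) O 8 (cons s (cons v I)) (pin s v I)
      (200 * (I.length + 1) * ((n + 1) * (v.length + 1))) := by
  fun_induction pin s v I with
  | case1 =>
    apply Computes.of rfl
    · apply EvalLE.case_cons (EvalLE.var rfl)
      apply EvalLE.case_cons (EvalLE.var rfl)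
      exact EvalLE.case_nil (EvalLE.var rfl) EvalLE.nil
    · simp only [length]; nlinarith
  | case2 e I ih =>
    apply Computes.of rfl
    · apply EvalLE.case_cons (EvalLE.var rfl)
      apply EvalLE.case_cons (EvalLE.var rfl)
      apply EvalLE.case_cons (EvalLE.var rfl)
      apply EvalLE.cons
      · exact EvalLE.call (EvalLE.cons (EvalLE.var rfl) (EvalLE.cons (EvalLE.var rfl)
          (EvalLE.var rfl))) (computes_pinEdge s v e)
      · exact EvalLE.call (EvalLE.cons (EvalLE.var rfl) (EvalLE.cons (EvalLE.var rfl)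
          (EvalLE.var rfl))) (ih fun e' he' => h e' (by simp [toEdges, he']))
    · have h1 := h e.toEdge (by simp [toEdges])
      rw [← toVertices_support, length_toVertices] at h1
      have h2 : (e.support.length + 1) * (v.length + 1) ≤ (n + 1) * (v.length + 1) := by gcongr
      have h3 : 1 ≤ (n + 1) * (v.length + 1) := Nat.mul_pos (by omega) (by omega)
      simp only [length]
      generalize (n + 1) * (v.length + 1) = x at *
      rw [mul_assoc 150]
      generalize (e.support.length + 1) * (v.length + 1) = y at *
      have : 200 * (I.length + 1 + 1) * x = 200 * (I.length + 1) * x + 200 * x := by ring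
      omega

theorem computes_revApp (x y : Val) :
    Computes (isingProgram a b) O 9 (cons x y) (revApp x y) (20 * (x.length + 1)) := by
  fun_induction revApp x y <;>
  · apply Computes.of rfl
    · repeat first
        | exact EvalLE.var rfl
        | exact EvalLE.call (EvalLE.cons (EvalLE.var rfl) (EvalLE.cons (EvalLE.var rfl)
            (EvalLE.var rfl))) (by assumption)
        | apply EvalLE.case_nil (EvalLE.var rfl)
        | apply EvalLE.case_cons (EvalLE.var rfl)
    · simp only [length]; omega

theorem computes_drop (x y : Val) :
    Computes (isingProgram a b) O 10 (cons x y) (drop x y) (20 * (x.length + 1)) := by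
  fun_induction drop x y <;>
  · apply Computes.of rfl
    · repeat first
        | exact EvalLE.var rfl
        | exact EvalLE.nil
        | exact EvalLE.call (EvalLE.cons (EvalLE.var rfl) (EvalLE.var rfl)) (by assumption)
        | apply EvalLE.case_nil (EvalLE.var rfl)
        | apply EvalLE.case_cons (EvalLE.var rfl)
    · simp only [length]; omega

theorem computes_support (e : Val) :
    Computes (isingProgram a b) O 14 e e.support 10 := by
  fun_cases support e with
  | case1 =>
    apply Computes.of rfl
    · apply EvalLE.case_cons (EvalLE.var rfl)
      apply EvalLE.case_cons (EvalLE.var rfl)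
      exact EvalLE.var rfl
    · omega
  | case2 e h =>
    match e with
    | Val.nil => exact Computes.of rfl (EvalLE.case_nil (EvalLE.var rfl) EvalLE.nil) (by omega)
    | Val.cons Val.nil S =>
      exact Computes.of rfl (EvalLE.case_cons (EvalLE.var rfl) (EvalLE.case_nil (EvalLE.var rfl)
        EvalLE.nil)) (by omega)
    | Val.cons (Val.cons c d) S => exact absurd rfl (h c d S)

theorem computes_zeroOn (e : Val) :
    Computes (isingProgram a b) O 15 e e.zeroOn 10 := by
  fun_cases zeroOn e with
  | case1 =>
    apply Computes.of rfl
    · apply EvalLE.case_cons (EvalLE.var rfl)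
      apply EvalLE.case_cons (EvalLE.var rfl)
      exact EvalLE.var rfl
    · omega
  | case2 e h =>
    match e with
    | Val.nil => exact Computes.of rfl (EvalLE.case_nil (EvalLE.var rfl) EvalLE.nil) (by omega)
    | Val.cons Val.nil S =>
      exact Computes.of rfl (EvalLE.case_cons (EvalLE.var rfl) (EvalLE.case_nil (EvalLE.var rfl)
        EvalLE.nil)) (by omega)
    | Val.cons (Val.cons c d) S => exact absurd rfl (h c d S)

theorem computes_oneOn (e : Val) :
    Computes (isingProgram a b) O 16 e e.oneOn 10 := by
  fun_cases oneOn e with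
  | case1 =>
    apply Computes.of rfl
    · apply EvalLE.case_cons (EvalLE.var rfl)
      apply EvalLE.case_cons (EvalLE.var rfl)
      exact EvalLE.var rfl
    · omega
  | case2 e h =>
    match e with
    | Val.nil => exact Computes.of rfl (EvalLE.case_nil (EvalLE.var rfl) EvalLE.nil) (by omega)
    | Val.cons Val.nil S =>
      exact Computes.of rfl (EvalLE.case_cons (EvalLE.var rfl) (EvalLE.case_nil (EvalLE.var rfl)
        EvalLE.nil)) (by omega)
    | Val.cons (Val.cons c d) S => exact absurd rfl (h c d S)

end TreeMachine

namespace TreeMachine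

open Term HypergraphSpin

open Val

/-! ### Fractions -/

/-- The tree is a fraction of the value `x` with numbers of at most `L` digits. -/
def IsRatio (w : Val) (x : ℝ) (L : ℕ) : Prop :=
  ∃ p q : Val, w = Val.cons p q ∧ p.length ≤ L ∧ q.length ≤ L ∧ 0 < p.toNat ∧ 0 < q.toNat ∧
    (p.toNat : ℝ) / q.toNat = x

/-- The tree is a pair `(P, C)` of numbers of at most `L` digits such that `P / (P + C) = x`. -/
def IsProb (w : Val) (x : ℝ) (L : ℕ) : Prop :=
  ∃ P C : Val, w = Val.cons P C ∧ P.length ≤ L ∧ C.length ≤ L ∧ 0 < P.toNat + C.toNat ∧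
    (P.toNat : ℝ) / (P.toNat + C.toNat) = x

variable {a b : ℕ} {O : IsingParam → ℕ → ℕ}

theorem EvalLE.mul {env : List Val} {e₁ e₂ : IsingTerm} {x y : Val} {T₁ T₂ : ℕ} (Λ : ℕ)
    (h₁ : EvalLE (isingProgram a b) O env e₁ x T₁) (h₂ : EvalLE (isingProgram a b) O env e₂ y T₂)
    (hx : x.length ≤ Λ) (hy : y.length ≤ Λ) :
    EvalLE (isingProgram a b) O env (mulTerm e₁ e₂) (Val.mul x y)
      (T₁ + T₂ + 402 * (Λ + 1) ^ 2) := by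
  obtain ⟨t, ht, h⟩ := EvalLE.call (EvalLE.cons h₁ h₂) (computes_mul x y)
  refine ⟨t, ht.trans ?_, h⟩
  have : 200 * (x.length + 1) * (x.length + y.length + 1) ≤ 200 * (Λ + 1) * (Λ + Λ + 1) := by gcongr
  nlinarith

theorem EvalLE.add {env : List Val} {e₁ e₂ : IsingTerm} {x y : Val} {T₁ T₂ : ℕ} (Λ : ℕ)
    (h₁ : EvalLE (isingProgram a b) O env e₁ x T₁) (h₂ : EvalLE (isingProgram a b) O env e₂ y T₂)
    (hx : x.length ≤ Λ) (hy : y.length ≤ Λ) :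
    EvalLE (isingProgram a b) O env (addTerm e₁ e₂) (Val.adc Val.nil x y)
      (T₁ + T₂ + 90 * (Λ + 1) ^ 2) := by
  obtain ⟨t, ht, h⟩ := EvalLE.call (EvalLE.cons EvalLE.nil (EvalLE.cons h₁ h₂))
    (computes_adc Val.nil x y)
  refine ⟨t, ht.trans ?_, h⟩
  nlinarith

theorem toNat_add (x y : Val) : (adc Val.nil x y).toNat = x.toNat + y.toNat := by
  simp [toNat_adc, Val.toNat]

/-- For `s` true, `p/(p+q) * P/(P+C)` has numerator `p P` and complement `q P + (p+q) C`, whose sum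
is `(p+q)(P+C)`; for `s` false, `p` and `q` trade places. Storing the complement instead of the
denominator avoids subtraction. -/
theorem computes_step (s R X : Val) {x y : ℝ} {l L Λ : ℕ} (hR : IsRatio R x l)
    (hX : IsProb X y L) (hΛ : L + (2 * l + 3) ≤ Λ) :
    ∃ w, Computes (isingProgram a b) O 19 (Val.cons s (Val.cons R X)) w (3000 * (Λ + 1) ^ 2) ∧
      IsProb w (stateProb s.isTrue x * y) (L + (2 * l + 3)) := by
  obtain ⟨p, q, rfl, hp, hq, hp0, hq0, rfl⟩ := hR
  obtain ⟨P, C, rfl, hP, hC, hPC, rfl⟩ := hX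
  have e1 := length_mul p P
  have e2 := length_mul q P
  have e3 := length_adc Val.nil p q
  have e4 := length_mul (adc Val.nil p q) C
  have e5 := length_adc Val.nil (Val.mul q P) (Val.mul (adc Val.nil p q) C)
  have e6 := length_adc Val.nil (Val.mul p P) (Val.mul (adc Val.nil p q) C)
  have hQ : 1 ≤ (Λ + 1) ^ 2 := Nat.one_le_pow _ _ (by omega)
  have hp0' : (0 : ℝ) < p.toNat := by exact_mod_cast hp0
  have hq0' : (0 : ℝ) < q.toNat := by exact_mod_cast hq0
  have hPC' : (0 : ℝ) < P.toNat + C.toNat := by exact_mod_cast hPC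
  have hpos : 0 < (p.toNat + q.toNat) * (P.toNat + C.toNat) := Nat.mul_pos (by omega) hPC
  cases s with
  | nil =>
    have hc : Computes (isingProgram a b) O 19
        (Val.cons Val.nil (Val.cons (Val.cons p q) (Val.cons P C)))
        (Val.cons (Val.mul q P) (adc Val.nil (Val.mul p P) (Val.mul (adc Val.nil p q) C)))
        (3000 * (Λ + 1) ^ 2) := by
      apply Computes.of rfl
      · apply EvalLE.case_cons (EvalLE.var rfl)
        apply EvalLE.case_cons (EvalLE.var rfl)
        apply EvalLE.case_cons (EvalLE.var rfl)
        apply EvalLE.case_cons (EvalLE.var rfl)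
        apply EvalLE.case_nil (EvalLE.var rfl)
        apply EvalLE.cons
        · exact EvalLE.mul Λ (EvalLE.var rfl) (EvalLE.var rfl) (by omega) (by omega)
        · exact EvalLE.add Λ (EvalLE.mul Λ (EvalLE.var rfl) (EvalLE.var rfl) (by omega) (by omega))
            (EvalLE.mul Λ (EvalLE.add Λ (EvalLE.var rfl) (EvalLE.var rfl) (by omega) (by omega))
              (EvalLE.var rfl) (by omega) (by omega)) (by omega) (by omega)
      · omega
    refine ⟨_, hc, _, _, rfl, by omega, by omega, ?_, ?_⟩
    · simp only [toNat_mul, toNat_add]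
      nlinarith
    · have hden : (q.toNat * P.toNat + (p.toNat * P.toNat + (p.toNat + q.toNat) * C.toNat) : ℝ) =
          (p.toNat + q.toNat) * (P.toNat + C.toNat) := by ring
      simp only [toNat_mul, toNat_add, stateProb, Val.isTrue, Bool.false_eq_true, if_false]
      push_cast
      rw [hden]
      field_simp
      try ring
  | cons s₁ s₂ =>
    have hc : Computes (isingProgram a b) O 19
        (Val.cons (Val.cons s₁ s₂) (Val.cons (Val.cons p q) (Val.cons P C)))
        (Val.cons (Val.mul p P) (adc Val.nil (Val.mul q P) (Val.mul (adc Val.nil p q) C)))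
        (3000 * (Λ + 1) ^ 2) := by
      apply Computes.of rfl
      · apply EvalLE.case_cons (EvalLE.var rfl)
        apply EvalLE.case_cons (EvalLE.var rfl)
        apply EvalLE.case_cons (EvalLE.var rfl)
        apply EvalLE.case_cons (EvalLE.var rfl)
        apply EvalLE.case_cons (EvalLE.var rfl)
        apply EvalLE.cons
        · exact EvalLE.mul Λ (EvalLE.var rfl) (EvalLE.var rfl) (by omega) (by omega)
        · exact EvalLE.add Λ (EvalLE.mul Λ (EvalLE.var rfl) (EvalLE.var rfl) (by omega) (by omega))
            (EvalLE.mul Λ (EvalLE.add Λ (EvalLE.var rfl) (EvalLE.var rfl) (by omega) (by omega))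
              (EvalLE.var rfl) (by omega) (by omega)) (by omega) (by omega)
      · omega
    refine ⟨_, hc, _, _, rfl, by omega, by omega, ?_, ?_⟩
    · simp only [toNat_mul, toNat_add]
      nlinarith
    · have hden : (p.toNat * P.toNat + (q.toNat * P.toNat + (p.toNat + q.toNat) * C.toNat) : ℝ) =
          (p.toNat + q.toNat) * (P.toNat + C.toNat) := by ring
      simp only [toNat_mul, toNat_add, stateProb, Val.isTrue, if_true]
      push_cast
      rw [hden]
      field_simp
      try ring

/-- The parameters `(ml, (mb, K))` present the field `ml / K` and the interaction `mb / K`, with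
numbers of at most `l` digits. -/
def IsParams (g : Val) (β lam : ℝ) (l : ℕ) : Prop :=
  ∃ ml mb K : Val, g = Val.cons ml (Val.cons mb K) ∧ ml.length ≤ l ∧ mb.length ≤ l ∧
    K.length ≤ l ∧ 0 < ml.toNat ∧ 0 < mb.toNat ∧ 0 < K.toNat ∧ (mb.toNat : ℝ) / K.toNat = β ∧
    (ml.toNat : ℝ) / K.toNat = lam

theorem computes_base {g : Val} {β lam : ℝ} {l : ℕ} (hg : IsParams g β lam l) :
    ∃ w, Computes (isingProgram a b) O 12 g w 10 ∧ IsRatio w lam l := by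
  obtain ⟨ml, mb, K, rfl, h1, h2, h3, h4, h5, h6, rfl, rfl⟩ := hg
  refine ⟨Val.cons ml K, ?_, ml, K, rfl, h1, h3, h4, h6, rfl⟩
  apply Computes.of rfl
  · apply EvalLE.case_cons (EvalLE.var rfl)
    apply EvalLE.case_cons (EvalLE.var rfl)
    exact EvalLE.cons (EvalLE.var rfl) (EvalLE.var rfl)
  · omega

/-- For `β = mb / K` one has `1 - (1-β) P/(P+C) = (K C + mb P) / (K (P+C))`. This is the numerator;
the factor `K` below cancels in the quotient formed by `computes_combine`. -/
theorem computes_mix (ml mb K P C : Val) {Λ : ℕ} (h1 : 2 * mb.length + P.length ≤ Λ)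
    (h2 : 2 * K.length + C.length ≤ Λ) :
    Computes (isingProgram a b) O 20 (Val.cons (Val.cons ml (Val.cons mb K)) (Val.cons P C))
      (adc Val.nil (Val.mul K C) (Val.mul mb P)) (1000 * (Λ + 1) ^ 2) := by
  have e1 := length_mul K C
  have e2 := length_mul mb P
  have hQ : 1 ≤ (Λ + 1) ^ 2 := Nat.one_le_pow _ _ (by omega)
  apply Computes.of rfl
  · apply EvalLE.case_cons (EvalLE.var rfl)
    apply EvalLE.case_cons (EvalLE.var rfl)
    apply EvalLE.case_cons (EvalLE.var rfl)
    apply EvalLE.case_cons (EvalLE.var rfl)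
    exact EvalLE.add Λ (EvalLE.mul Λ (EvalLE.var rfl) (EvalLE.var rfl) (by omega) (by omega))
      (EvalLE.mul Λ (EvalLE.var rfl) (EvalLE.var rfl) (by omega) (by omega)) (by omega) (by omega)
  · omega

theorem computes_sum (P C : Val) {Λ : ℕ} (h1 : P.length ≤ Λ) (h2 : C.length ≤ Λ) :
    Computes (isingProgram a b) O 21 (Val.cons P C) (adc Val.nil P C) (100 * (Λ + 1) ^ 2) := by
  have hQ : 1 ≤ (Λ + 1) ^ 2 := Nat.one_le_pow _ _ (by omega)
  apply Computes.of rfl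
  · apply EvalLE.case_cons (EvalLE.var rfl)
    exact EvalLE.add Λ (EvalLE.var rfl) (EvalLE.var rfl) (by omega) (by omega)
  · omega

theorem computes_combine {g X Y R : Val} {β lam x y r : ℝ} {l L k Λ : ℕ}
    (hg : IsParams g β lam l) (hX : IsProb X x L) (hY : IsProb Y y L) (hR : IsRatio R r k)
    (hΛ : k + (4 * L + 4 * l + 4) ≤ Λ) :
    ∃ w, Computes (isingProgram a b) O 22 (Val.cons g (Val.cons X (Val.cons Y R))) w
        (5000 * (Λ + 1) ^ 2) ∧
      IsRatio w ((1 - (1 - β) * x) / (1 - (1 - β) * y) * r) (k + (4 * L + 4 * l + 4)) := by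
  obtain ⟨ml, mb, K, rfl, g1, g2, g3, g4, g5, g6, rfl, rfl⟩ := hg
  obtain ⟨P, C, rfl, hP, hC, hPC, rfl⟩ := hX
  obtain ⟨P', C', rfl, hP', hC', hPC', rfl⟩ := hY
  obtain ⟨p, q, rfl, hp, hq, hp0, hq0, rfl⟩ := hR
  have hQ : 1 ≤ (Λ + 1) ^ 2 := Nat.one_le_pow _ _ (by omega)
  have e1 := length_mul K C
  have e2 := length_mul mb P
  have e3 := length_adc Val.nil (Val.mul K C) (Val.mul mb P)
  have e1' := length_mul K C'
  have e2' := length_mul mb P'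
  have e3' := length_adc Val.nil (Val.mul K C') (Val.mul mb P')
  have e4 := length_adc Val.nil P C
  have e4' := length_adc Val.nil P' C'
  have e5 := length_mul (adc Val.nil (Val.mul K C) (Val.mul mb P)) p
  have e5' := length_mul (adc Val.nil (Val.mul K C') (Val.mul mb P')) q
  have e6 := length_mul (adc Val.nil P' C')
    (Val.mul (adc Val.nil (Val.mul K C) (Val.mul mb P)) p)
  have e6' := length_mul (adc Val.nil P C)
    (Val.mul (adc Val.nil (Val.mul K C') (Val.mul mb P')) q)
  have hc : Computes (isingProgram a b) O 22
      (Val.cons (Val.cons ml (Val.cons mb K)) (Val.cons (Val.cons P C) (Val.cons (Val.cons P' C')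
        (Val.cons p q))))
      (Val.cons
        (Val.mul (adc Val.nil P' C') (Val.mul (adc Val.nil (Val.mul K C) (Val.mul mb P)) p))
        (Val.mul (adc Val.nil P C) (Val.mul (adc Val.nil (Val.mul K C') (Val.mul mb P')) q)))
      (5000 * (Λ + 1) ^ 2) := by
    apply Computes.of rfl
    · apply EvalLE.case_cons (EvalLE.var rfl)
      apply EvalLE.case_cons (EvalLE.var rfl)
      apply EvalLE.case_cons (EvalLE.var rfl)
      apply EvalLE.case_cons (EvalLE.var rfl)
      apply EvalLE.cons
      · exact EvalLE.mul Λ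
          (EvalLE.call (EvalLE.var rfl) (computes_sum P' C' (Λ := Λ) (by omega) (by omega)))
          (EvalLE.mul Λ (EvalLE.call (EvalLE.cons (EvalLE.var rfl) (EvalLE.var rfl))
            (computes_mix ml mb K P C (Λ := Λ) (by omega) (by omega)))
            (EvalLE.var rfl) (by omega) (by omega)) (by omega) (by omega)
      · exact EvalLE.mul Λ
          (EvalLE.call (EvalLE.var rfl) (computes_sum P C (Λ := Λ) (by omega) (by omega)))
          (EvalLE.mul Λ (EvalLE.call (EvalLE.cons (EvalLE.var rfl) (EvalLE.var rfl))
            (computes_mix ml mb K P' C' (Λ := Λ) (by omega) (by omega)))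
            (EvalLE.var rfl) (by omega) (by omega)) (by omega) (by omega)
    · omega
  have key : ∀ P C : ℕ, 0 < P + C → 0 < K.toNat * C + mb.toNat * P := by
    intro P C h
    rcases Nat.eq_zero_or_pos C with h0 | h0
    · have : 0 < P := by omega
      positivity
    · positivity
  have hpos := key _ _ hPC
  have hpos' := key _ _ hPC'
  refine ⟨_, hc, _, _, rfl, by omega, by omega, ?_, ?_, ?_⟩
  · simp only [toNat_mul, toNat_add]; positivity
  · simp only [toNat_mul, toNat_add]; positivity
  · have h1 : (0 : ℝ) < P.toNat + C.toNat := by exact_mod_cast hPC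
    have h2 : (0 : ℝ) < P'.toNat + C'.toNat := by exact_mod_cast hPC'
    have h3 : (0 : ℝ) < K.toNat * C.toNat + mb.toNat * P.toNat := by exact_mod_cast hpos
    have h4 : (0 : ℝ) < K.toNat * C'.toNat + mb.toNat * P'.toNat := by exact_mod_cast hpos'
    have h5 : (0 : ℝ) < K.toNat := by exact_mod_cast g6
    have h6 : (0 : ℝ) < q.toNat := by exact_mod_cast hq0
    have key2 : ∀ P C : ℝ, 0 < P + C → 1 - (1 - (mb.toNat : ℝ) / K.toNat) * (P / (P + C)) =
        (K.toNat * C + mb.toNat * P) / (K.toNat * (P + C)) := by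
      intro P C h
      field_simp
      ring
    rw [key2 _ _ h1, key2 _ _ h2]
    simp only [toNat_mul, toNat_add]
    push_cast
    field_simp

end TreeMachine

namespace TreeMachine

open Term HypergraphSpin

open Val

/-! ### The recursive part of the program -/

theorem length_le_of_nodup {n : ℕ} {S : List ℕ} (h : S.Nodup) (hS : ∀ u ∈ S, u ∈ Finset.range n) :
    S.length ≤ n := by
  rw [← List.toFinset_card_of_nodup h, ← Finset.card_range n]
  exact Finset.card_le_card fun u hu => hS u (List.mem_toFinset.1 hu)

/-- The function for the approximate ratio needs at most `T` steps and yields numbers of at most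
`l` digits, on admissible instances with at most `n` vertices and `m` edges. -/
def RatioBound (a b : ℕ) (O : IsingParam → ℕ → ℕ) (g : Val) (β lam : ℝ) (n Δ m B l T : ℕ) :
    Prop :=
  ∀ Bv v I : Val, Bv.length = B → v.length < n → Admissible (Finset.range n) Δ I.toEdges →
    I.length ≤ m → ∃ w, Computes (isingProgram a b) O 11 (Val.cons g (Val.cons Bv (Val.cons v I))) w T ∧
      IsRatio w (approxRatio β lam B v.length I.toEdges) l

/-- The time for the operations that do not depend on the recursion. -/
def overhead (n m Λ : ℕ) : ℕ := 6000 * (Λ + 1) ^ 2 + 600 * ((m + 1) * (n + 1) ^ 2)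

variable {a b : ℕ} {O : IsingParam → ℕ → ℕ} {g : Val} {β lam : ℝ} {n Δ m : ℕ}

theorem computes_pin_le (s v I : Val) (hv : v.length < n) (hm : I.length ≤ m)
    (hI : Admissible (Finset.range n) Δ I.toEdges) :
    Computes (isingProgram a b) O 8 (Val.cons s (Val.cons v I)) (Val.pin s v I)
      (200 * ((m + 1) * (n + 1) ^ 2)) := by
  refine (computes_pin n s v I fun e he =>
    length_le_of_nodup (hI.edges e he).1 (hI.edges e he).2).mono ?_
  calc 200 * (I.length + 1) * ((n + 1) * (v.length + 1))
      ≤ 200 * (m + 1) * ((n + 1) * (n + 1)) := by gcongr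
    _ = _ := by ring

/-- Digit counts add under multiplication, so every vertex of the chain contributes `2 l + 3` digits
and one call for a ratio. -/
theorem computes_chain {B l T Λ : ℕ} (h : RatioBound a b O g β lam n Δ m B l T) (s Bv S I : Val)
    (hBv : Bv.length = B) (hS : ∀ u ∈ S.toVertices, u < n)
    (hI : Admissible (Finset.range n) Δ I.toEdges) (hm : I.length ≤ m)
    (hΛ : 1 + S.length * (2 * l + 3) ≤ Λ) :
    ∃ w, Computes (isingProgram a b) O 18
        (Val.cons s (Val.cons g (Val.cons Bv (Val.cons S I)))) w
        (S.length * T + (S.length + 1) * overhead n m Λ) ∧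
      IsProb w (chainProb (approxRatio β lam B) s.isTrue S.toVertices I.toEdges)
        (1 + S.length * (2 * l + 3)) := by
  have hQ : 1 ≤ (Λ + 1) ^ 2 := Nat.one_le_pow _ _ (by omega)
  induction S generalizing I with
  | nil =>
    refine ⟨Val.cons (Val.cons tt Val.nil) Val.nil, ?_, Val.cons tt Val.nil, Val.nil, rfl,
      by simp [length], by simp [length], by simp [Val.toNat], by simp [Val.toNat, toVertices, chainProb]⟩
    apply Computes.of rfl
    · apply EvalLE.case_cons (EvalLE.var rfl)
      apply EvalLE.case_cons (EvalLE.var rfl)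
      apply EvalLE.case_cons (EvalLE.var rfl)
      apply EvalLE.case_cons (EvalLE.var rfl)
      apply EvalLE.case_nil (EvalLE.var rfl)
      exact EvalLE.cons (EvalLE.cons EvalLE.one EvalLE.nil) EvalLE.nil
    · simp only [length, overhead]
      omega
  | cons u S _ ih =>
    have hu : u.length < n := hS _ (by simp [toVertices])
    have hk : (Val.cons u S).length = S.length + 1 := rfl
    rw [hk] at hΛ
    have hΛ' : 1 + S.length * (2 * l + 3) + (2 * l + 3) ≤ Λ := by
      calc _ = 1 + (S.length + 1) * (2 * l + 3) := by ring
        _ ≤ Λ := hΛ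
    obtain ⟨R, hR, hRr⟩ := h Bv u I hBv hu hI hm
    have hpin := computes_pin_le (a := a) (b := b) (O := O) s u I hu hm hI
    have hI' : Admissible (Finset.range n) Δ (Val.pin s u I).toEdges := by
      rw [toEdges_pin]; exact hI.pin _ _
    obtain ⟨X, hX, hXp⟩ := ih (Val.pin s u I) (fun w hw => hS w (by simp [toVertices, hw])) hI'
      (by rwa [length_pin]) (by omega)
    obtain ⟨w, hw, hwp⟩ := computes_step (a := a) (b := b) (O := O) s R X hRr hXp hΛ'
    refine ⟨w, ?_, ?_⟩
    · apply Computes.of rfl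
      · apply EvalLE.case_cons (EvalLE.var rfl)
        apply EvalLE.case_cons (EvalLE.var rfl)
        apply EvalLE.case_cons (EvalLE.var rfl)
        apply EvalLE.case_cons (EvalLE.var rfl)
        apply EvalLE.case_cons (EvalLE.var rfl)
        apply EvalLE.bind
        · exact EvalLE.call (EvalLE.cons (EvalLE.var rfl) (EvalLE.cons (EvalLE.var rfl)
            (EvalLE.cons (EvalLE.var rfl) (EvalLE.var rfl)))) hR
        apply EvalLE.bind
        · exact EvalLE.call (EvalLE.cons (EvalLE.var rfl) (EvalLE.cons (EvalLE.var rfl)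
            (EvalLE.cons (EvalLE.var rfl) (EvalLE.cons (EvalLE.var rfl) (EvalLE.call
              (EvalLE.cons (EvalLE.var rfl) (EvalLE.cons (EvalLE.var rfl) (EvalLE.var rfl)))
              hpin))))) hX
        exact EvalLE.call (EvalLE.cons (EvalLE.var rfl) (EvalLE.cons (EvalLE.var rfl)
          (EvalLE.var rfl))) hw
      · rw [hk]
        have e1 : (S.length + 1) * T = S.length * T + T := by ring
        have e2 : (S.length + 1 + 1) * overhead n m Λ =
          (S.length + 1) * overhead n m Λ + overhead n m Λ := by ring
        rw [e1, e2]
        simp only [overhead] at *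
        omega
    · rw [toEdges_pin] at hwp
      rw [hk, show 1 + (S.length + 1) * (2 * l + 3) = 1 + S.length * (2 * l + 3) + (2 * l + 3) by
        ring]
      exact hwp

theorem computes_chainIf {arg : Val} {x : ℝ} {L T : ℕ} (f : Val) (hL : 1 ≤ L)
    (h : ∃ w, Computes (isingProgram a b) O 18 arg w T ∧ IsProb w x L) :
    ∃ w, Computes (isingProgram a b) O 17 (Val.cons f arg) w (T + 15) ∧
      IsProb w (if f.isTrue = true then x else 0) L := by
  obtain ⟨w, hw, hp⟩ := h
  cases f with
  | nil =>
    refine ⟨Val.cons Val.nil (Val.cons tt Val.nil), ?_, Val.nil, Val.cons tt Val.nil, rfl,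
      by simp [length], by simpa [length] using hL, by simp [Val.toNat], by simp [Val.toNat, Val.isTrue]⟩
    apply Computes.of rfl
    · apply EvalLE.case_cons (EvalLE.var rfl)
      apply EvalLE.case_nil (EvalLE.var rfl)
      exact EvalLE.cons EvalLE.nil (EvalLE.cons EvalLE.one EvalLE.nil)
    · omega
  | cons f₁ f₂ =>
    refine ⟨w, ?_, by simpa [Val.isTrue] using hp⟩
    apply Computes.of rfl
    · apply EvalLE.case_cons (EvalLE.var rfl)
      apply EvalLE.case_cons (EvalLE.var rfl)
      exact EvalLE.call (EvalLE.var rfl) hw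
    · omega

/-- `Eb` and `Et` bound the digits and the recursive time of a single incident edge, uniformly in
its size `k`. Edges that avoid `v` cost only overhead, so these bounds are multiplied by the degree
and not by `m`. -/
theorem computes_edges {B l₀ Eb Et Λ : ℕ} (l T : ℕ → ℕ) (hg : IsParams g β lam l₀)
    (h : ∀ k, RatioBound a b O g β lam n Δ m (B - k) (l k) (T k))
    (hEb : ∀ k ≤ n, 4 * (1 + k * (2 * l k + 3)) + 4 * l₀ + 4 ≤ Eb)
    (hEt : ∀ k ≤ n, 2 * (k * T k + (k + 1) * overhead n m Λ) ≤ Et)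
    (hΛ : l₀ + Δ * Eb ≤ Λ) (Bv v pre rest : Val) (hBv : Bv.length = B) (hv : v.length < n)
    (hI : Admissible (Finset.range n) Δ (pre.toEdges.reverseAux rest.toEdges))
    (hm : pre.length + rest.length ≤ m) :
    ∃ w, Computes (isingProgram a b) O 13
        (Val.cons g (Val.cons Bv (Val.cons v (Val.cons pre rest)))) w
        ((rest.length + 1) * overhead n m Λ + degree v.length rest.toEdges * Et) ∧
      IsRatio w (lam * edgeProduct β (fun k u J => approxRatio β lam (B - k) u J) v.length
        pre.toEdges rest.toEdges) (l₀ + degree v.length rest.toEdges * Eb) := by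
  have hQ : 1 ≤ (Λ + 1) ^ 2 := Nat.one_le_pow _ _ (by omega)
  have hW1 : (n + 1) ^ 2 ≤ (m + 1) * (n + 1) ^ 2 := Nat.le_mul_of_pos_left _ (by omega)
  have hW2 : m + 1 ≤ (m + 1) * (n + 1) ^ 2 := Nat.le_mul_of_pos_right _ (by positivity)
  have hW3 : n + 1 ≤ (n + 1) ^ 2 := by nlinarith
  induction rest generalizing pre with
  | nil =>
    obtain ⟨w, hw, hwr⟩ := computes_base (a := a) (b := b) (O := O) hg
    refine ⟨w, ?_, by simpa [edgeProduct, toEdges, degree] using hwr⟩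
    apply Computes.of rfl
    · apply EvalLE.case_cons (EvalLE.var rfl)
      apply EvalLE.case_cons (EvalLE.var rfl)
      apply EvalLE.case_cons (EvalLE.var rfl)
      apply EvalLE.case_cons (EvalLE.var rfl)
      apply EvalLE.case_nil (EvalLE.var rfl)
      exact EvalLE.call (EvalLE.var rfl) hw
    · simp only [length, overhead]
      omega
  | cons e rest _ ih =>
    have hk : (Val.cons e rest).length = rest.length + 1 := rfl
    have hte : (Val.cons e rest).toEdges = e.toEdge :: rest.toEdges := rfl
    rw [hk] at hm
    rw [hte] at hI
    have hcur := hI.current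
    have hlen : e.support.length ≤ n := by
      rw [← length_toVertices, toVertices_support]
      exact length_le_of_nodup hcur.1 hcur.2
    have hsup := computes_support (a := a) (b := b) (O := O) e
    have hmem := (computes_contains (a := a) (b := b) (O := O) v e.support).mono
      (show _ ≤ 40 * (n + 1) ^ 2 by
        calc 40 * (e.support.length + 1) * (v.length + 1) ≤ 40 * (n + 1) * (n + 1) := by gcongr
          _ = _ := by ring)
    have hmemT := isTrue_contains v e.support
    rw [toVertices_support] at hmemT
    cases hc : contains v e.support with
    | nil =>
      rw [hc] at hmem hmemT
      have hnv : v.length ∉ e.toEdge.support := by simpa [Val.isTrue] using hmemT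
      have hI' := hI.next true v.length
      rw [show HypergraphSpin.pinEdge true v.length e.toEdge = e.toEdge by
        simp [HypergraphSpin.pinEdge, hnv]] at hI'
      obtain ⟨w, hw, hwr⟩ := ih (Val.cons e pre) hI' (by rw [length_cons]; omega)
      refine ⟨w, ?_, ?_⟩
      · apply Computes.of rfl
        · apply EvalLE.case_cons (EvalLE.var rfl)
          apply EvalLE.case_cons (EvalLE.var rfl)
          apply EvalLE.case_cons (EvalLE.var rfl)
          apply EvalLE.case_cons (EvalLE.var rfl)
          apply EvalLE.case_cons (EvalLE.var rfl)
          apply EvalLE.case_nil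
          · exact EvalLE.call (EvalLE.cons (EvalLE.var rfl) (EvalLE.call (EvalLE.var rfl) hsup)) hmem
          exact EvalLE.call (EvalLE.cons (EvalLE.var rfl) (EvalLE.cons (EvalLE.var rfl)
            (EvalLE.cons (EvalLE.var rfl) (EvalLE.cons (EvalLE.cons (EvalLE.var rfl)
              (EvalLE.var rfl)) (EvalLE.var rfl))))) hw
        · rw [hk, hte, degree_cons, if_neg hnv]
          have e1 : (rest.length + 1 + 1) * overhead n m Λ =
            (rest.length + 1) * overhead n m Λ + overhead n m Λ := by ring
          rw [e1, add_zero]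
          simp only [overhead] at *
          omega
      · rw [hte, degree_cons, if_neg hnv, edgeProduct, if_neg hnv]
        exact hwr
    | cons c₁ c₂ =>
      rw [hc] at hmem hmemT
      have hnv : v.length ∈ e.toEdge.support := by simpa [Val.isTrue] using hmemT
      have hdeg : degree v.length rest.toEdges + 1 ≤ Δ := by
        have := hI.degree_le v.length
        rw [degree_reverseAux, degree_cons, if_pos hnv] at this
        omega
      set S := remove v e.support with hSdef
      have hSv : S.toVertices = e.toEdge.support.filter (· ≠ v.length) := by
        rw [hSdef, toVertices_remove, toVertices_support]
      obtain ⟨hSn, hSU⟩ := hI.filter_nodup v.length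
      rw [← hSv] at hSn hSU
      have hSlen : S.length ≤ n := by
        rw [← length_toVertices]; exact length_le_of_nodup hSn hSU
      have hrem := (computes_remove (a := a) (b := b) (O := O) v e.support).mono
        (show _ ≤ 50 * (n + 1) ^ 2 by
          calc 50 * (e.support.length + 1) * (v.length + 1) ≤ 50 * (n + 1) * (n + 1) := by gcongr
            _ = _ := by ring)
      have hrestI : Admissible (Finset.range n) Δ rest.toEdges := by
        refine ⟨fun e' he' => hI.edges e' (by simp [List.reverseAux_eq, he']), fun u => ?_⟩
        have := hI.degree_le u
        rw [degree_reverseAux, degree_cons] at this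
        omega
      have hpin := computes_pin_le (a := a) (b := b) (O := O) (m := m) Val.nil v rest hv (by omega) hrestI
      set J := revApp pre (Val.pin Val.nil v rest) with hJdef
      have hJe : J.toEdges = pre.toEdges.reverseAux
          (HypergraphSpin.pin false v.length rest.toEdges) := by
        rw [hJdef, toEdges_revApp, toEdges_pin]; rfl
      have hJ : Admissible (Finset.range n) Δ J.toEdges := by
        rw [hJe]; exact hI.without false v.length
      have hJlen : J.length ≤ m := by
        rw [hJdef, length_revApp, length_pin]; omega
      have hrapp := computes_revApp (a := a) (b := b) (O := O) pre (Val.pin Val.nil v rest)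
      have hdrop := computes_drop (a := a) (b := b) (O := O) S Bv
      have hdl : (drop S Bv).length = B - S.length := by rw [length_drop, hBv]
      have hbits := hEb S.length hSlen
      have hΔE : (degree v.length rest.toEdges + 1) * Eb ≤ Δ * Eb := Nat.mul_le_mul_right _ hdeg
      have hΔE' : (degree v.length rest.toEdges + 1) * Eb =
        degree v.length rest.toEdges * Eb + Eb := by ring
      have hchain := fun s => computes_chain (Λ := Λ) (h S.length) s (drop S Bv) S J hdl
        (fun u hu => Finset.mem_range.1 (hSU u hu)) hJ hJlen (by omega)
      obtain ⟨X, hX, hXp⟩ := computes_chainIf e.oneOn (by omega) (hchain tt)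
      obtain ⟨Y, hY, hYp⟩ := computes_chainIf e.zeroOn (by omega) (hchain Val.nil)
      have hone := computes_oneOn (a := a) (b := b) (O := O) e
      have hzero := computes_zeroOn (a := a) (b := b) (O := O) e
      have hpe := (computes_pinEdge (a := a) (b := b) (O := O) tt v e).mono
        (show _ ≤ 150 * (n + 1) ^ 2 by
          calc 150 * (e.support.length + 1) * (v.length + 1) ≤ 150 * (n + 1) * (n + 1) := by gcongr
            _ = _ := by ring)
      have hI' := hI.next true v.length
      have hpe' : (Val.pinEdge tt v e).toEdge = HypergraphSpin.pinEdge true v.length e.toEdge := by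
        rw [toEdge_pinEdge]; rfl
      rw [← hpe'] at hI'
      obtain ⟨R, hR, hRr⟩ := ih (Val.cons (Val.pinEdge tt v e) pre) hI' (by rw [length_cons]; omega)
      obtain ⟨w, hw, hwr⟩ := computes_combine (a := a) (b := b) (O := O) (Λ := Λ) hg hXp hYp hRr
        (by omega)
      refine ⟨w, ?_, ?_⟩
      · apply Computes.of rfl
        · apply EvalLE.case_cons (EvalLE.var rfl)
          apply EvalLE.case_cons (EvalLE.var rfl)
          apply EvalLE.case_cons (EvalLE.var rfl)
          apply EvalLE.case_cons (EvalLE.var rfl)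
          apply EvalLE.case_cons (EvalLE.var rfl)
          apply EvalLE.case_cons
          · exact EvalLE.call (EvalLE.cons (EvalLE.var rfl) (EvalLE.call (EvalLE.var rfl) hsup)) hmem
          apply EvalLE.bind
          · exact EvalLE.call (EvalLE.cons (EvalLE.var rfl) (EvalLE.call (EvalLE.var rfl) hsup)) hrem
          apply EvalLE.bind
          · exact EvalLE.call (EvalLE.cons (EvalLE.var rfl) (EvalLE.call (EvalLE.cons EvalLE.nil
              (EvalLE.cons (EvalLE.var rfl) (EvalLE.var rfl))) hpin)) hrapp
          apply EvalLE.bind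
          · exact EvalLE.call (EvalLE.cons (EvalLE.var rfl) (EvalLE.var rfl)) hdrop
          apply EvalLE.bind
          · exact EvalLE.call (EvalLE.cons (EvalLE.call (EvalLE.var rfl) hone) (EvalLE.cons
              EvalLE.one (EvalLE.cons (EvalLE.var rfl) (EvalLE.cons (EvalLE.var rfl)
                (EvalLE.cons (EvalLE.var rfl) (EvalLE.var rfl)))))) hX
          apply EvalLE.bind
          · exact EvalLE.call (EvalLE.cons (EvalLE.call (EvalLE.var rfl) hzero) (EvalLE.cons
              EvalLE.nil (EvalLE.cons (EvalLE.var rfl) (EvalLE.cons (EvalLE.var rfl)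
                (EvalLE.cons (EvalLE.var rfl) (EvalLE.var rfl)))))) hY
          apply EvalLE.bind
          · exact EvalLE.call (EvalLE.cons (EvalLE.var rfl) (EvalLE.cons (EvalLE.var rfl)
              (EvalLE.cons (EvalLE.var rfl) (EvalLE.cons (EvalLE.cons (EvalLE.call (EvalLE.cons
                EvalLE.one (EvalLE.cons (EvalLE.var rfl) (EvalLE.var rfl))) hpe) (EvalLE.var rfl))
                (EvalLE.var rfl))))) hR
          exact EvalLE.call (EvalLE.cons (EvalLE.var rfl) (EvalLE.cons (EvalLE.var rfl)
            (EvalLE.cons (EvalLE.var rfl) (EvalLE.var rfl)))) hw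
        · have ht := hEt S.length hSlen
          rw [hk, hte, degree_cons, if_pos hnv]
          have e1 : (rest.length + 1 + 1) * overhead n m Λ =
            (rest.length + 1) * overhead n m Λ + overhead n m Λ := by ring
          have e2 : (degree v.length rest.toEdges + 1) * Et =
            degree v.length rest.toEdges * Et + Et := by ring
          rw [e1, e2]
          generalize (rest.length + 1) * overhead n m Λ = z1 at *
          generalize S.length * T S.length + (S.length + 1) * overhead n m Λ = z2 at *
          generalize degree v.length rest.toEdges * Et = z3 at *
          have e3 : overhead n m Λ = 6000 * (Λ + 1) ^ 2 + 600 * ((m + 1) * (n + 1) ^ 2) := rfl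
          rw [e3]
          omega
      · rw [hte, degree_cons, if_pos hnv, edgeProduct, if_pos hnv]
        obtain ⟨p, q, h1, h2, h3, h4, h5, h6⟩ := hwr
        refine ⟨p, q, h1, by omega, by omega, h4, h5, h6.trans ?_⟩
        rw [edgeFactor, ← hSv, ← hJe, length_toVertices, ← isTrue_oneOn, ← isTrue_zeroOn, ← hpe']
        have e4 : ∀ (f : Bool) (x : ℝ), (1 - β) * (if f = true then x else 0) =
            (if f = true then 1 - β else 0) * x := by
          intro f x; cases f <;> simp
        rw [e4, e4]
        simp only [Val.isTrue, toEdges]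
        ring

end TreeMachine

/-! ### Growth of time and digits with the budget, and the model functions for reading the input -/

namespace TreeMachine

open Term HypergraphSpin

open Val

/-- Why budgets control the size of the recursion: as `k ≤ D ^ k`, the `k` calls made for an edge
with `k` vertices weigh no more than a single call with budget `B`. Subtracting `1` makes the weight
vanish at budget `0`, which covers `k ≥ B`. -/
theorem mul_pow_sub_one_le {D : ℕ} (hD : 2 ≤ D) (B k : ℕ) :
    k * (D ^ (B - k) - 1) ≤ D ^ B - 1 := by
  rcases Nat.eq_zero_or_pos k with rfl | hk
  · simp
  rcases le_total B k with h | h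
  · simp [Nat.sub_eq_zero_of_le h]
  · have h1 : k * D ^ (B - k) ≤ D ^ B := by
      calc k * D ^ (B - k) ≤ D ^ k * D ^ (B - k) := by
            gcongr
            exact (Nat.lt_pow_self (by omega)).le
        _ = D ^ B := by rw [← pow_add]; congr 1; omega
    rw [Nat.mul_sub, mul_one]
    omega

theorem IsRatio.mono {w : Val} {x : ℝ} {L L' : ℕ} (h : IsRatio w x L) (hL : L ≤ L') :
    IsRatio w x L' := by
  obtain ⟨p, q, h1, h2, h3, h4⟩ := h
  exact ⟨p, q, h1, h2.trans hL, h3.trans hL, h4⟩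

/-- The growth of the numbers of digits. -/
def digitScale (n l₀ : ℕ) : ℕ := 4 * l₀ + 8 + 12 * n + 8 * (n * l₀)

/-- The growth of the time. -/
def timeScale (Δ n m Λ : ℕ) : ℕ :=
  40 + (m + 1) * overhead n m Λ + 2 * (Δ * (30 * n + (n + 1) * overhead n m Λ))

variable {a b : ℕ} {O : IsingParam → ℕ → ℕ} {g : Val} {β lam : ℝ} {n Δ m : ℕ}

/-- An incident edge with `k` vertices causes `2 k` calls in time, and `8 k` times the digits of a
ratio: a chain doubles them and `computes_combine` uses four probability components. By
`mul_pow_sub_one_le` the dependence on `k` disappears, and `D = 8 Δ + 2` dominates both recurrences.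
`Bmax` enters only to have one bound `Λ` on all operands. -/
theorem ratioBound {l₀ Bmax Λ : ℕ} (hg : IsParams g β lam l₀)
    (hΛ : l₀ + digitScale n l₀ * ((8 * Δ + 2) ^ Bmax - 1) ≤ Λ) (B : ℕ) (hB : B ≤ Bmax) :
    RatioBound a b O g β lam n Δ m B (l₀ + digitScale n l₀ * ((8 * Δ + 2) ^ B - 1))
      (30 + timeScale Δ n m Λ * ((8 * Δ + 2) ^ B - 1)) := by
  induction B using Nat.strong_induction_on with
  | _ B ih =>
    intro Bv v I hBv hv hI hm
    cases Bv with
    | nil =>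
      obtain ⟨w, hw, hwr⟩ := computes_base (a := a) (b := b) (O := O) hg
      rw [length_nil] at hBv
      subst hBv
      refine ⟨w, ?_, ?_⟩
      · apply Computes.of rfl
        · apply EvalLE.case_cons (EvalLE.var rfl)
          apply EvalLE.case_cons (EvalLE.var rfl)
          apply EvalLE.case_cons (EvalLE.var rfl)
          apply EvalLE.case_nil (EvalLE.var rfl)
          exact EvalLE.call (EvalLE.var rfl) hw
        · omega
      · rw [approxRatio]
        exact hwr.mono (by omega)
    | cons c Bv =>
      rw [length_cons] at hBv
      subst hBv
      set B := Bv.length with hBdef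
      set D := 8 * Δ + 2 with hD
      set W := digitScale n l₀ with hW
      set V := timeScale Δ n m Λ with hV
      have hpos : 1 ≤ D ^ B := Nat.one_le_pow _ _ (by omega)
      obtain ⟨X, hX⟩ : ∃ X, D ^ B = X + 1 := ⟨D ^ B - 1, by omega⟩
      have hX1 : D ^ B - 1 = X := by omega
      have hX2 : D ^ (B + 1) - 1 = 8 * (Δ * X) + 8 * Δ + 2 * X + 1 := by
        have : D ^ (B + 1) = 8 * (Δ * X) + 8 * Δ + 2 * X + 2 := by
          rw [pow_succ, hX, hD]; ring
        omega
      have hrec : ∀ k, k * (D ^ (B - k) - 1) ≤ X := fun k => by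
        rw [← hX1]; exact mul_pow_sub_one_le (by omega) B k
      have hbits : l₀ + Δ * (W + 8 * (W * X)) ≤ l₀ + W * (D ^ (B + 1) - 1) := by
        rw [hX2]
        have e1 : Δ * (W + 8 * (W * X)) = W * Δ + 8 * (W * (Δ * X)) := by ring
        have e2 : W * (8 * (Δ * X) + 8 * Δ + 2 * X + 1) =
          8 * (W * (Δ * X)) + 8 * (W * Δ) + 2 * (W * X) + W := by ring
        omega
      have hmono : W * (D ^ (B + 1) - 1) ≤ W * (D ^ Bmax - 1) := by
        have : D ^ (B + 1) ≤ D ^ Bmax := Nat.pow_le_pow_right (by omega) hB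
        gcongr
      obtain ⟨w, hw, hwr⟩ := computes_edges (a := a) (b := b) (O := O) (g := g) (β := β)
        (lam := lam) (n := n) (Δ := Δ) (m := m) (B := B) (l₀ := l₀) (Λ := Λ)
        (Eb := W + 8 * (W * X)) (Et := 2 * (30 * n + V * X + (n + 1) * overhead n m Λ))
        (fun k => l₀ + W * (D ^ (B - k) - 1)) (fun k => 30 + V * (D ^ (B - k) - 1)) hg
        (fun k => ih (B - k) (by omega) (by omega)) (by
          intro k hk
          have e1 : k * l₀ ≤ n * l₀ := Nat.mul_le_mul_right _ hk
          have e2 : W * (k * (D ^ (B - k) - 1)) ≤ W * X := Nat.mul_le_mul_left _ (hrec k)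
          have e3 : 4 * (1 + k * (2 * (l₀ + W * (D ^ (B - k) - 1)) + 3)) + 4 * l₀ + 4 =
            8 + 8 * (k * l₀) + 8 * (W * (k * (D ^ (B - k) - 1))) + 12 * k + 4 * l₀ := by ring
          have e4 : W = 4 * l₀ + 8 + 12 * n + 8 * (n * l₀) := rfl
          omega) (by
          intro k hk
          have e2 : V * (k * (D ^ (B - k) - 1)) ≤ V * X := Nat.mul_le_mul_left _ (hrec k)
          have e3 : 2 * (k * (30 + V * (D ^ (B - k) - 1)) + (k + 1) * overhead n m Λ) =
            2 * (30 * k + V * (k * (D ^ (B - k) - 1)) + (k + 1) * overhead n m Λ) := by ring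
          have e4 : (k + 1) * overhead n m Λ ≤ (n + 1) * overhead n m Λ := by gcongr
          omega) (by omega) Bv v Val.nil I rfl hv hI (by simpa [length] using hm)
      have hdeg := hI.degree_le v.length
      refine ⟨w, ?_, ?_⟩
      · apply Computes.of rfl
        · apply EvalLE.case_cons (EvalLE.var rfl)
          apply EvalLE.case_cons (EvalLE.var rfl)
          apply EvalLE.case_cons (EvalLE.var rfl)
          apply EvalLE.case_cons (EvalLE.var rfl)
          exact EvalLE.call (EvalLE.cons (EvalLE.var rfl) (EvalLE.cons (EvalLE.var rfl)
            (EvalLE.cons (EvalLE.var rfl) (EvalLE.cons EvalLE.nil (EvalLE.var rfl))))) hw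
        · rw [hX2]
          have e1 : (I.length + 1) * overhead n m Λ ≤ (m + 1) * overhead n m Λ := by gcongr
          have e2 : degree v.length I.toEdges *
              (2 * (30 * n + V * X + (n + 1) * overhead n m Λ)) ≤
              Δ * (2 * (30 * n + V * X + (n + 1) * overhead n m Λ)) := Nat.mul_le_mul_right _ hdeg
          have e3 : Δ * (2 * (30 * n + V * X + (n + 1) * overhead n m Λ)) =
            2 * (Δ * (30 * n + (n + 1) * overhead n m Λ)) + 2 * (V * (Δ * X)) := by ring
          have e4 : V * (8 * (Δ * X) + 8 * Δ + 2 * X + 1) =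
            8 * (V * (Δ * X)) + 8 * (V * Δ) + 2 * (V * X) + V := by ring
          have e5 : V = 40 + (m + 1) * overhead n m Λ +
            2 * (Δ * (30 * n + (n + 1) * overhead n m Λ)) := rfl
          rw [e4]
          generalize V * (Δ * X) = y1 at *
          generalize V * Δ = y2 at *
          generalize V * X = y3 at *
          generalize overhead n m Λ = o at *
          omega
      · rw [approxRatio]
        refine hwr.mono ?_
        have e1 : degree v.length I.toEdges * (W + 8 * (W * X)) ≤ Δ * (W + 8 * (W * X)) :=
          Nat.mul_le_mul_right _ hdeg
        omega

/-! ### Reading the input -/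

namespace Val

def row : Val → Val
  | nil => nil
  | cons nil x => row x
  | cons (cons _ _) x => cons x (row x)

def rows : Val → Val
  | nil => nil
  | cons r x => cons (cons (cons tt tt) (row r)) (rows x)

def vertices : Val → Val
  | nil => nil
  | cons _ x => cons x (vertices x)

def count : Val → Val
  | nil => nil
  | cons _ x => inc (count x)

def pow (x : Val) : Val → Val
  | nil => cons tt nil
  | cons _ y => mul x (pow x y)

def powTwo : Val → Val
  | nil => cons tt nil
  | cons _ x => cons nil (powTwo x)

def pad (x : Val) : ℕ → Val
  | 0 => x
  | k + 1 => cons nil (pad x k)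

def scale (a : ℕ) : Val → Val → Val
  | nil, y => y
  | cons _ x, y => pad (scale a x y) a

theorem length_pad (x : Val) (k : ℕ) : (pad x k).length = x.length + k := by
  induction k with
  | zero => rfl
  | succ k ih => rw [pad, length_cons, ih]; rfl

theorem length_scale (a : ℕ) (x y : Val) : (scale a x y).length = a * x.length + y.length := by
  fun_induction scale a x y with
  | case1 => simp [length]
  | case2 _ x y ih => rw [length_pad, ih, length_cons]; ring

theorem toNat_powTwo (x : Val) : (powTwo x).toNat = 2 ^ x.length := by
  fun_induction powTwo x with
  | case1 => rfl
  | case2 _ x ih => rw [Val.toNat, ih, length_cons, pow_succ']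

theorem length_powTwo (x : Val) : (powTwo x).length = x.length + 1 := by
  fun_induction powTwo x <;> simp_all [length]

theorem toNat_pow (x y : Val) : (pow x y).toNat = x.toNat ^ y.length := by
  fun_induction pow x y with
  | case1 => rfl
  | case2 _ y ih => rw [toNat_mul, ih, length_cons, pow_succ']

theorem length_pow (x y : Val) : (pow x y).length ≤ 2 * (y.length * x.length) + 1 := by
  fun_induction pow x y with
  | case1 => simp [length]
  | case2 _ y ih =>
    have := length_mul x (pow x y)
    rw [length_cons]
    nlinarith

theorem toNat_count (x : Val) : (count x).toNat = x.length := by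
  fun_induction count x with
  | case1 => rfl
  | case2 _ y ih => rw [toNat_inc, ih, length_cons]

theorem toNat_lt (x : Val) : x.toNat < 2 ^ x.length := by
  fun_induction Val.toNat x <;> simp_all [length, pow_succ] <;> omega

/-- The condition says that there is no leading zero. Since `inc` preserves it, `count` produces
numbers of logarithmic length, which makes the budget logarithmic. -/
theorem two_pow_length_inc_le (x : Val) (h : x.length = 0 ∨ 2 ^ x.length ≤ 2 * x.toNat) :
    2 ^ (inc x).length ≤ 2 * (inc x).toNat := by
  fun_induction inc x with
  | case1 => simp [length, Val.toNat]
  | case2 x =>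
    simp only [length, Val.toNat, pow_succ] at *
    omega
  | case3 _ _ x ih =>
    simp only [length, Val.toNat, pow_succ] at *
    have := ih (by
      rcases Nat.eq_zero_or_pos x.length with h0 | h0
      · exact Or.inl h0
      · obtain ⟨k, hk⟩ := Nat.exists_eq_succ_of_ne_zero h0.ne'
        right
        rw [hk, pow_succ] at h ⊢
        omega)
    omega

theorem two_pow_length_count_le (x : Val) : 2 ^ (count x).length ≤ 2 * x.length + 1 := by
  have key : (count x).length = 0 ∨ 2 ^ (count x).length ≤ 2 * (count x).toNat := by
    fun_induction count x with
    | case1 => simp [length]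
    | case2 _ x ih => exact Or.inr (two_pow_length_inc_le _ ih)
  rw [toNat_count] at key
  rcases key with h | h
  · rw [h]; omega
  · omega

theorem length_vertices (x : Val) : (vertices x).length = x.length := by
  fun_induction vertices x <;> simp_all [length]

theorem toVertices_vertices (x : Val) :
    (vertices x).toVertices.Nodup ∧ ∀ u, u ∈ (vertices x).toVertices ↔ u < x.length := by
  fun_induction vertices x with
  | case1 => simp [toVertices, length]
  | case2 _ x ih =>
    simp only [toVertices, List.nodup_cons, List.mem_cons, ih.2, lt_irrefl, not_false_iff, ih.1,
      length, true_and]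
    intro u
    omega

theorem length_rows (x : Val) : (rows x).length = x.length := by
  fun_induction rows x <;> simp_all [length]

end Val

end TreeMachine

/-! ### Running the input functions and the main function -/

namespace TreeMachine

open Term HypergraphSpin

open Val

variable {a b : ℕ} {O : IsingParam → ℕ → ℕ}

theorem computes_row (x : Val) :
    Computes (isingProgram a b) O 23 x (row x) (20 * (x.length + 1)) := by
  fun_induction row x <;>
  · apply Computes.of rfl
    · repeat first
        | exact EvalLE.var rfl
        | exact EvalLE.nil
        | exact EvalLE.call (EvalLE.var rfl) (by assumption)
        | exact EvalLE.cons (EvalLE.var rfl) (EvalLE.call (EvalLE.var rfl) (by assumption))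
        | apply EvalLE.case_nil (EvalLE.var rfl)
        | apply EvalLE.case_cons (EvalLE.var rfl)
    · simp only [length]; omega

theorem computes_rows (n : ℕ) (x : Val) (hx : ∀ k ∈ x.toVertices, k ≤ n) :
    Computes (isingProgram a b) O 24 x (rows x) ((x.length + 1) * (20 * (n + 2))) := by
  fun_induction rows x with
  | case1 =>
    apply Computes.of rfl
    · exact EvalLE.case_nil (EvalLE.var rfl) EvalLE.nil
    · simp only [length]; omega
  | case2 r x ih =>
    have hr := hx r.length (by simp [toVertices])
    have ih := ih fun k hk => hx k (by simp [toVertices, hk])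
    apply Computes.of rfl
    · apply EvalLE.case_cons (EvalLE.var rfl)
      apply EvalLE.cons
      · exact EvalLE.cons (EvalLE.cons EvalLE.one EvalLE.one)
          (EvalLE.call (EvalLE.var rfl) (computes_row r))
      · exact EvalLE.call (EvalLE.var rfl) ih
    · rw [length_cons, show (x.length + 1 + 1) * (20 * (n + 2)) =
        (x.length + 1) * (20 * (n + 2)) + 20 * (n + 2) by ring]
      omega

theorem computes_vertices (x : Val) :
    Computes (isingProgram a b) O 25 x (vertices x) (20 * (x.length + 1)) := by
  fun_induction vertices x <;>
  · apply Computes.of rfl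
    · repeat first
        | exact EvalLE.nil
        | exact EvalLE.cons (EvalLE.var rfl) (EvalLE.call (EvalLE.var rfl) (by assumption))
        | apply EvalLE.case_nil (EvalLE.var rfl)
        | apply EvalLE.case_cons (EvalLE.var rfl)
    · simp only [length]; omega

theorem length_count_le (x : Val) : (count x).length ≤ x.length := by
  fun_induction count x with
  | case1 => simp
  | case2 _ x ih =>
    have := length_inc (count x)
    rw [length_cons]; omega

theorem computes_count (x : Val) :
    Computes (isingProgram a b) O 26 x (count x) (40 * (x.length + 1) ^ 2) := by
  fun_induction count x with
  | case1 =>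
    apply Computes.of rfl
    · exact EvalLE.case_nil (EvalLE.var rfl) EvalLE.nil
    · simp [length]
  | case2 _ x ih =>
    have := length_count_le x
    apply Computes.of rfl
    · apply EvalLE.case_cons (EvalLE.var rfl)
      exact EvalLE.call (EvalLE.call (EvalLE.var rfl) ih) (computes_inc _)
    · rw [length_cons]; nlinarith

theorem computes_pow (x y : Val) (Λ : ℕ) (hx : x.length ≤ Λ)
    (hΛ : 2 * (y.length * x.length) + 1 ≤ Λ) :
    Computes (isingProgram a b) O 27 (Val.cons x y) (Val.pow x y)
      ((y.length + 1) * (500 * (Λ + 1) ^ 2)) := by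
  have hQ : 1 ≤ (Λ + 1) ^ 2 := Nat.one_le_pow _ _ (by omega)
  fun_induction Val.pow x y with
  | case1 =>
    apply Computes.of rfl
    · apply EvalLE.case_cons (EvalLE.var rfl)
      exact EvalLE.case_nil (EvalLE.var rfl) (EvalLE.cons EvalLE.one EvalLE.nil)
    · rw [length_nil]; omega
  | case2 _ y ih =>
    rw [length_cons] at hΛ
    have h1 : 2 * (y.length * x.length) + 1 ≤ Λ := by nlinarith
    have h2 := length_pow x y
    apply Computes.of rfl
    · apply EvalLE.case_cons (EvalLE.var rfl)
      apply EvalLE.case_cons (EvalLE.var rfl)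
      exact EvalLE.mul Λ (EvalLE.var rfl)
        (EvalLE.call (EvalLE.cons (EvalLE.var rfl) (EvalLE.var rfl)) (ih h1)) hx (by omega)
    · rw [length_cons, show (y.length + 1 + 1) * (500 * (Λ + 1) ^ 2) =
        (y.length + 1) * (500 * (Λ + 1) ^ 2) + 500 * (Λ + 1) ^ 2 by ring]
      omega

theorem computes_powTwo (x : Val) :
    Computes (isingProgram a b) O 28 x (powTwo x) (20 * (x.length + 1)) := by
  fun_induction powTwo x <;>
  · apply Computes.of rfl
    · repeat first
        | exact EvalLE.cons EvalLE.one EvalLE.nil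
        | exact EvalLE.cons EvalLE.nil (EvalLE.call (EvalLE.var rfl) (by assumption))
        | apply EvalLE.case_nil (EvalLE.var rfl)
        | apply EvalLE.case_cons (EvalLE.var rfl)
    · simp only [length]; omega

theorem EvalLE.pad {env : List Val} {e : IsingTerm} {v : Val} {T : ℕ}
    (h : EvalLE (isingProgram a b) O env e v T) (k : ℕ) :
    EvalLE (isingProgram a b) O env (padTerm e k) (Val.pad v k) (T + 2 * k) := by
  induction k with
  | zero => exact h
  | succ k ih =>
    obtain ⟨t, ht, h⟩ := EvalLE.cons EvalLE.nil ih
    exact ⟨t, by omega, h⟩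

theorem computes_scale (x y : Val) :
    Computes (isingProgram a b) O 29 (Val.cons x y) (scale a x y)
      ((x.length + 1) * (20 + 2 * a)) := by
  fun_induction scale a x y with
  | case1 =>
    apply Computes.of rfl
    · apply EvalLE.case_cons (EvalLE.var rfl)
      exact EvalLE.case_nil (EvalLE.var rfl) (EvalLE.var rfl)
    · rw [length_nil]; omega
  | case2 _ x y ih =>
    apply Computes.of rfl
    · apply EvalLE.case_cons (EvalLE.var rfl)
      apply EvalLE.case_cons (EvalLE.var rfl)
      exact EvalLE.pad (EvalLE.call (EvalLE.cons (EvalLE.var rfl) (EvalLE.var rfl)) ih) a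
    · rw [length_cons, show (x.length + 1 + 1) * (20 + 2 * a) =
        (x.length + 1) * (20 + 2 * a) + (20 + 2 * a) by ring]
      omega

/-- The budget of the program. -/
def Val.budget (a b : ℕ) (n rows num den : Val) : Val :=
  scale a (count n) (scale a (count rows) (scale a (drop num den) (Val.pad Val.nil b)))

theorem length_budget (n rows num den : Val) : (Val.budget a b n rows num den).length =
    a * ((count n).length + (count rows).length + (den.length - num.length)) + b := by
  simp only [Val.budget, length_scale, length_pad, length_drop, length_nil]
  ring

/-- The parameters that the program obtains from the oracles. -/
def Val.params (O : IsingParam → ℕ → ℕ) (B : Val) : Val :=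
  Val.cons (Val.ofNat (O .field B.length))
    (Val.cons (Val.ofNat (O .interaction B.length)) (powTwo B))

theorem evalLE_budget {env : List Val} {i j k l M : ℕ} {n r num den : Val}
    (hi : env[i]? = some n) (hj : env[j]? = some r) (hk : env[k]? = some num)
    (hl : env[l]? = some den) (hn : n.length ≤ M) (hm : r.length ≤ M) (h1 : num.length ≤ M)
    (h2 : den.length ≤ M) :
    EvalLE (isingProgram a b) O env (budgetTerm b (.var i) (.var j) (.var k) (.var l))
      (Val.budget a b n r num den) ((400 + 10 * a + 10 * b) * (M + 1) ^ 2) := by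
  have e1 := length_count_le n
  have e2 := length_count_le r
  have e3 : (drop num den).length = den.length - num.length := length_drop _ _
  have key := EvalLE.call (EvalLE.cons
    (EvalLE.call (EvalLE.var hi) (computes_count (a := a) (b := b) (O := O) n))
    (EvalLE.call (EvalLE.cons (EvalLE.call (EvalLE.var hj) (computes_count r))
      (EvalLE.call (EvalLE.cons (EvalLE.call (EvalLE.cons (EvalLE.var hk) (EvalLE.var hl))
        (computes_drop num den)) (EvalLE.pad EvalLE.nil b)) (computes_scale _ _)))
      (computes_scale _ _))) (computes_scale _ _)
  obtain ⟨t, ht, h⟩ := key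
  refine ⟨t, ht.trans ?_, h⟩
  have c1 : 40 * (n.length + 1) ^ 2 ≤ 40 * (M + 1) ^ 2 := by gcongr
  have c2 : 40 * (r.length + 1) ^ 2 ≤ 40 * (M + 1) ^ 2 := by gcongr
  have c3 : M + 1 ≤ (M + 1) ^ 2 := by nlinarith
  have c4 : ∀ x ≤ M, (x + 1) * (20 + 2 * a) ≤ (M + 1) ^ 2 * (20 + 2 * a) := fun x hx => by
    gcongr; omega
  have c5 := c4 (count n).length (by omega)
  have c6 := c4 (count r).length (by omega)
  have c7 := c4 (drop num den).length (by omega)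
  have c8 : b ≤ b * (M + 1) ^ 2 := Nat.le_mul_of_pos_right _ (by positivity)
  nlinarith

theorem overhead_le {n m Λ M : ℕ} (hn : n ≤ M) (hm : m ≤ M) (hΛ : Λ ≤ M) :
    overhead n m Λ ≤ 6600 * (M + 1) ^ 3 := by
  calc overhead n m Λ ≤ 6000 * (M + 1) ^ 2 + 600 * ((M + 1) * (M + 1) ^ 2) := by
        unfold overhead; gcongr
    _ ≤ 6600 * (M + 1) ^ 3 := by
        have : (M + 1) ^ 2 ≤ (M + 1) ^ 3 := Nat.pow_le_pow_right (by omega) (by omega)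
        have : (M + 1) * (M + 1) ^ 2 = (M + 1) ^ 3 := by ring
        omega

theorem timeScale_le {Δ n m Λ M : ℕ} (hn : n ≤ M) (hm : m ≤ M) (hΛ : Λ ≤ M) :
    timeScale Δ n m Λ ≤ 15000 * (Δ + 1) * (M + 1) ^ 4 := by
  have ho := overhead_le hn hm hΛ
  have p1 : 1 ≤ (M + 1) ^ 4 := Nat.one_le_pow _ _ (by omega)
  have p2 : M + 1 ≤ (M + 1) ^ 4 := Nat.le_self_pow (by omega) _
  calc timeScale Δ n m Λ ≤ 40 + (M + 1) * (6600 * (M + 1) ^ 3) +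
        2 * (Δ * (30 * M + (M + 1) * (6600 * (M + 1) ^ 3))) := by
        unfold timeScale; gcongr
    _ = 40 + 6600 * (M + 1) ^ 4 + 2 * (Δ * (30 * M + 6600 * (M + 1) ^ 4)) := by ring
    _ ≤ 40 * (M + 1) ^ 4 + 6600 * (M + 1) ^ 4 +
        2 * (Δ * (30 * (M + 1) ^ 4 + 6600 * (M + 1) ^ 4)) := by gcongr <;> omega
    _ ≤ _ := by nlinarith [Nat.zero_le (Δ * (M + 1) ^ 4)]

/-- A single `M` bounds the input lists, the factor `D ^ B` and all digit counts. The exponent `6`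
is reached by at most `M` calls for ratios, each costing `timeScale = O(M ^ 4)` times `D ^ B ≤ M`.
Here `β` and `lam` are the dyadic values, and the output is exact for them. -/
theorem isingProgram_runs {Δ l₀ M : ℕ} {β lam : ℝ} {n r num den : Val}
    (hg : IsParams (Val.params O (Val.budget a b n r num den)) β lam l₀)
    (hI : Admissible (Finset.range n.length) Δ (rows r).toEdges)
    (hr : ∀ k ∈ r.toVertices, k ≤ n.length)
    (hn : n.length ≤ M) (hm : r.length ≤ M) (h1 : num.length ≤ M) (h2 : den.length ≤ M)
    (hB : (8 * Δ + 2) ^ (Val.budget a b n r num den).length ≤ M)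
    (hM : 1 + (n.length + 1) * (2 * (l₀ + digitScale n.length l₀ *
      ((8 * Δ + 2) ^ (Val.budget a b n r num den).length - 1)) + 3) +
      (2 * (r.length * l₀) + l₀ + 1) ≤ M) :
    ∃ w t, Runs (isingProgram a b) O (Val.cons (Val.cons n r) (Val.cons num den)) w t ∧
      t ≤ 100000 * (Δ + a + b + 1) * (M + 1) ^ 6 ∧
      (w.toRat : ℝ) = β ^ r.length / chainProb
        (approxRatio β lam (Val.budget a b n r num den).length) false (vertices n).toVertices
        (rows r).toEdges := by
  set Bv := Val.budget a b n r num den with hBv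
  obtain ⟨l, hl⟩ : ∃ l, l = l₀ + digitScale n.length l₀ * ((8 * Δ + 2) ^ Bv.length - 1) :=
    ⟨_, rfl⟩
  rw [← hl] at hM
  have hsplit : (n.length + 1) * (2 * l + 3) = n.length * (2 * l + 3) + (2 * l + 3) := by ring
  have hBM : Bv.length ≤ M := (Nat.lt_pow_self (by omega)).le.trans hB
  have hbound := ratioBound (a := a) (b := b) (O := O) (n := n.length) (m := r.length) (Λ := M)
    hg (Bmax := Bv.length) (Δ := Δ) (by rw [← hl]; omega) Bv.length le_rfl
  rw [← hl] at hbound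
  clear hl
  obtain ⟨X, hX, hXp⟩ := computes_chain (Λ := M) hbound Val.nil Bv (vertices n) (rows r) rfl
    (fun u hu => ((toVertices_vertices n).2 u).1 hu) hI (length_rows r).le
    (by rw [length_vertices]; omega)
  obtain ⟨P, C, rfl, hP, hC, hPC, hval⟩ := hXp
  rw [length_vertices] at hX hP hC
  obtain ⟨ml, mb, K, hgeq, g1, g2, g3, g4, g5, g6, g7, -⟩ := hg
  obtain ⟨rfl, rfl, rfl⟩ : Val.ofNat (O .field Bv.length) = ml ∧
      Val.ofNat (O .interaction Bv.length) = mb ∧ powTwo Bv = K := by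
    simpa [Val.params] using hgeq
  set ml := Val.ofNat (O .field Bv.length)
  set mb := Val.ofNat (O .interaction Bv.length)
  have hmbM : r.length * mb.length ≤ r.length * l₀ := Nat.mul_le_mul_left _ g2
  have hKM : r.length * (powTwo Bv).length ≤ r.length * l₀ := Nat.mul_le_mul_left _ g3
  have hlm := length_pow mb r
  have hlK := length_pow (powTwo Bv) r
  have hsum := length_adc Val.nil P C
  have hpow := fun x hx hx' => computes_pow (a := a) (b := b) (O := O) x r M hx hx'
  have hmain : EvalLE (isingProgram a b) O [Val.cons (Val.cons n r) (Val.cons num den)]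
      (.call 0 (.var 0)) (Val.cons (Val.mul (adc Val.nil P C) (Val.pow mb r))
        (Val.mul P (Val.pow (powTwo Bv) r))) (100000 * (Δ + a + b + 1) * (M + 1) ^ 6) := by
    -- The `2` that is subtracted pays for the outer call and its variable.
    have hcomp : Computes (isingProgram a b) O 0 (Val.cons (Val.cons n r) (Val.cons num den))
        (Val.cons (Val.mul (adc Val.nil P C) (Val.pow mb r))
          (Val.mul P (Val.pow (powTwo Bv) r))) (100000 * (Δ + a + b + 1) * (M + 1) ^ 6 - 2) := by
      apply Computes.of rfl
      · apply EvalLE.case_cons (EvalLE.var rfl)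
        apply EvalLE.case_cons (EvalLE.var rfl)
        apply EvalLE.case_cons (EvalLE.var rfl)
        apply EvalLE.bind
        · exact evalLE_budget (M := M) rfl rfl rfl rfl hn hm h1 h2
        apply EvalLE.bind
        · exact EvalLE.query (EvalLE.var rfl)
        apply EvalLE.bind
        · exact EvalLE.query (EvalLE.var rfl)
        apply EvalLE.bind
        · exact EvalLE.call (EvalLE.var rfl) (computes_powTwo Bv)
        apply EvalLE.bind
        · exact EvalLE.call (EvalLE.cons EvalLE.nil (EvalLE.cons (EvalLE.cons (EvalLE.var rfl)
            (EvalLE.cons (EvalLE.var rfl) (EvalLE.var rfl))) (EvalLE.cons (EvalLE.var rfl)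
              (EvalLE.cons (EvalLE.call (EvalLE.var rfl) (computes_vertices n))
                (EvalLE.call (EvalLE.var rfl) (computes_rows n.length r hr)))))) hX
        apply EvalLE.case_cons (EvalLE.var rfl)
        apply EvalLE.cons
        · exact EvalLE.mul M (EvalLE.add M (EvalLE.var rfl) (EvalLE.var rfl) (by omega) (by omega))
            (EvalLE.call (EvalLE.cons (EvalLE.var rfl) (EvalLE.var rfl))
              (hpow mb (by omega) (by omega))) (by omega) (by omega)
        · exact EvalLE.mul M (EvalLE.var rfl)
            (EvalLE.call (EvalLE.cons (EvalLE.var rfl) (EvalLE.var rfl))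
              (hpow (powTwo Bv) (by omega) (by omega))) (by omega) (by omega)
      · have q1 : (M + 1) ^ 2 ≤ (M + 1) ^ 6 := Nat.pow_le_pow_right (by omega) (by omega)
        have q2 : M + 1 ≤ (M + 1) ^ 6 := Nat.le_self_pow (by omega) _
        have t1 : (r.length + 1) * (500 * (M + 1) ^ 2) ≤ 500 * (M + 1) ^ 6 := by
          calc (r.length + 1) * (500 * (M + 1) ^ 2) ≤ (M + 1) * (500 * (M + 1) ^ 2) := by gcongr
            _ = 500 * (M + 1) ^ 3 := by ring
            _ ≤ _ := by gcongr <;> omega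
        have t2 : (r.length + 1) * (20 * (n.length + 2)) ≤ 40 * (M + 1) ^ 6 := by
          calc (r.length + 1) * (20 * (n.length + 2)) ≤ (M + 1) * (20 * (2 * (M + 1))) := by
                gcongr; omega
            _ = 40 * (M + 1) ^ 2 := by ring
            _ ≤ _ := by gcongr
        have t3 : n.length * (30 + timeScale Δ n.length r.length M *
            ((8 * Δ + 2) ^ Bv.length - 1)) ≤ 15030 * (Δ + 1) * (M + 1) ^ 6 := by
          have e1 := timeScale_le (Δ := Δ) hn hm (le_refl M)
          calc _ ≤ M * (30 + 15000 * (Δ + 1) * (M + 1) ^ 4 * M) := by gcongr; omega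
            _ ≤ (M + 1) * (30 * (Δ + 1) * (M + 1) ^ 5 +
                15000 * (Δ + 1) * (M + 1) ^ 4 * (M + 1)) := by
                gcongr
                · omega
                · have : 1 ≤ (Δ + 1) * (M + 1) ^ 5 := Nat.mul_pos (by omega) (by positivity)
                  nlinarith
                · omega
            _ = _ := by ring
        have t4 : (n.length + 1) * overhead n.length r.length M ≤ 6600 * (M + 1) ^ 6 := by
          have e1 := overhead_le hn hm (le_refl M)
          calc _ ≤ (M + 1) * (6600 * (M + 1) ^ 3) := by gcongr
            _ = 6600 * (M + 1) ^ 4 := by ring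
            _ ≤ _ := by gcongr <;> omega
        have t5 : (400 + 10 * a + 10 * b) * (M + 1) ^ 2 ≤
            (400 + 10 * a + 10 * b) * (M + 1) ^ 6 := by gcongr
        have t6 : 100000 * (Δ + a + b + 1) * (M + 1) ^ 6 =
          15030 * (Δ + 1) * (M + 1) ^ 6 + (400 + 10 * a + 10 * b) * (M + 1) ^ 6 +
            (84970 * Δ + 99990 * a + 99990 * b + 84570) * (M + 1) ^ 6 := by ring
        have t7 : 84570 * (M + 1) ^ 6 ≤
            (84970 * Δ + 99990 * a + 99990 * b + 84570) * (M + 1) ^ 6 := by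
          gcongr; omega
        rw [t6, ← hBv]
        generalize (84970 * Δ + 99990 * a + 99990 * b + 84570) * (M + 1) ^ 6 = z1 at *
        generalize (400 + 10 * a + 10 * b) * (M + 1) ^ 6 = z2 at *
        generalize 15030 * (Δ + 1) * (M + 1) ^ 6 = z3 at *
        generalize (M + 1) ^ 6 = z4 at *
        omega
    have hcall : EvalLE (isingProgram a b) O [Val.cons (Val.cons n r) (Val.cons num den)]
      (.call 0 (.var 0)) _ _ := EvalLE.call (EvalLE.var rfl) hcomp
    obtain ⟨t, ht, h⟩ := hcall
    refine ⟨t, ht.trans ?_, h⟩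
    have : 1 ≤ (M + 1) ^ 6 := Nat.one_le_pow _ _ (by omega)
    have : 100000 * 1 * 1 ≤ 100000 * (Δ + a + b + 1) * (M + 1) ^ 6 := by gcongr; omega
    omega
  obtain ⟨t, ht, h⟩ := hmain
  refine ⟨_, t, h, ht, ?_⟩
  change _ = _ / chainProb _ Val.nil.isTrue _ _
  rw [← hval, ← g7]
  simp only [Val.toRat, toNat_mul, toNat_add, toNat_pow]
  push_cast
  rw [div_pow, div_div_div_eq]
  ring

end TreeMachine

namespace HypergraphSpin

open TreeMachine Finset

/-! ### Encoded hypergraphs -/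

section Encoding

variable {α : Type*}

open Classical in
/-- The numbers of the vertices of `e`, where a vertex in the list `vs` is numbered by the number
of vertices behind it. -/
noncomputable def incidentIds (e : Set α) : List α → List ℕ
  | [] => []
  | v :: vs => if v ∈ e then vs.length :: incidentIds e vs else incidentIds e vs

/-- A hyperedge with labels on both states. -/
noncomputable def encodedEdge (vs : List α) (e : Set α) : LabelledEdge :=
  ⟨true, true, incidentIds e vs⟩

/-- Numbers count the vertices behind a vertex, so `k` is a position in the reversed list. -/
theorem mem_incidentIds {e : Set α} {vs : List α} {k : ℕ} :
    k ∈ incidentIds e vs ↔ ∃ v ∈ e, vs.reverse[k]? = some v := by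
  induction vs with
  | nil => simp [incidentIds]
  | cons v vs ih =>
    have key : (∃ w ∈ e, (v :: vs).reverse[k]? = some w) ↔
        (k = vs.length ∧ v ∈ e) ∨ ∃ w ∈ e, vs.reverse[k]? = some w := by
      rw [List.reverse_cons, List.getElem?_append]
      rcases lt_trichotomy k vs.length with h | h | h
      · simp [h, h.ne]
      · simp [h]
      · have h1 : ¬ k < vs.length := by omega
        have h2 : k - vs.length ≠ 0 := by omega
        simp [h1, h.ne', h2]
    rw [key, ← ih]
    by_cases h : v ∈ e <;> simp [incidentIds, h]

theorem lt_of_mem_incidentIds {e : Set α} {vs : List α} {k : ℕ} (h : k ∈ incidentIds e vs) :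
    k < vs.length := by
  obtain ⟨v, -, h⟩ := mem_incidentIds.1 h
  simpa using (List.getElem?_eq_some_iff.1 h).1

theorem nodup_incidentIds (e : Set α) (vs : List α) : (incidentIds e vs).Nodup := by
  induction vs with
  | nil => simp [incidentIds]
  | cons v vs ih =>
    by_cases h : v ∈ e
    · simp only [incidentIds, h, if_true, List.nodup_cons]
      exact ⟨fun h' => (lt_of_mem_incidentIds h').false, ih⟩
    · simpa [incidentIds, h] using ih

theorem length_ofList (l : List Val) : (Val.ofList l).length = l.length := by
  induction l <;> simp_all [Val.ofList, Val.length]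

open Classical in
theorem toVertices_row (e : Set α) (vs : List α) :
    (Val.row (.ofList (vs.map fun v => .ofBool (decide (v ∈ e))))).toVertices =
      incidentIds e vs := by
  induction vs with
  | nil => rfl
  | cons v vs ih =>
    by_cases h : v ∈ e
    · simp [incidentIds, h, ← ih, Val.ofList, Val.ofBool, Val.row, Val.toVertices, length_ofList]
    · simp [incidentIds, h, ← ih, Val.ofList, Val.ofBool, Val.row]

open Classical in
/-- The incidence matrix. -/
noncomputable def incidenceMatrix (vs : List α) (es : List (Set α)) : Val :=
  .ofList (es.map fun e => .ofList (vs.map fun v => .ofBool (decide (v ∈ e))))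

theorem toEdges_rows (vs : List α) (es : List (Set α)) :
    (Val.rows (incidenceMatrix vs es)).toEdges = es.map (encodedEdge vs) := by
  induction es with
  | nil => rfl
  | cons e es ih =>
    have h := toVertices_row e vs
    simp only [incidenceMatrix, List.map_cons, Val.ofList, Val.rows, Val.toEdges] at ih ⊢
    rw [ih]
    simp only [Val.toEdge, h]
    rfl

theorem le_of_mem_toVertices_incidenceMatrix (vs : List α) (es : List (Set α)) :
    ∀ k ∈ (incidenceMatrix vs es).toVertices, k ≤ vs.length := by
  induction es with
  | nil => simp [incidenceMatrix, Val.ofList, Val.toVertices]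
  | cons e es ih =>
    intro k hk
    simp only [incidenceMatrix, List.map_cons, Val.ofList, Val.toVertices, List.mem_cons] at ih hk
    rcases hk with rfl | hk
    · simp [length_ofList]
    · exact ih k hk

variable {G : Hypergraph α} {vs : List α} {es : List (Set α)}

theorem Enumerates.admissible (h : Enumerates G vs es) {Δ : ℕ} (hΔ : maxDegree G ≤ (Δ : ℕ∞)) :
    Admissible (range vs.length) Δ (es.map (encodedEdge vs)) := by
  classical
  refine ⟨fun e he => ?_, fun k => ?_⟩
  · obtain ⟨e, -, rfl⟩ := List.mem_map.1 he
    exact ⟨nodup_incidentIds e vs, fun u hu => mem_range.2 (lt_of_mem_incidentIds hu)⟩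
  · rw [degree, List.countP_map]
    by_cases hk : k < vs.reverse.length
    · set v := vs.reverse[k] with hv
      have hvG : v ∈ G.vertexSet := (h.mem_vs v).1 (List.mem_reverse.1 (List.getElem_mem hk))
      have h1 : es.countP ((fun e => decide (k ∈ e.support)) ∘ encodedEdge vs) =
          (es.filter (fun e => decide (v ∈ e))).length := by
        rw [← List.countP_eq_length_filter]
        refine List.countP_congr fun e _ => ?_
        simp [encodedEdge, mem_incidentIds, List.getElem?_eq_getElem hk, hv]
      rw [h1, ← List.toFinset_card_of_nodup (h.es_nodup.filter _), ← Nat.cast_le (α := ℕ∞),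
        ← Set.encard_coe_eq_coe_finsetCard]
      refine le_trans (le_of_eq ?_) ((le_iSup₂ (f := fun v (_ : v ∈ G.vertexSet) =>
        {e | e ∈ G.edgeSet ∧ v ∈ e}.encard) v hvG).trans hΔ)
      congr 1
      ext e
      simp [h.mem_es]
    · rw [List.countP_eq_zero.2]
      · exact Nat.zero_le _
      · intro e _ hk'
        exact hk (by simpa using lt_of_mem_incidentIds (of_decide_eq_true hk'))

/-- Configurations correspond to their sets of ones, with vertices numbered by position in
`vs.reverse`. -/
theorem Enumerates.isingPartitionFunction_eq (h : Enumerates G vs es) (β lam : ℝ) :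
    isingPartitionFunction β lam G =
      total β lam (range vs.length) (es.map (encodedEdge vs)) 1 := by
  classical
  let f : Fin vs.reverse.length ≃ G.vertexSet :=
    ((List.nodup_reverse.2 h.vs_nodup).getEquiv vs.reverse).trans
      (Equiv.subtypeEquivRight fun v => by rw [List.mem_reverse, h.mem_vs])
  have hf : ∀ k : Fin vs.reverse.length, (f k : α) = vs.reverse[k] := fun k => rfl
  have : Fintype G.vertexSet := Fintype.ofEquiv _ f
  have hlen : vs.reverse.length = vs.length := List.length_reverse
  have hedge : ∀ (A : Finset ℕ) (e : Set α),
      edgeWeight (G := G) β β e (fun v => decide ((f.symm v : ℕ) ∈ A)) =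
        labelWeight β A (encodedEdge vs e) := by
    intro A e
    have hmem : ∀ p : ℕ → Prop, (∀ v : G.vertexSet, (v : α) ∈ e → p (f.symm v)) ↔
        ∀ u ∈ incidentIds e vs, p u := by
      intro p
      constructor
      · intro H u hu
        obtain ⟨v, hv, hu⟩ := mem_incidentIds.1 hu
        obtain ⟨hu', rfl⟩ := List.getElem?_eq_some_iff.1 hu
        simpa using H (f ⟨u, hu'⟩) hv
      · intro H v hv
        refine H _ (mem_incidentIds.2 ⟨v, hv, ?_⟩)
        rw [List.getElem?_eq_getElem (f.symm v).2]
        exact congrArg some ((hf _).symm.trans (by simp))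
    have h1 := hmem (· ∉ A)
    have h2 := hmem (· ∈ A)
    simp only [edgeWeight, labelWeight, encodedEdge, decide_eq_false_iff_not, decide_eq_true_eq,
      h1, h2, true_and]
    -- An empty edge meets both conditions; as both labels equal `β`, nested cases and disjunction
    -- agree.
    by_cases a : ∀ u ∈ incidentIds e vs, u ∉ A
    · rw [if_pos a, if_pos (Or.inl a)]
    · rw [if_neg a]
      exact if_congr (by rw [or_iff_right a]) rfl rfl
  have hweight : ∀ A ∈ (range vs.length).powerset,
      weight G (fun _ => β) (fun _ => β) lam (fun v => decide ((f.symm v : ℕ) ∈ A)) =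
        configWeight β lam (es.map (encodedEdge vs)) A := by
    intro A hA
    rw [weight, configWeight, mul_comm]
    congr 1
    · rw [finprod_eq_prod_of_fintype, ← Equiv.prod_comp f]
      simp only [Equiv.symm_apply_apply, vertexWeight, decide_eq_true_eq]
      rw [Fin.prod_univ_eq_prod_range (fun k => if k ∈ A then lam else 1), prod_ite, prod_const,
        prod_const_one, mul_one, filter_mem_eq_inter, hlen, inter_eq_right.2 (mem_powerset.1 hA)]
    · have hE : G.edgeSet = (es.toFinset : Set (Set α)) := by
        ext e; simp [h.mem_es]
      rw [finprod_set_coe_eq_finprod_mem (f := fun e => edgeWeight β β e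
        (fun v => decide ((f.symm v : ℕ) ∈ A))), hE, finprod_mem_coe_finset,
        List.prod_toFinset _ h.es_nodup, List.map_map]
      congr 1
      exact List.map_congr_left fun e _ => hedge A e
  rw [isingPartitionFunction, partitionFunction, finsum_eq_sum_of_fintype, total]
  symm
  refine sum_nbij' (fun A v => decide ((f.symm v : ℕ) ∈ A))
    (fun σ => (univ.filter fun k => σ (f k) = true).map Fin.valEmbedding)
    (fun _ _ => mem_univ _) ?_ ?_ ?_ ?_
  · intro σ _
    rw [mem_powerset]
    intro k hk
    obtain ⟨k, -, rfl⟩ := mem_map.1 hk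
    exact mem_range.2 (hlen ▸ k.2)
  · intro A hA
    ext k
    simp only [Equiv.symm_apply_apply, decide_eq_true_eq, mem_map, mem_filter, mem_univ, true_and,
      Fin.valEmbedding_apply]
    constructor
    · rintro ⟨k, hk, rfl⟩; exact hk
    · intro hk
      exact ⟨⟨k, by rw [hlen]; exact mem_range.1 (mem_powerset.1 hA hk)⟩, hk, rfl⟩
  · intro σ _
    ext v
    simp only [mem_map, mem_filter, mem_univ, true_and, Fin.valEmbedding_apply, Fin.val_inj]
    simp
  · intro A hA
    rw [hweight A hA, Pi.one_apply, mul_one]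

end Encoding

end HypergraphSpin

namespace HypergraphSpin

open Finset

/-! ### Perturbation of the parameters -/

/-- The weight of a configuration has at most one parameter factor per vertex and per edge, and each
of them grows by at most `exp η`. -/
theorem total_le_exp_mul {β β' lam lam' η : ℝ} (hβ : 0 < β) (hβ' : 0 < β') (hl : 0 < lam)
    (hl' : 0 < lam') (hη : 0 ≤ η) (h1 : β' ≤ Real.exp η * β) (h2 : lam' ≤ Real.exp η * lam)
    (U : Finset ℕ) (I : List LabelledEdge) :
    total β' lam' U I 1 ≤ Real.exp η ^ (U.card + I.length) * total β lam U I 1 := by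
  have he : 1 ≤ Real.exp η := Real.one_le_exp hη
  unfold total
  rw [mul_sum]
  refine sum_le_sum fun A hA => ?_
  simp only [Pi.one_apply, mul_one, configWeight]
  have hprod : ∀ J : List LabelledEdge, (J.map (labelWeight β' A)).prod ≤
      Real.exp η ^ J.length * (J.map (labelWeight β A)).prod := by
    intro J
    induction J with
    | nil => simp
    | cons e J ih =>
      simp only [List.map_cons, List.prod_cons, List.length_cons, pow_succ']
      have hw : labelWeight β' A e ≤ Real.exp η * labelWeight β A e := by
        unfold labelWeight
        split_ifs
        · exact h1
        · linarith
      have hJ : 0 ≤ (J.map (labelWeight β' A)).prod := List.prod_nonneg fun x hx => by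
        obtain ⟨e, -, rfl⟩ := List.mem_map.1 hx
        exact (labelWeight_pos hβ' A e).le
      calc _ ≤ (Real.exp η * labelWeight β A e) *
            (Real.exp η ^ J.length * (J.map (labelWeight β A)).prod) :=
            mul_le_mul hw ih hJ (mul_pos (by positivity) (labelWeight_pos hβ A e)).le
        _ = _ := by ring
  have hJ : 0 ≤ (I.map (labelWeight β' A)).prod := List.prod_nonneg fun x hx => by
    obtain ⟨e, -, rfl⟩ := List.mem_map.1 hx
    exact (labelWeight_pos hβ' A e).le
  have hJ' : 0 ≤ (I.map (labelWeight β A)).prod := List.prod_nonneg fun x hx => by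
    obtain ⟨e, -, rfl⟩ := List.mem_map.1 hx
    exact (labelWeight_pos hβ A e).le
  have hcard : A.card ≤ U.card := card_le_card (mem_powerset.1 hA)
  calc lam' ^ A.card * (I.map (labelWeight β' A)).prod
      ≤ (Real.exp η * lam) ^ A.card *
        (Real.exp η ^ I.length * (I.map (labelWeight β A)).prod) := by
        gcongr
        exact hprod I
    _ = Real.exp η ^ A.card * (lam ^ A.card *
        (Real.exp η ^ I.length * (I.map (labelWeight β A)).prod)) := by rw [mul_pow]; ring
    _ ≤ Real.exp η ^ U.card * (lam ^ A.card *
        (Real.exp η ^ I.length * (I.map (labelWeight β A)).prod)) := by gcongr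
    _ = _ := by rw [pow_add]; ring

theorem abs_log_sub_log_le {x y c δ : ℝ} (hc : 0 < c) (hx : c ≤ x) (hy : c ≤ y)
    (h : |x - y| ≤ δ) : |Real.log x - Real.log y| ≤ δ / c := by
  have key : ∀ x y : ℝ, c ≤ x → c ≤ y → |x - y| ≤ δ → Real.log x - Real.log y ≤ δ / c := by
    intro x y hx hy h
    have hx0 := hc.trans_le hx
    have hy0 := hc.trans_le hy
    rw [← Real.log_div hx0.ne' hy0.ne']
    calc Real.log (x / y) ≤ x / y - 1 := Real.log_le_sub_one_of_pos (by positivity)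
      _ = (x - y) / y := by field_simp
      _ ≤ δ / y := by gcongr; exact (le_abs_self _).trans h
      _ ≤ δ / c := by
        have := (abs_nonneg _).trans h
        gcongr
  rw [abs_le]
  have h1 := key x y hx hy h
  have h2 := key y x hy hx (by rwa [abs_sub_comm])
  constructor <;> linarith

theorem abs_log_total_sub_le {β β' lam lam' η : ℝ} (hβ : 0 < β) (hβ' : 0 < β') (hl : 0 < lam)
    (hl' : 0 < lam') (h1 : |Real.log β' - Real.log β| ≤ η)
    (h2 : |Real.log lam' - Real.log lam| ≤ η) (U : Finset ℕ) (I : List LabelledEdge) :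
    |Real.log (total β' lam' U I 1) - Real.log (total β lam U I 1)| ≤
      (U.card + I.length : ℕ) * η := by
  have hη := (abs_nonneg _).trans h1
  have hle : ∀ {x y : ℝ}, 0 < x → 0 < y → |Real.log x - Real.log y| ≤ η →
      x ≤ Real.exp η * y := by
    intro x y hx hy h
    rw [← Real.log_le_log_iff hx (by positivity), Real.log_mul (Real.exp_ne_zero _) hy.ne',
      Real.log_exp]
    linarith [(abs_le.1 h).2]
  have key : ∀ {β β' lam lam' : ℝ}, 0 < β → 0 < β' → 0 < lam → 0 < lam' →
      |Real.log β' - Real.log β| ≤ η → |Real.log lam' - Real.log lam| ≤ η →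
      Real.log (total β' lam' U I 1) - Real.log (total β lam U I 1) ≤
        (U.card + I.length : ℕ) * η := by
    intro β β' lam lam' hβ hβ' hl hl' h1 h2
    have hT := total_one_pos hβ hl U I
    have hT' := total_one_pos hβ' hl' U I
    have h := total_le_exp_mul hβ hβ' hl hl' hη (hle hβ' hβ h1) (hle hl' hl h2) U I
    have := Real.log_le_log hT' h
    rw [Real.log_mul (by positivity) hT.ne', Real.log_pow, Real.log_exp] at this
    linarith
  rw [abs_le]
  have e1 := key hβ hβ' hl hl' h1 h2
  have e2 := key hβ' hβ hl' hl (by rwa [abs_sub_comm]) (by rwa [abs_sub_comm])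
  constructor <;> linarith

/-- Contraction needs only `β₀ > x / (1 + x)`, and the assumed threshold is strictly above that
since `2 (1 + x) < 2 x + 3`. The gap leaves room for some `β₀ < β`, so that the decay also holds for
approximations of `β` from below. -/
theorem exists_decayParams {Δ : ℕ} {β : ℝ} (hβ0 : 0 < β) (hβ1 : β < 1)
    (hβ : 1 - 2 / (2 * Real.exp (-1 / 2) * (Δ : ℝ) + 3) ≤ β) (Λ₀ : ℝ) :
    ∃ β₀ θ, β₀ < β ∧ DecayParams Δ β₀ Λ₀ θ := by
  set x := Real.exp (-1 / 2) * (Δ : ℝ) with hx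
  have hx0 : 0 ≤ x := by positivity
  have h1 : x / (1 + x) < β := by
    refine lt_of_lt_of_le ?_ hβ
    rw [mul_assoc, ← hx, div_lt_iff₀ (by positivity)]
    have h3 : 2 / (2 * x + 3) * (2 * x + 3) = 2 := div_mul_cancel₀ _ (by positivity)
    have h4 : 2 / (2 * x + 3) * (1 + x) < 1 := by
      rw [div_mul_eq_mul_div, div_lt_one (by positivity)]; linarith
    linarith
  obtain ⟨β₀, h2, h3⟩ := exists_between (max_lt h1 hβ0)
  obtain ⟨h4, h5⟩ := max_lt_iff.1 h2
  obtain ⟨θ, t1, t2, t3⟩ := exists_decay_rate (Δ * ((1 - β₀) / β₀))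
    (Real.sigmoid (Λ₀ + Δ * -Real.log β₀))
    (mul_nonneg (by positivity) (div_nonneg (by linarith) h5.le))
    (Real.sigmoid_pos _) (Real.sigmoid_lt_one _) (by
      rw [div_lt_iff₀ (by positivity)] at h4
      rw [← mul_div_assoc, div_mul_eq_mul_div, div_lt_one h5]
      calc _ = x * (1 - β₀) := by rw [hx]; ring
        _ < β₀ := by linarith)
  exact ⟨β₀, θ, h3, h5, by linarith, t1, t2, t3⟩

end HypergraphSpin

namespace TreeMachine

open HypergraphSpin

/-! ### Sizes of the input -/

namespace Val

theorem toNat_ofNat (n : ℕ) : (ofNat n).toNat = n := by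
  induction n using Nat.binaryRec' with
  | zero => simp [ofNat, ofList, Val.toNat]
  | bit b n h ih =>
    rw [ofNat, Nat.bits_append_bit n b h]
    cases b
    · simp only [List.map_cons, ofList, ofBool, Val.toNat]
      exact congrArg (2 * ·) ih
    · simp only [List.map_cons, ofList, ofBool, Val.toNat]
      exact congrArg (2 * · + 1) ih

theorem length_ofNat (n : ℕ) : (ofNat n).length = n.size := by
  rw [ofNat, length_ofList, List.length_map, Nat.size_eq_bits_len]

theorem length_ofUnary (n : ℕ) : (ofUnary n).length = n := by
  rw [ofUnary, length_ofList, List.length_replicate]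

theorem length_le_size (x : Val) : x.length ≤ x.size := by
  induction x with
  | nil => simp [length]
  | cons x y _ ih => simp only [length, size]; omega

theorem lt_two_pow_length_count (x : Val) : x.length + 1 ≤ 2 ^ (count x).length := by
  have := toNat_lt (count x)
  rwa [toNat_count] at this

end Val

/-- The difference of digit counts, truncated at `0`, replaces `log₂ (1/ε)`: the first bound gives
enough accuracy, the second keeps the time polynomial in `1/ε`. -/
theorem two_pow_digits_mul (ε : ℚ) (hε : 0 < ε) :
    (1 : ℝ) ≤ 2 ^ (ε.den.size - ε.num.toNat.size) * (2 * (ε : ℝ)) ∧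
      2 ^ (ε.den.size - ε.num.toNat.size) ≤ 2 * ⌈1 / ε⌉₊ := by
  have hp : 0 < ε.num.toNat := by
    have := Rat.num_pos.2 hε
    omega
  have hnum : ((ε.num.toNat : ℕ) : ℚ) = ε.num := by
    exact_mod_cast Int.toNat_of_nonneg (Rat.num_pos.2 hε).le
  have hq : 0 < ε.den := ε.den_pos
  have heq : ε = (ε.num.toNat : ℚ) / ε.den := by rw [hnum, Rat.num_div_den]
  generalize ε.num.toNat = p at *
  generalize ε.den = q at *
  have p1 := Nat.lt_size_self p
  have q1 := Nat.lt_size_self q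
  have p0 : 0 < p.size := Nat.size_pos.2 hp
  have q0 : 0 < q.size := Nat.size_pos.2 hq
  have p2 : 2 ^ (p.size - 1) ≤ p := Nat.lt_size.1 (by omega)
  have q2 : 2 ^ (q.size - 1) ≤ q := Nat.lt_size.1 (by omega)
  constructor
  · have h1 : q ≤ 2 ^ (q.size - p.size) * (2 * p) := by
      calc q ≤ 2 ^ q.size := q1.le
        _ ≤ 2 ^ ((q.size - p.size) + (1 + (p.size - 1))) :=
          Nat.pow_le_pow_right (by omega) (by omega)
        _ = 2 ^ (q.size - p.size) * (2 * 2 ^ (p.size - 1)) := by rw [pow_add, pow_add, pow_one]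
        _ ≤ _ := by gcongr
    have h2 : (q : ℝ) ≤ 2 ^ (q.size - p.size) * (2 * p) := by exact_mod_cast h1
    have hq' : (0 : ℝ) < q := by exact_mod_cast hq
    rw [heq]
    push_cast
    rw [← mul_div_assoc, ← mul_div_assoc, le_div_iff₀ hq', one_mul]
    exact h2
  · have hE : q ≤ ⌈1 / ε⌉₊ * p := by
      have h1 : (1 / ε : ℚ) ≤ (⌈1 / ε⌉₊ : ℚ) := Nat.le_ceil _
      have hp' : (0 : ℚ) < p := by exact_mod_cast hp
      nth_rewrite 1 [heq] at h1
      rw [one_div_div, div_le_iff₀ hp'] at h1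
      exact_mod_cast h1
    rcases Nat.eq_zero_or_pos (q.size - p.size) with h | h
    · rw [h]
      have : 0 < ⌈1 / ε⌉₊ := Nat.ceil_pos.2 (by positivity)
      omega
    · refine Nat.le_of_mul_le_mul_right ?_ hp
      calc 2 ^ (q.size - p.size) * p ≤ 2 ^ (q.size - p.size) * 2 ^ p.size := by gcongr
        _ = 2 ^ (1 + (q.size - 1)) := by rw [← pow_add]; congr 1; omega
        _ = 2 * 2 ^ (q.size - 1) := by rw [pow_add, pow_one]
        _ ≤ 2 * (⌈1 / ε⌉₊ * p) := by gcongr; exact q2.trans hE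
        _ = _ := by ring

theorem isParams_of_presents {O : IsingParam → ℕ → ℕ} {β lam : ℝ}
    (hO : ∀ i, Presents (O i) (isingParams β lam i)) {k : ℕ} (hβ1 : β < 1) (hlam : lam ≤ 2 ^ k)
    (B : Val) (h1 : (1 : ℝ) / 2 ^ B.length < β) (h2 : (1 : ℝ) / 2 ^ B.length < lam) :
    ∃ β' lam' : ℝ, |β' - β| ≤ 1 / 2 ^ B.length ∧ |lam' - lam| ≤ 1 / 2 ^ B.length ∧
      IsParams (Val.params O B) β' lam' (B.length + k + 2) := by
  have hb := hO .interaction B.length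
  have hl := hO .field B.length
  simp only [isingParams] at hb hl
  have h2B : (0 : ℝ) < 2 ^ B.length := by positivity
  have h2B' : (1 : ℝ) / 2 ^ B.length ≤ 1 :=
    (div_le_one h2B).2 (one_le_pow₀ (by norm_num))
  have hk1 : (1 : ℝ) ≤ 2 ^ k := one_le_pow₀ (by norm_num)
  have hsize : ∀ {x : ℝ} {m : ℕ}, x ≤ 2 ^ k → |(m : ℝ) / 2 ^ B.length - x| ≤ 1 / 2 ^ B.length →
      m.size ≤ B.length + k + 2 := by
    intro x m hx hm
    rw [Nat.size_le]
    -- The quotient is at most `x + 1 ≤ 2 ^ k + 1`; the factor `4` accounts for the `2` in the digit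
    -- bound.
    have h3 : (m : ℝ) / 2 ^ B.length < 2 ^ k * 4 := by linarith [(abs_le.1 hm).2]
    rw [div_lt_iff₀ h2B] at h3
    have h4 : (m : ℝ) < 2 ^ (B.length + k + 2) := by
      refine h3.trans_eq ?_
      rw [pow_add, pow_add]; ring
    exact_mod_cast h4
  have hpos : ∀ {x : ℝ} {m : ℕ}, 1 / 2 ^ B.length < x →
      |(m : ℝ) / 2 ^ B.length - x| ≤ 1 / 2 ^ B.length → 0 < m := by
    intro x m hx hm
    have h3 : 0 < (m : ℝ) / 2 ^ B.length := by linarith [(abs_le.1 hm).1]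
    rw [div_pos_iff_of_pos_right h2B] at h3
    exact_mod_cast h3
  refine ⟨_, _, hb, hl, _, _, _, rfl, ?_, ?_, ?_, ?_, ?_, ?_, ?_, ?_⟩
  · rw [Val.length_ofNat]; exact hsize hlam hl
  · rw [Val.length_ofNat]; exact hsize (hβ1.le.trans hk1) hb
  · rw [Val.length_powTwo]; omega
  · rw [Val.toNat_ofNat]; exact hpos h2 hl
  · rw [Val.toNat_ofNat]; exact hpos h1 hb
  · rw [Val.toNat_powTwo]; positivity
  · rw [Val.toNat_ofNat, Val.toNat_powTwo]; push_cast; rfl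
  · rw [Val.toNat_ofNat, Val.toNat_powTwo]; push_cast; rfl

theorem digits_bound {X W n m l₀ : ℕ} (hX : 1 ≤ X) (hn : n + 1 ≤ X) (hm : m ≤ X) (hl : l₀ ≤ X)
    (hW : W ≤ X) : 1 + (n + 1) * (2 * (l₀ + digitScale n l₀ * (W - 1)) + 3) +
      (2 * (m * l₀) + l₀ + 1) ≤ 80 * X ^ 4 := by
  have h2 : X ≤ X ^ 2 := Nat.le_self_pow (by omega) _
  have h3 : X ≤ X ^ 3 := Nat.le_self_pow (by omega) _
  have h4 : X ≤ X ^ 4 := Nat.le_self_pow (by omega) _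
  have h5 : X ^ 2 ≤ X ^ 4 := Nat.pow_le_pow_right hX (by omega)
  have hd : digitScale n l₀ ≤ 32 * X ^ 2 := by
    calc digitScale n l₀ ≤ 4 * X + 8 + 12 * X + 8 * (X * X) := by
          unfold digitScale
          gcongr <;> omega
      _ ≤ 32 * X ^ 2 := by nlinarith
  have hd' : digitScale n l₀ * (W - 1) ≤ 32 * X ^ 3 := by
    calc digitScale n l₀ * (W - 1) ≤ 32 * X ^ 2 * X := Nat.mul_le_mul hd (by omega)
      _ = _ := by ring
  calc _ ≤ 1 + X * (2 * (X + 32 * X ^ 3) + 3) + (2 * (X * X) + X + 1) := by gcongr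
    _ = 2 + 64 * X ^ 4 + 4 * X ^ 2 + 4 * X := by ring
    _ ≤ _ := by omega

theorem approximates_of_log {x y δ ε : ℝ} (hx : 0 < x) (hy : 0 < y)
    (h : |Real.log x - Real.log y| ≤ δ) (hδ : δ ≤ 1 / 2) (hε : δ ≤ ε / 2) :
    (1 - ε) * y ≤ x ∧ x ≤ (1 + ε) * y := by
  have hδ0 := (abs_nonneg _).trans h
  obtain ⟨h1, h2⟩ := abs_le.1 h
  rw [← Real.log_div hx.ne' hy.ne'] at h1 h2
  have hxy : 0 < x / y := div_pos hx hy
  have h3 : x / y ≤ Real.exp δ := (Real.log_le_iff_le_exp hxy).1 h2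
  have h4 : Real.exp (-δ) ≤ x / y := (Real.le_log_iff_exp_le hxy).1 (by linarith)
  have h5 : 1 - δ ≤ Real.exp (-δ) := by linarith [Real.add_one_le_exp (-δ)]
  -- From `exp (-δ) ≥ 1 - δ` and `(1 + 2 δ)(1 - δ) ≥ 1`, valid for `0 ≤ δ ≤ 1/2`.
  have h6 : Real.exp δ ≤ 1 + 2 * δ := by
    have h7 : Real.exp δ * Real.exp (-δ) = 1 := by rw [← Real.exp_add]; simp
    nlinarith [Real.exp_pos δ]
  rw [← le_div_iff₀ hy, ← div_le_iff₀ hy]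
  constructor <;> linarith

end TreeMachine

/-! ### Total error, size of the budget, and the approximation scheme -/

namespace TreeMachine

open HypergraphSpin

/-- If the budget is `a * s + b`, the error of the chain with perturbed parameters is small. -/
theorem chain_error {Δ : ℕ} {β β₀ lam θ τ β' lam' Λ₀ : ℝ} (hD : DecayParams Δ β₀ Λ₀ θ)
    (hβ : β₀ ≤ β) (hβ' : β₀ ≤ β') (hβ1' : β' ≤ 1) (hl : 0 < lam) (hl' : lam / 2 ≤ lam')
    (hΛ : |Real.log lam'| ≤ Λ₀) (hτ : θ ≤ τ) (hτ2 : 1 / 2 ≤ τ)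
    {a b s l : ℕ} (ha : τ ^ a ≤ 1 / 2)
    (hb : τ ^ b * (4 * (Δ * -Real.log β₀ + (1 / β₀ + 2 / lam))) ≤ 1)
    {n : ℕ} {S : List ℕ} (hSn : S.Nodup) (hS : ∀ u, u ∈ S ↔ u ∈ Finset.range n)
    {I : List LabelledEdge} (hI : Admissible (Finset.range n) Δ I)
    (hon : ∀ e ∈ I, e.zeroOn = true) (hs : (n + 1) * (I.length + 1) * 2 ^ l ≤ 2 ^ s)
    (hbβ : |β' - β| ≤ 1 / 2 ^ (a * s + b)) (hbl : |lam' - lam| ≤ 1 / 2 ^ (a * s + b)) :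
    0 < β' ^ I.length / chainProb (approxRatio β' lam' (a * s + b)) false S I ∧
    |Real.log (β' ^ I.length / chainProb (approxRatio β' lam' (a * s + b)) false S I) -
      Real.log (total β lam (Finset.range n) I 1)| ≤ 1 / 2 ^ l / 4 := by
  have hβ0 := hD.beta_pos
  have hL : 0 ≤ -Real.log β₀ := by linarith [Real.log_nonpos hβ0.le hD.beta_le]
  have hl'0 : 0 < lam' := by linarith
  set B := a * s + b with hB
  have hc : 0 < chainProb (approxRatio β' lam' B) false S I :=
    (chainProb_mem (fun u hu J hJ => (approxRatio_error hD hβ' hβ1' hl'0 hΛ B u hu J hJ).1)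
      false S (fun u hu => (hS u).1 hu) I hI).1
  refine ⟨div_pos (pow_pos (hβ0.trans_le hβ') _) hc, ?_⟩
  have e1 := total_error hD hβ' hβ1' hl'0 hΛ B S hSn hS I hI hon
  have hτ0 : 0 < τ := by linarith
  have hcard : S.length = n := by
    rw [← List.toFinset_card_of_nodup hSn, show S.toFinset = Finset.range n by ext u; simp [hS],
      Finset.card_range]
  have hθB : θ ^ B ≤ τ ^ B := pow_le_pow_left₀ hD.theta_pos.le hτ _
  -- With `τ ≥ 1/2`, one power of `τ` controls the truncation error and the oracle error.
  have h2B : (1 : ℝ) / 2 ^ B ≤ τ ^ B := by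
    rw [← one_div_pow]; exact pow_le_pow_left₀ (by norm_num) hτ2 _
  set κ := 1 / β₀ + 2 / lam with hκ
  have hκ1 : 1 / β₀ ≤ κ := by rw [hκ]; linarith [show 0 < 2 / lam by positivity]
  have hκ2 : 2 / lam ≤ κ := by rw [hκ]; linarith [show 0 < 1 / β₀ by positivity]
  have hκ0 : 0 ≤ κ := le_trans (by positivity) hκ1
  have e2 := abs_log_total_sub_le (η := τ ^ B * κ) (hβ0.trans_le hβ) (hβ0.trans_le hβ') hl hl'0
    (by
      refine (abs_log_sub_log_le hβ0 hβ' hβ hbβ).trans ?_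
      rw [div_eq_mul_one_div]
      gcongr)
    (by
      refine (abs_log_sub_log_le (half_pos hl) hl' (by linarith) hbl).trans ?_
      rw [div_eq_mul_one_div, one_div_div]
      gcongr) (Finset.range n) I
  rw [Finset.card_range] at e2
  rw [hcard] at e1
  set C := Δ * -Real.log β₀ with hC
  have hC0 : 0 ≤ C := by positivity
  -- The factor `a` of the budget turns `τ ^ (a s)` into `2 ^ (-s)`, which absorbs `n + m` and the
  -- accuracy; `b` absorbs the constants.
  have hτB : τ ^ B ≤ (1 / 2) ^ s * τ ^ b := by
    rw [hB, pow_add, pow_mul]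
    gcongr
  have hs' : ((n : ℝ) + I.length) * 2 ^ l ≤ 2 ^ s := by
    have : (n + I.length) * 2 ^ l ≤ 2 ^ s := le_trans (by gcongr; nlinarith) hs
    exact_mod_cast this
  -- The intermediate quantity is the exact partition function at the perturbed parameters.
  calc _ ≤ _ := abs_sub_le _ (Real.log (total β' lam' (Finset.range n) I 1)) _
    _ ≤ n * (C * θ ^ B) + (n + I.length : ℕ) * (τ ^ B * κ) := add_le_add e1 e2
    _ ≤ (n + I.length) * (C * τ ^ B) + (n + I.length) * (τ ^ B * κ) := by
        have hθ := hD.theta_pos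
        have hn : (n : ℝ) ≤ n + I.length := le_add_of_nonneg_right (by positivity)
        push_cast
        gcongr
    _ = (n + I.length) * (τ ^ B * (C + κ)) := by ring
    _ ≤ (n + I.length) * ((1 / 2) ^ s * τ ^ b * (C + κ)) := by gcongr
    _ = (n + I.length) / 2 ^ s * (τ ^ b * (4 * (C + κ)) / 4) := by rw [one_div_pow]; ring
    _ ≤ 1 / 2 ^ l * (1 / 4) := by
        refine mul_le_mul ?_ (by linarith) (by positivity) (by positivity)
        rw [div_le_div_iff₀ (by positivity) (by positivity), one_mul]
        exact hs'
    _ = _ := by ring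

/-- The budget is logarithmic in the size of the input and the inverse of the accuracy. -/
theorem two_pow_budget_le {a b d Y : ℕ} {n r : Val} {ε : ℚ} (hε : 0 < ε) (hn : n.length ≤ Y)
    (hr : r.length ≤ Y) (hY : ⌈1 / ε⌉₊ ≤ Y) :
    (2 ^ d) ^ (Val.budget a b n r (.ofNat ε.num.toNat) (.ofNat ε.den)).length ≤
      2 ^ (d * b) * (2 * Y + 1) ^ (3 * d * a) := by
  have h3 := (two_pow_digits_mul ε hε).2
  rw [length_budget, Val.length_ofNat, Val.length_ofNat]
  calc _ = 2 ^ (d * b) * (2 ^ (Val.count n).length * 2 ^ (Val.count r).length *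
        2 ^ (ε.den.size - ε.num.toNat.size)) ^ (d * a) := by
        rw [← pow_add, ← pow_add, ← pow_mul, ← pow_mul, ← pow_add]; congr 1; ring
    _ ≤ 2 ^ (d * b) * ((2 * Y + 1) * (2 * Y + 1) * (2 * Y + 1)) ^ (d * a) := by
        gcongr
        · exact (Val.two_pow_length_count_le n).trans (by omega)
        · exact (Val.two_pow_length_count_le r).trans (by omega)
        · omega
    _ = _ := by rw [← pow_three', ← pow_mul]; congr 2; ring

end TreeMachine

open TreeMachine HypergraphSpin in
theorem theorem2 (Δ : ℕ) (β lam : ℝ) (hβ0 : 0 < β) (hβ1 : β < 1) (hlam : 0 < lam)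
    (hβ : 1 - 2 / (2 * Real.exp (-1 / 2) * (Δ : ℝ) + 3) ≤ β) :
    HypergraphSpin.HasFPTAS (HypergraphSpin.isingParams β lam)
      (fun _ G => HypergraphSpin.maxDegree G ≤ (Δ : ℕ∞))
      (fun _ G => HypergraphSpin.isingPartitionFunction β lam G) := by
  -- The extra `1` is room for the field from the oracle, whose logarithm is off by at most `1`.
  obtain ⟨β₀, θ, hβ₀, hD⟩ := exists_decayParams hβ0 hβ1 hβ (|Real.log lam| + 1)
  have hβ₀0 := hD.beta_pos
  set τ := max θ (1 / 2) with hτ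
  have hτ0 : 0 ≤ τ := le_trans (by norm_num) (le_max_right θ (1 / 2))
  have hτ1 : τ < 1 := max_lt hD.theta_lt (by norm_num)
  obtain ⟨a, ha⟩ := exists_pow_lt_of_lt_one (show (0 : ℝ) < 1 / 2 by norm_num) hτ1
  set K := 4 * (Δ * -Real.log β₀ + (1 / β₀ + 2 / lam)) with hK
  have hK0 : 0 < K := by
    have := Real.log_nonpos hβ₀0.le hD.beta_le
    have : 0 ≤ Δ * -Real.log β₀ := mul_nonneg (by positivity) (by linarith)
    positivity
  -- The four bounds ensure `β' ≤ 1`, `β₀ ≤ β'`, `lam / 2 ≤ lam'`, and that the constant `K` of the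
  -- error is absorbed.
  obtain ⟨b, hb⟩ := exists_pow_lt_of_lt_one (show 0 < min (min (1 - β) (β - β₀))
    (min (lam / 2) (1 / K)) from lt_min (lt_min (by linarith) (by linarith))
      (lt_min (by linarith) (by positivity))) hτ1
  simp only [lt_min_iff] at hb
  obtain ⟨⟨hb1, hb2⟩, hb3, hb4⟩ := hb
  obtain ⟨k, hk⟩ := pow_unbounded_of_one_lt lam (one_lt_two)
  set d := 8 * Δ + 2 with hd
  refine ⟨isingProgram a b, Polynomial.C (100000 * (Δ + a + b + 1)) *
    (Polynomial.C 80 * (Polynomial.X + Polynomial.C (2 ^ (d * b)) *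
      (Polynomial.C 2 * Polynomial.X + 1) ^ (3 * d * a) + Polynomial.C (k + 2)) ^ 4 + 1) ^ 6, ?_⟩
  intro O hO α G hG vs es hvs ε hε
  set n := Val.ofUnary vs.length with hn
  set r := incidenceMatrix vs es with hr
  set num := Val.ofNat ε.num.toNat with hnum
  set den := Val.ofNat ε.den with hden
  have hinput : encodeInput vs es ε = .cons (.cons n r) (.cons num den) := rfl
  have hnlen : n.length = vs.length := Val.length_ofUnary _
  have hrlen : r.length = es.length := by rw [hr, incidenceMatrix, length_ofList, List.length_map]
  rw [hinput]
  have hsize : n.length + r.length + num.length + den.length + 1 ≤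
      (Val.cons (.cons n r) (.cons num den)).size := by
    have h1 := Val.length_le_size n
    have h2 := Val.length_le_size r
    have h3 := Val.length_le_size num
    have h4 := Val.length_le_size den
    simp only [Val.size]
    omega
  have hE : 0 < ⌈1 / ε⌉₊ := Nat.ceil_pos.2 (by positivity)
  obtain ⟨Y, hY⟩ : ∃ Y, Y = (Val.cons (.cons n r) (.cons num den)).size + ⌈1 / ε⌉₊ := ⟨_, rfl⟩
  rw [← hY]
  have hEeval : ∀ A W Z : ℕ, Polynomial.eval Y (Polynomial.C A *
    (Polynomial.C 80 * (Polynomial.X + Polynomial.C W *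
      (Polynomial.C 2 * Polynomial.X + 1) ^ (3 * d * a) + Polynomial.C Z) ^ 4 + 1) ^ 6) =
      A * (80 * (Y + W * (2 * Y + 1) ^ (3 * d * a) + Z) ^ 4 + 1) ^ 6 := by
    intro A W Z
    simp
  rw [hEeval]
  have hW := two_pow_budget_le (a := a) (b := b) (d := d) (n := n) (r := r) (Y := Y) hε (by omega)
    (by omega) (by omega)
  rw [← hnum, ← hden] at hW
  set B := Val.budget a b n r num den with hB
  -- Bounding the base `d` by `2 ^ d` reduces the claim to powers of two, which the digit counts in
  -- the budget turn into a polynomial in `Y`.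
  have hW' : d ^ B.length ≤ 2 ^ (d * b) * (2 * Y + 1) ^ (3 * d * a) :=
    (Nat.pow_le_pow_left Nat.lt_two_pow_self.le _).trans hW
  have hBW : B.length ≤ d ^ B.length := (Nat.lt_pow_self (by omega)).le
  set s := (Val.count n).length + (Val.count r).length + (den.length - num.length) with hs
  have hBlen : B.length = a * s + b := length_budget n r num den
  have h2B : (1 : ℝ) / 2 ^ B.length ≤ τ ^ b := by
    rw [← one_div_pow]
    calc (1 / 2 : ℝ) ^ B.length ≤ τ ^ B.length :=
          pow_le_pow_left₀ (by norm_num) (le_max_right _ _) _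
      _ ≤ τ ^ b := pow_le_pow_of_le_one hτ0 hτ1.le (by omega)
  obtain ⟨β', lam', e1, e2, hparams⟩ := isParams_of_presents hO hβ1 hk.le B (by linarith)
    (by linarith)
  obtain ⟨f1, f2⟩ := abs_le.1 e1
  obtain ⟨f3, f4⟩ := abs_le.1 e2
  have hIe := hvs.admissible hG
  obtain ⟨X, hX⟩ : ∃ X, X = Y + 2 ^ (d * b) * (2 * Y + 1) ^ (3 * d * a) + (k + 2) := ⟨_, rfl⟩
  rw [← hX]
  have hX1 : X ≤ 80 * X ^ 4 :=
    (Nat.le_self_pow (by omega) X).trans (Nat.le_mul_of_pos_left _ (by omega))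
  obtain ⟨w, t, hrun, ht, hw⟩ := isingProgram_runs (Δ := Δ) (M := 80 * X ^ 4) hparams
    (by rw [hr, toEdges_rows, hnlen]; exact hIe)
    (by rw [hnlen]; exact le_of_mem_toVertices_incidenceMatrix vs es) (by omega)
    (by omega) (by omega) (by omega) (show d ^ B.length ≤ _ by omega)
    (digits_bound (by omega) (by omega) (by omega) (by omega) (show d ^ B.length ≤ X by omega))
  refine ⟨w, t, hrun, ht, ?_⟩
  beta_reduce
  rw [hw, hr, toEdges_rows, ← hr, hvs.isingPartitionFunction_eq, ← hB, hBlen]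
  have hdig := (two_pow_digits_mul ε hε).1
  have hl' : lam / 2 ≤ lam' := by linarith
  have herr := chain_error (s := s) (l := den.length - num.length)
    (S := (Val.vertices n).toVertices)
    (n := vs.length) (τ := τ) (a := a) (b := b) (I := es.map (encodedEdge vs)) (β := β) (lam := lam)
    (β' := β') (lam' := lam') hD hβ₀.le
    (by linarith) (by linarith) hlam hl' (by
      have h1 := abs_log_sub_log_le (y := lam) (δ := lam / 2) (half_pos hlam) hl' (by linarith)
        (by rw [abs_le]; constructor <;> linarith)
      rw [div_self (half_pos hlam).ne'] at h1
      have h2 := abs_sub_abs_le_abs_sub (Real.log lam') (Real.log lam)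
      linarith)
    (le_max_left _ _) (le_max_right _ _) ha.le
    (by rw [← hK]; exact ((lt_div_iff₀ hK0).1 hb4).le)
    (Val.toVertices_vertices n).1
    (fun u => by rw [(Val.toVertices_vertices n).2, hnlen, Finset.mem_range]) hIe
    (fun e he => by obtain ⟨e, -, rfl⟩ := List.mem_map.1 he; rfl)
    (by
      rw [List.length_map, ← hnlen, ← hrlen, hs, pow_add, pow_add]
      gcongr
      · exact Val.lt_two_pow_length_count n
      · exact Val.lt_two_pow_length_count r)
    (by rwa [← hBlen]) (by rwa [← hBlen])
  rw [List.length_map, ← hrlen] at herr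
  refine approximates_of_log herr.1 (total_one_pos hβ0 hlam _ _) herr.2 ?_ ?_
  · have : (1 : ℝ) / 2 ^ (den.length - num.length) ≤ 1 :=
      (div_le_one (by positivity)).2 (one_le_pow₀ (by norm_num))
    linarith
  -- A quarter of `2 ε` is the `ε / 2` that `approximates_of_log` asks for.
  · have : (1 : ℝ) / 2 ^ (den.length - num.length) ≤ 2 * ε := by
      rw [div_le_iff₀ (by positivity), mul_comm, hden, hnum, Val.length_ofNat, Val.length_ofNat]
      exact hdig
    linarith
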